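/- **Model.** Algorithms are randomized programs in a fixed general-purpose model of computation with fair coins and unit-cost steps that is polynomially equivalent to probabilistic Turing machines (concretely: while-programs over binary trees). A program runs in time $T$ on an input if it halts within $T$ steps for all outcomes of its coins. Graphs on $n$ labelled vertices are given by their adjacency matrices. Let $\mathcal G(n,\frac12)$ be the distribution of the Erdős–Rényi random graph on $n$ labelled vertices with edge probability $\frac12$, and let $\mathcal G(n,\frac12,\kappa)$ be the distribution obtained by choosing a uniformly random set of $\kappa$ vertices and adding all edges within this set to a graph drawn from $\mathcal G(n,\frac12)$. **Strongish Planted Clique Hypothesis (SPCH).** There is a constant $\delta\in(0,\frac12)$ such that no randomized algorithm $\mathcal A$ with running time $n^{o(\log n)}$ on $n$-vertex graphs satisfies, for all sufficiently large $n$, both $$\Pr_{G\sim\mathcal G(n,\frac12,\lceil n^\delta\rceil)}[\mathcal A(G)=1]\ \ge\ \tfrac23\qquad\text{and}\qquad \Pr_{G\sim\mathcal G(n,\frac12)}[\mathcal A(G)=1]\ \le\ \tfrac13 ,$$ where the probabilities are over $G$ and the coins of $\mathcal A$. **Theorem.** Assume SPCH. Let $(H_i)_{i\in\mathbb N}$ be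 any sequence of graphs (patterns), where $H_i$ has $k_i$ vertices and $k_i\to\infty$. Then there is no randomized algorithm that solves induced pattern detection for these patterns in time $f(k)\cdot n^{o(k)}$, for any function $f$. That is, there are no algorithm $\mathcal A$ and functions $f,g:\mathbb N\to\mathbb R$ with $g(k)=o(k)$ such that, for every $i$ and every graph $G$ on $n\ge1$ vertices, $\mathcal A$, given the pattern and $G$, halts within time $f(k_i)\cdot n^{g(k_i)}$ and decides with probability of error at most $\frac13$ whether $G$ contains an induced subgraph isomorphic to $H_i$. Here the $i$-th pattern may be given to $\mathcal A$ by any code $c_i$ that is computable from $i$: by its index $c_i=i$, for an arbitrary sequence $(H_i)$, or explicitly as $c_i=H_i$, if the sequence $(H_i)$ is computable. -/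

import Mathlib

open Filter MeasureTheory
open scoped ENNReal Asymptotics

/-! ### The model of computation

Randomized structured programs on binary trees: the `WHILE` language of tree-manipulating
programs (in a one-variable, point-free presentation) together with a fair coin. Every elementary
operation, every composition, every branching and every test of a loop costs one unit of time.
Trees only grow by sharing and are only inspected through their immediate subtrees, so that this
cost measure is polynomially equivalent to the running time of probabilistic Turing machines. -/

/-- Binary trees, the data on which programs operate. -/
inductive BTree : Type
  | nil : BTree
  | cons : BTree → BTree → BTree

namespace BTree

/-- Left subtree (and `nil` for `nil`). -/
def left : BTree → BTree
  | nil => nil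
  | cons x _ => x

/-- Right subtree (and `nil` for `nil`). -/
def right : BTree → BTree
  | nil => nil
  | cons _ y => y

/-- Bits: `nil` is "false" and the tree with a single inner node is "true". -/
def ofBool : Bool → BTree
  | false => nil
  | true => cons nil nil

/-- Lists of trees. -/
def ofList : List BTree → BTree
  | [] => nil
  | x :: l => cons x (ofList l)

/-- Natural numbers in unary. -/
def ofNat (n : ℕ) : BTree := ofList (List.replicate n nil)

open Classical in
/-- A graph on `n` labelled vertices, given by its adjacency matrix (the list of its rows). -/
noncomputable def ofGraph {n : ℕ} (G : SimpleGraph (Fin n)) : BTree :=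
  ofList (List.ofFn fun u => ofList (List.ofFn fun v => ofBool (decide (G.Adj u v))))

end BTree

/-- Programs. A program maps an input tree to an output tree.
* `id`, `nil`, `left`, `right`: return the input, the empty tree, the left or right subtree;
* `flip`: return a fresh uniformly random bit;
* `pair p q`: run `p` and then `q`, both on the input `x`, and return `cons (p x) (q x)`;
* `comp q p`: run `p`, then run `q` on the result;
* `ite c p q`: run `c` on the input; run `p` on the input if the result of `c` is not `nil`, and
  `q` if it is `nil`;
* `loop c p`: starting with the input as current value, replace the current value by its image
  under `p` as long as `c`, run on the current value, returns something else than `nil`; then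
  return the current value. -/
inductive Prog : Type
  | id : Prog
  | nil : Prog
  | left : Prog
  | right : Prog
  | flip : Prog
  | pair : Prog → Prog → Prog
  | comp : Prog → Prog → Prog
  | ite : Prog → Prog → Prog → Prog
  | loop : Prog → Prog → Prog

namespace Prog

/-- The possible results of a run with a limited amount of time: the output together with the
amount of time that is left, or `none` if the time did not suffice. -/
abbrev Result : Type := Option (BTree × ℕ)

/-- Spend one unit of time, then continue. -/
noncomputable def tick (t : ℕ) (f : ℕ → PMF Result) : PMF Result :=
  match t with
  | 0 => PMF.pure none
  | s + 1 => f s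

/-- Continue with the output and the remaining time of a run, if it finished in time. -/
noncomputable def andThen (m : PMF Result) (f : BTree → ℕ → PMF Result) : PMF Result :=
  m.bind fun r =>
    match r with
    | none => PMF.pure none
    | some (y, s) => f y s

open Classical in
/-- Run the loop with test `c` and body `p` on `x` with time `t`. As each test costs at least one
unit of time, `t` rounds are enough, and the first argument is a bound on the number of rounds. -/
noncomputable def evalLoop (c p : BTree → ℕ → PMF Result) : ℕ → BTree → ℕ → PMF Result
  | 0, _, _ => PMF.pure none
  | m + 1, x, t =>
    tick t fun t₁ => andThen (c x t₁) fun b t₂ =>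
      if b = BTree.nil then PMF.pure (some (x, t₂))
      else andThen (p x t₂) fun y t₃ => evalLoop c p m y t₃

open Classical in
/-- `eval p x t` is the distribution of the result of the program `p` on the input `x` when `t`
units of time are available. -/
noncomputable def eval : Prog → BTree → ℕ → PMF Result
  | id, x, t => tick t fun s => PMF.pure (some (x, s))
  | nil, _, t => tick t fun s => PMF.pure (some (BTree.nil, s))
  | left, x, t => tick t fun s => PMF.pure (some (x.left, s))
  | right, x, t => tick t fun s => PMF.pure (some (x.right, s))
  | flip, _, t => tick t fun s =>
      (PMF.uniformOfFintype Bool).map fun b => some (BTree.ofBool b, s)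
  | pair p q, x, t => tick t fun t₁ => andThen (eval p x t₁) fun y t₂ =>
      andThen (eval q x t₂) fun z t₃ => PMF.pure (some (BTree.cons y z, t₃))
  | comp q p, x, t => tick t fun t₁ => andThen (eval p x t₁) (eval q)
  | ite c p q, x, t => tick t fun t₁ => andThen (eval c x t₁) fun b t₂ =>
      if b = BTree.nil then eval q x t₂ else eval p x t₂
  | loop c p, x, t => evalLoop (eval c) (eval p) t x t

/-- On the input `x` the program halts within time `T`, whatever the outcomes of its coins. -/
def HaltsWithin (A : Prog) (x : BTree) (T : ℝ) : Prop :=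
  ∃ t : ℕ, (t : ℝ) ≤ T ∧ eval A x t none = 0

/-- The probability, over the coins of the program, that it halts on the input `x` and accepts,
that is, returns something else than `nil`. -/
noncomputable def acceptProb (A : Prog) (x : BTree) : ℝ≥0∞ :=
  ⨆ t : ℕ, (eval A x t).toOuterMeasure {r | ∃ y s, r = some (y, s) ∧ y ≠ BTree.nil}

/-- On the input `x` the program always halts, after a bounded time, with the output `y`. -/
def Outputs (A : Prog) (x y : BTree) : Prop :=
  ∃ t : ℕ, ∀ r ∈ (eval A x t).support, ∃ s, r = some (y, s)

end Prog

/-! ### Planted cliques -/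

/-- The Erdős–Rényi distribution `𝒢(n, 1/2)` on graphs with `n` labelled vertices. -/
noncomputable def erdosRenyiHalf (n : ℕ) : Measure (SimpleGraph (Fin n)) :=
  SimpleGraph.binomialRandom (Fin n) ⟨1 / 2, by norm_num, by norm_num⟩

/-- The graph whose edges are all pairs of distinct elements of `S`. -/
def cliqueOn {n : ℕ} (S : Finset (Fin n)) : SimpleGraph (Fin n) :=
  SimpleGraph.fromRel fun u v => u ∈ S ∧ v ∈ S

/-- The distribution `𝒢(n, 1/2, κ)`, for `κ ≤ n`: all edges within a uniformly random set of `κ`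
vertices are added to a graph drawn from `𝒢(n, 1/2)`. -/
noncomputable def plantedClique (n κ : ℕ) : Measure (SimpleGraph (Fin n)) :=
  ((n.choose κ : ℝ≥0∞)⁻¹) •
    ∑ S ∈ (Finset.univ : Finset (Fin n)).powersetCard κ,
      (erdosRenyiHalf n).map fun G => G ⊔ cliqueOn S

/-- The Strongish Planted Clique Hypothesis: for some constant `δ ∈ (0, 1/2)`, no randomized
`n ^ o(log n)`-time algorithm distinguishes, for all large `n`, between `𝒢(n, 1/2, ⌈n ^ δ⌉)` and
`𝒢(n, 1/2)`. Probabilities are over the graph and the coins of the algorithm. -/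
def StrongishPlantedCliqueHypothesis : Prop :=
  ∃ δ : ℝ, 0 < δ ∧ δ < 1 / 2 ∧
    ¬ ∃ (A : Prog) (h : ℕ → ℝ),
      h =o[atTop] (fun n : ℕ => Real.log n) ∧
      ∀ᶠ n : ℕ in atTop,
        (∀ G : SimpleGraph (Fin n), A.HaltsWithin (BTree.ofGraph G) ((n : ℝ) ^ h n)) ∧
        2 / 3 ≤ ∫⁻ G, A.acceptProb (BTree.ofGraph G) ∂(plantedClique n ⌈(n : ℝ) ^ δ⌉₊) ∧
        ∫⁻ G, A.acceptProb (BTree.ofGraph G) ∂(erdosRenyiHalf n) ≤ 1 / 3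

/-! ### Induced pattern detection -/

/-- The randomized algorithm `A` solves induced pattern detection for the patterns `H i` in time
`T i n`, where the pattern `H i` is presented to the algorithm by the code `code i`: given `code i`
and a nonempty host graph `G`, on `n` vertices say, it decides whether `G` has an induced subgraph
isomorphic to `H i`, with probability of error at most `1/3` and within time `T i n`. -/
def SolvesInducedDetection (A : Prog) {k : ℕ → ℕ} (H : ∀ i, SimpleGraph (Fin (k i)))
    (code : ℕ → BTree) (T : ℕ → ℕ → ℝ) : Prop :=
  ∀ i n : ℕ, 1 ≤ n → ∀ G : SimpleGraph (Fin n),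
    A.HaltsWithin (BTree.cons (code i) (BTree.ofGraph G)) (T i n) ∧
    ((H i).IsIndContained G →
      2 / 3 ≤ A.acceptProb (BTree.cons (code i) (BTree.ofGraph G))) ∧
    (¬ (H i).IsIndContained G →
      A.acceptProb (BTree.cons (code i) (BTree.ofGraph G)) ≤ 1 / 3)

/-! A detection algorithm becomes a distinguisher for planted cliques by passing from a graph `G` on
`n` vertices to a graph on random tuples of its vertices. Let `P` be a pattern with `k` vertices.
Complementing both pattern and host does not affect induced containment, so `P` may be assumed to
have at least `k * k / 4` ordered adjacent pairs. For each vertex ("colour") of `P` one draws `M`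
random tuples of length `l`. Two tuples are joined if their colours are adjacent in `P` and every
vertex of one equals or is adjacent in `G` to every vertex of the other. With `e = C * (⌊log₂ n⌋ / k
+ 1)`, rounded down, one takes `l = 2 * d * e` and `M = n ^ (2 * (d - 1) * e)`.

If `G` has a planted clique of size about `n ^ δ`, then with high probability some tuple of each
colour lies inside it, and these tuples induce a copy of `P` (`isIndContained_instGraph_of_clique`,
`clique_bound`). If `G` is purely random, then with high probability any `r = k / 8` tuples together
have more than `u = r * e` vertices (`avg_not_spread_le`). A dense pattern has at least `r` vertices
of degree at least `r`, so every copy of it forces at least `u * (u + 1) / 2` edges of `G`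
(`exists_forced_edges`). Since `k * e ≥ C * log₂ n` up to rounding, the probability `2 ^ (-u * (u +
1) / 2)` beats the number `(M * k) ^ k` of conceivable copies once `C` is large
(`erdosRenyiHalf_isIndContained_le`, `edges_bound`).

The instance has `n ^ O(log n / k)` vertices, so for a fixed pattern a detection algorithm with time
`f(k) * N ^ g(k)` needs time `exp (η * log n ^ 2)`, where `η` becomes arbitrarily small as `k`
grows. To obtain the exponent `o(log n)` the pattern has to vary with `n`, but `f` and `g` need not
be computable and the best index is unknown. Therefore the reductions for all indices below `n` are
run in parallel on the same coins, and the first answer is adopted (`Prog.exists_parallel`). This is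
as fast as the best index up to a polynomial (`isLittleO_logb_bestTime`). It is correct because each
index errs with probability `O(1 / n ^ 2)`, thanks to a majority vote over `n ^ 2` runs
(`Prog.vote_error`), and a union bound covers all indices.

The patterns need not be given explicitly: an algorithm that detects them determines them, since a
nonempty pattern is the smallest host graph that contains it (`exists_fn_pattern`).

On the side of the machine model, probabilities are averages over finite coin tapes
(`Prog.simulates_runT`). The programs are assembled from functions known to be computable or
polynomial-time (`Fn`), among them the clocked simulation of any fixed program (`Prog.fn_runT`). -/

/-! ### Tape semantics -/

namespace BTree

/-- The test for the empty tree. -/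
def isNil : BTree → Bool
  | nil => true
  | cons _ _ => false

theorem isNil_iff {x : BTree} : x.isNil = true ↔ x = nil := by
  cases x <;> simp [isNil]

theorem isNil_eq_false_iff {x : BTree} : x.isNil = false ↔ x ≠ nil := by
  cases x <;> simp [isNil]

end BTree

namespace Prog

/-- The result of a run on a given coin tape: output, remaining time, remaining tape. -/
abbrev TapeResult : Type := Option (BTree × ℕ × List Bool)

/-- Spend one unit of time, then continue. -/
def tickT (t : ℕ) (f : ℕ → TapeResult) : TapeResult :=
  match t with
  | 0 => none
  | s + 1 => f s

/-- Loops, with coins taken from a tape. -/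
def loopT (c p : BTree → ℕ → List Bool → TapeResult) :
    ℕ → BTree → ℕ → List Bool → TapeResult
  | 0, _, _, _ => none
  | m + 1, x, t, w => tickT t fun t₁ => (c x t₁ w).bind fun r =>
      if r.1.isNil then some (x, r.2)
      else (p x r.2.1 r.2.2).bind fun r' => loopT c p m r'.1 r'.2.1 r'.2.2

/-- Run a program with time `t` and with the coins on the tape `w`. -/
def runT : Prog → BTree → ℕ → List Bool → TapeResult
  | id, x, t, w => tickT t fun s => some (x, s, w)
  | nil, _, t, w => tickT t fun s => some (BTree.nil, s, w)
  | left, x, t, w => tickT t fun s => some (x.left, s, w)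
  | right, x, t, w => tickT t fun s => some (x.right, s, w)
  | flip, _, t, w => tickT t fun s =>
      match w with
      | [] => none
      | b :: w' => some (BTree.ofBool b, s, w')
  | pair p q, x, t, w => tickT t fun s => (runT p x s w).bind fun r =>
      (runT q x r.2.1 r.2.2).bind fun r' => some (BTree.cons r.1 r'.1, r'.2)
  | comp q p, x, t, w => tickT t fun s => (runT p x s w).bind fun r => runT q r.1 r.2.1 r.2.2
  | ite c p q, x, t, w => tickT t fun s => (runT c x s w).bind fun r =>
      if r.1.isNil then runT q x r.2.1 r.2.2 else runT p x r.2.1 r.2.2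
  | loop c p, x, t, w => loopT (runT c) (runT p) t x t w

/-! ### Averages over coin tapes -/

/-- The average of `Φ` over all tapes of length `L`. -/
noncomputable def avg : ℕ → (List Bool → ℝ≥0∞) → ℝ≥0∞
  | 0, Φ => Φ []
  | L + 1, Φ => (avg L (fun w => Φ (true :: w)) + avg L (fun w => Φ (false :: w))) / 2

theorem ennreal_half_add (a : ℝ≥0∞) : (a + a) / 2 = a := by
  rw [← two_mul, mul_comm, ENNReal.mul_div_cancel_right (by simp) (by simp)]

@[simp] theorem avg_const (L : ℕ) (a : ℝ≥0∞) : avg L (fun _ => a) = a := by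
  induction L with
  | zero => rfl
  | succ L ih => simp only [avg, ih, ennreal_half_add]

theorem avg_congr {L : ℕ} {Φ Ψ : List Bool → ℝ≥0∞} (h : ∀ w, w.length = L → Φ w = Ψ w) :
    avg L Φ = avg L Ψ := by
  induction L generalizing Φ Ψ with
  | zero => exact h [] rfl
  | succ L ih =>
    simp only [avg]
    rw [ih (Φ := fun w => Φ (true :: w)) fun w hw => h _ (by simp [hw]),
      ih (Φ := fun w => Φ (false :: w)) fun w hw => h _ (by simp [hw])]

theorem avg_mono {L : ℕ} {Φ Ψ : List Bool → ℝ≥0∞} (h : ∀ w, w.length = L → Φ w ≤ Ψ w) :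
    avg L Φ ≤ avg L Ψ := by
  induction L generalizing Φ Ψ with
  | zero => exact h [] rfl
  | succ L ih =>
    simp only [avg]
    gcongr
    · exact ih fun w hw => h _ (by simp [hw])
    · exact ih fun w hw => h _ (by simp [hw])

theorem avg_add {L : ℕ} (Φ Ψ : List Bool → ℝ≥0∞) :
    avg L (fun w => Φ w + Ψ w) = avg L Φ + avg L Ψ := by
  induction L generalizing Φ Ψ with
  | zero => rfl
  | succ L ih =>
    simp only [avg, ih, ENNReal.div_add_div_same]
    congr 1
    ring

theorem avg_mul_left {L : ℕ} (a : ℝ≥0∞) (Φ : List Bool → ℝ≥0∞) :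
    avg L (fun w => a * Φ w) = a * avg L Φ := by
  induction L generalizing Φ with
  | zero => rfl
  | succ L ih => simp only [avg, ih, ← mul_add, mul_div_assoc]

theorem avg_sum {L : ℕ} {ι : Type*} (s : Finset ι) (Φ : ι → List Bool → ℝ≥0∞) :
    avg L (fun w => ∑ i ∈ s, Φ i w) = ∑ i ∈ s, avg L (Φ i) := by
  classical
  induction s using Finset.induction_on with
  | empty => simp
  | insert i s hi ih => simp only [Finset.sum_insert hi, avg_add, ih]

theorem avg_append (L K : ℕ) (Φ : List Bool → ℝ≥0∞) :
    avg (L + K) Φ = avg L (fun v => avg K (fun w => Φ (v ++ w))) := by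
  induction L generalizing Φ with
  | zero => simp [avg]
  | succ L ih => rw [Nat.add_right_comm]; simp [avg, ih]

theorem avg_eq_zero_iff {L : ℕ} {Φ : List Bool → ℝ≥0∞} :
    avg L Φ = 0 ↔ ∀ w, w.length = L → Φ w = 0 := by
  constructor
  · intro h w hw
    induction L generalizing Φ w with
    | zero => rw [List.length_eq_zero_iff] at hw; subst hw; exact h
    | succ L ih =>
      simp only [avg, ENNReal.div_eq_zero_iff, add_eq_zero, ENNReal.ofNat_ne_top, or_false] at h
      match w, hw with
      | true :: w, hw => exact ih h.1 w (by simpa using hw)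
      | false :: w, hw => exact ih h.2 w (by simpa using hw)
  · intro h
    rw [avg_congr h, avg_const]

/-! ### Tape semantics and distributional semantics -/

/-- The tape computation `F`, which starts with time `t`, has the distribution `m`. -/
def Simulates (t : ℕ) (F : List Bool → TapeResult) (m : PMF Result) : Prop :=
  ∀ L, t ≤ L → ∀ (Ψ : TapeResult → ℝ≥0∞) (c : Result → ℝ≥0∞), Ψ none = c none →
    (∀ y s L', s ≤ t → L + s ≤ L' + t →
      avg L' (fun w => Ψ (some (y, s, w))) = c (some (y, s))) →
    avg L (fun w => Ψ (F w)) = ∑' r, m r * c r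

theorem tsum_pure_mul {α : Type*} (a : α) (c : α → ℝ≥0∞) : ∑' r, PMF.pure a r * c r = c a := by
  classical
  rw [tsum_eq_single a]
  · simp
  · intro b hb; simp [PMF.pure_apply, hb]

theorem tsum_bind_mul {α β : Type*} (m : PMF α) (f : α → PMF β) (c : β → ℝ≥0∞) :
    ∑' b, m.bind f b * c b = ∑' a, m a * ∑' b, f a b * c b := by
  simp only [PMF.bind_apply, ← ENNReal.tsum_mul_right, ← ENNReal.tsum_mul_left]
  rw [ENNReal.tsum_comm]
  simp only [mul_assoc]

namespace Simulates

theorem none (t : ℕ) : Simulates t (fun _ => Option.none) (PMF.pure Option.none) := by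
  intro L _ Ψ c h0 _
  rw [tsum_pure_mul, avg_const, h0]

theorem pure {s t : ℕ} (y : BTree) (h : s ≤ t) :
    Simulates t (fun w => some (y, s, w)) (PMF.pure (some (y, s))) := by
  intro L _ Ψ c _ h1
  rw [tsum_pure_mul]
  exact h1 y s L h (by omega)

theorem mono {s t : ℕ} {F : List Bool → TapeResult} {m : PMF Result} (h : Simulates s F m)
    (hst : s ≤ t) : Simulates t F m := by
  intro L hL Ψ c h0 h1
  exact h L (by omega) Ψ c h0 fun y s' L' hs' hL' => h1 y s' L' (by omega) (by omega)

/-- Test functions are arbitrary so that the continuation can be absorbed into them. The condition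
`L + s ≤ L' + t` says that no more coins than time units have been spent, which keeps the remaining
tape long enough for the remaining time. -/
theorem bind {t : ℕ} {F : List Bool → TapeResult} {m : PMF Result}
    {K : BTree → ℕ → List Bool → TapeResult} {k : BTree → ℕ → PMF Result}
    (h : Simulates t F m) (hk : ∀ y s, s ≤ t → Simulates s (K y s) (k y s)) :
    Simulates t (fun w => (F w).bind fun r => K r.1 r.2.1 r.2.2) (andThen m k) := by
  intro L hL Ψ c h0 h1
  have := h L hL (fun r => Ψ (r.bind fun r => K r.1 r.2.1 r.2.2))
    (fun r => match r with
      | Option.none => c Option.none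
      | some (y, s) => ∑' r, (k y s) r * c r) (by simpa using h0)
    (by
      intro y s L' hs hL'
      simp only [Option.bind_some]
      exact hk y s hs L' (by omega) Ψ c h0 fun y' s' L'' hs' hL'' =>
        h1 y' s' L'' (by omega) (by omega))
  rw [this, andThen, tsum_bind_mul]
  refine tsum_congr fun r => ?_
  rcases r with _ | ⟨y, s⟩
  · simp only [tsum_pure_mul]
  · rfl

theorem tick {t : ℕ} {F : ℕ → List Bool → TapeResult} {m : ℕ → PMF Result}
    (h : ∀ s, s < t → Simulates s (F s) (m s)) :
    Simulates t (fun w => tickT t fun s => F s w) (Prog.tick t m) := by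
  cases t with
  | zero => exact none 0
  | succ s => exact (h s (Nat.lt_succ_self s)).mono (Nat.le_succ s)

theorem flip {s : ℕ} : Simulates (s + 1)
    (fun w => match w with
      | [] => Option.none
      | b :: w' => some (BTree.ofBool b, s, w'))
    ((PMF.uniformOfFintype Bool).map fun b => some (BTree.ofBool b, s)) := by
  intro L hL Ψ c h0 h1
  obtain ⟨L', rfl⟩ : ∃ L', L = L' + 1 := ⟨L - 1, by omega⟩
  rw [PMF.map, tsum_bind_mul, tsum_bool]
  simp only [avg, Function.comp, tsum_pure_mul]
  rw [h1 _ _ _ (by omega) (by omega), h1 _ _ _ (by omega) (by omega)]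
  simp only [PMF.uniformOfFintype_apply, Fintype.card_bool]
  rw [← mul_add, add_comm, ENNReal.div_eq_inv_mul]
  norm_num

theorem loop {c p : BTree → ℕ → List Bool → TapeResult} {c' p' : BTree → ℕ → PMF Result}
    (hc : ∀ x t, Simulates t (c x t) (c' x t)) (hp : ∀ x t, Simulates t (p x t) (p' x t))
    (m : ℕ) (x : BTree) (t : ℕ) :
    Simulates t (loopT c p m x t) (evalLoop c' p' m x t) := by
  induction m generalizing x t with
  | zero => exact none t
  | succ m ih =>
    refine tick fun s _ => (hc x s).bind (K := fun y s w => if y.isNil then some (x, s, w)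
      else (p x s w).bind fun r' => loopT c p m r'.1 r'.2.1 r'.2.2) fun b s' _ => ?_
    cases b with
    | nil => simpa [BTree.isNil] using pure x le_rfl
    | cons y z => simpa [BTree.isNil] using (hp x s').bind fun y s'' _ => ih y s''

end Simulates

/-- The tape semantics has the right distribution. -/
theorem simulates_runT (p : Prog) (x : BTree) (t : ℕ) :
    Simulates t (runT p x t) (eval p x t) := by
  induction p generalizing x t with
  | id => exact Simulates.tick fun s _ => Simulates.pure x le_rfl
  | nil => exact Simulates.tick fun s _ => Simulates.pure _ le_rfl
  | left => exact Simulates.tick fun s _ => Simulates.pure _ le_rfl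
  | right => exact Simulates.tick fun s _ => Simulates.pure _ le_rfl
  | flip =>
    cases t with
    | zero => exact Simulates.none 0
    | succ s => exact Simulates.flip
  | pair p q hp hq =>
    exact Simulates.tick fun s _ => (hp x s).bind
      (K := fun y s w => (runT q x s w).bind fun r' => some (BTree.cons y r'.1, r'.2))
      fun y s' _ => (hq x s').bind (K := fun z s w => some (BTree.cons y z, s, w))
        fun z s'' _ => Simulates.pure _ le_rfl
  | comp q p hq hp =>
    exact Simulates.tick fun s _ => (hp x s).bind fun y s' _ => hq y s'
  | ite c p q hc hp hq =>
    refine Simulates.tick fun s _ => (hc x s).bind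
      (K := fun b s w => if b.isNil then runT q x s w else runT p x s w) fun b s' _ => ?_
    cases b with
    | nil => simpa [BTree.isNil] using hq x s'
    | cons y z => simpa [BTree.isNil] using hp x s'
  | loop c p hc hp => exact Simulates.loop hc hp t x t

/-- Whether a run on a tape halts and accepts. -/
def Accepts (r : TapeResult) : Prop := ∃ y s w, r = some (y, s, w) ∧ y ≠ BTree.nil

-- The indicator of acceptance ignores the unread tape, so it is an admissible test function for
-- `Simulates`.
open Classical in
theorem toOuterMeasure_eval (p : Prog) (x : BTree) {t L : ℕ} (h : t ≤ L) :
    (eval p x t).toOuterMeasure {r | ∃ y s, r = some (y, s) ∧ y ≠ BTree.nil} =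
      avg L (fun w => if Accepts (runT p x t w) then 1 else 0) := by
  rw [PMF.toOuterMeasure_apply, simulates_runT p x t L h (fun r => if Accepts r then 1 else 0)
    (fun r => if ∃ y s, r = some (y, s) ∧ y ≠ BTree.nil then 1 else 0)]
  · refine tsum_congr fun r => ?_
    simp [Set.indicator]
  · simp [Accepts]
  · intro y s L' _ _
    simp [Accepts]

theorem eval_none_eq_zero_iff (p : Prog) (x : BTree) {t L : ℕ} (h : t ≤ L) :
    eval p x t none = 0 ↔ ∀ w, w.length = L → runT p x t w ≠ none := by
  classical
  have := simulates_runT p x t L h (fun r => if r = none then 1 else 0)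
    (fun r => if r = none then 1 else 0) (by simp) (by simp)
  simp only [mul_ite, mul_one, mul_zero, tsum_ite_eq] at this
  rw [← this, avg_eq_zero_iff]
  simp

/-! ### Runs with known coins -/

/-- `F` finishes in time exactly `t` with the output `y` after reading exactly the coins `v`. -/
def Exec (F : ℕ → List Bool → TapeResult) (v : List Bool) (y : BTree) (t : ℕ) : Prop :=
  ∀ s u, F (t + s) (v ++ u) = some (y, s, u)

/-- Successful computations read an initial part of the tape and do not depend on the rest. -/
def Regular (F : ℕ → List Bool → TapeResult) : Prop :=
  ∀ t w y s w', F t w = some (y, s, w') →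
    ∃ v t₀, w = v ++ w' ∧ t = t₀ + s ∧ v.length ≤ t₀ ∧ Exec F v y t₀

theorem Exec.bind {F : ℕ → List Bool → TapeResult} {K : BTree → ℕ → List Bool → TapeResult}
    {v₁ v₂ : List Bool} {y z : BTree} {t₁ t₂ : ℕ} (hF : Exec F v₁ y t₁) (hK : Exec (K y) v₂ z t₂) :
    Exec (fun t w => (F t w).bind fun r => K r.1 r.2.1 r.2.2) (v₁ ++ v₂) z (t₁ + t₂) := by
  intro s u
  have h1 := hF (t₂ + s) (v₂ ++ u)
  rw [← Nat.add_assoc, ← List.append_assoc] at h1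
  simp only [h1, Option.bind_some, hK s u]

theorem Exec.tick {F : ℕ → List Bool → TapeResult} {v : List Bool} {y : BTree} {t : ℕ}
    (hF : Exec F v y t) : Exec (fun t w => tickT t fun s => F s w) v y (t + 1) := by
  intro s u
  rw [Nat.add_right_comm]
  exact hF s u

namespace Regular

theorem pure (y : BTree) : Regular (fun t w => some (y, t, w)) := by
  rintro t w y' s w' h
  simp only [Option.some.injEq, Prod.mk.injEq] at h
  obtain ⟨rfl, rfl, rfl⟩ := h
  exact ⟨[], 0, by simp, by simp, by simp, fun s u => by simp⟩

theorem bind {F : ℕ → List Bool → TapeResult} {K : BTree → ℕ → List Bool → TapeResult}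
    (hF : Regular F) (hK : ∀ y, Regular (K y)) :
    Regular (fun t w => (F t w).bind fun r => K r.1 r.2.1 r.2.2) := by
  intro t w z s w' h
  simp only [Option.bind_eq_some_iff] at h
  obtain ⟨⟨y, s₁, w₁⟩, h1, h2⟩ := h
  obtain ⟨v₁, t₁, rfl, rfl, hl1, he1⟩ := hF _ _ _ _ _ h1
  obtain ⟨v₂, t₂, rfl, rfl, hl2, he2⟩ := hK y _ _ _ _ _ h2
  exact ⟨v₁ ++ v₂, t₁ + t₂, by simp, by omega, by simp; omega, he1.bind he2⟩

theorem tick {F : ℕ → List Bool → TapeResult} (hF : Regular F) :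
    Regular (fun t w => tickT t fun s => F s w) := by
  intro t w y s w' h
  cases t with
  | zero => simp [tickT] at h
  | succ t =>
    obtain ⟨v, t₀, rfl, rfl, hl, he⟩ := hF _ _ _ _ _ h
    exact ⟨v, t₀ + 1, rfl, by omega, by omega, he.tick⟩

end Regular

theorem Regular.le {F : ℕ → List Bool → TapeResult} (hF : Regular F) {t : ℕ} {w : List Bool}
    {r : BTree × ℕ × List Bool} (h : F t w = some r) : r.2.1 ≤ t := by
  obtain ⟨_, _, _, rfl, _⟩ := hF t w r.1 r.2.1 r.2.2 h
  omega

theorem loopT_mono {c p : BTree → ℕ → List Bool → TapeResult} {m m' : ℕ} (h : m ≤ m') {x : BTree}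
    {t : ℕ} {w : List Bool} {r : BTree × ℕ × List Bool} (hr : loopT c p m x t w = some r) :
    loopT c p m' x t w = some r := by
  induction m generalizing m' x t w with
  | zero => simp [loopT] at hr
  | succ m ih =>
    obtain ⟨m', rfl⟩ : ∃ k, m' = k + 1 := ⟨m' - 1, by omega⟩
    cases t with
    | zero => simp [loopT, tickT] at hr
    | succ t =>
      simp only [loopT, tickT, Option.bind_eq_some_iff] at hr ⊢
      obtain ⟨r₁, h1, h2⟩ := hr
      refine ⟨r₁, h1, ?_⟩
      split_ifs at h2 ⊢ with hb
      · exact h2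
      · simp only [Option.bind_eq_some_iff] at h2 ⊢
        obtain ⟨r₂, h3, h4⟩ := h2
        exact ⟨r₂, h3, ih (by omega) h4⟩

/-- Every round pays at least one unit for its test, so all bounds on the number of rounds that are
at least the available time have the same effect. -/
theorem loopT_rounds {c p : BTree → ℕ → List Bool → TapeResult} (hc : ∀ x, Regular (c x))
    (hp : ∀ x, Regular (p x)) {m m' t : ℕ} (h : t ≤ m) (h' : t ≤ m') (x : BTree) (w : List Bool) :
    loopT c p m x t w = loopT c p m' x t w := by
  induction t using Nat.strong_induction_on generalizing m m' x w with
  | _ t ih =>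
    cases t with
    | zero => cases m <;> cases m' <;> simp [loopT, tickT]
    | succ t =>
      obtain ⟨m, rfl⟩ : ∃ k, m = k + 1 := ⟨m - 1, by omega⟩
      obtain ⟨m', rfl⟩ : ∃ k, m' = k + 1 := ⟨m' - 1, by omega⟩
      simp only [loopT, tickT]
      cases h1 : c x t w with
      | none => rfl
      | some r₁ =>
        have := (hc x).le h1
        simp only [Option.bind_some]
        split_ifs
        · rfl
        · cases h2 : p x r₁.2.1 r₁.2.2 with
          | none => rfl
          | some r₂ =>
            have := (hp x).le h2
            exact ih _ (by omega) (by omega) (by omega) _ _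

theorem Regular.ite_nil {F G : ℕ → List Bool → TapeResult} (hF : Regular F) (hG : Regular G)
    (b : BTree) : Regular (fun t w => if b.isNil then F t w else G t w) := by
  cases b <;> simpa [BTree.isNil]

theorem Regular.loopT {c p : BTree → ℕ → List Bool → TapeResult} (hc : ∀ x, Regular (c x))
    (hp : ∀ x, Regular (p x)) (m : ℕ) (x : BTree) : Regular (Prog.loopT c p m x) := by
  induction m generalizing x with
  | zero => intro t w y s w' h; simp [Prog.loopT] at h
  | succ m ih =>
    exact ((hc x).bind (K := fun b t w => if b.isNil then some (x, t, w)
      else (p x t w).bind fun r' => Prog.loopT c p m r'.1 r'.2.1 r'.2.2) fun b =>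
        (Regular.pure x).ite_nil ((hp x).bind fun y => ih y) b).tick

theorem regular_runT (p : Prog) (x : BTree) : Regular (runT p x) := by
  induction p generalizing x with
  | id => exact (Regular.pure x).tick
  | nil => exact (Regular.pure _).tick
  | left => exact (Regular.pure _).tick
  | right => exact (Regular.pure _).tick
  | flip =>
    intro t w y s w' h
    match t, w, h with
    | t + 1, b :: w, h =>
      simp only [runT, tickT, Option.some.injEq, Prod.mk.injEq] at h
      obtain ⟨rfl, rfl, rfl⟩ := h
      exact ⟨[b], 1, rfl, by omega, by simp, fun s u => by
        rw [Nat.add_comm]; rfl⟩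
  | pair p q hp hq =>
    exact ((hp x).bind (K := fun y s w => (runT q x s w).bind fun r' =>
      some (BTree.cons y r'.1, r'.2)) fun y => (hq x).bind
        (K := fun z s w => some (BTree.cons y z, s, w)) fun z => Regular.pure _).tick
  | comp q p hq hp => exact ((hp x).bind fun y => hq y).tick
  | ite c p q hc hp hq =>
    exact ((hc x).bind (K := fun b s w => if b.isNil then runT q x s w else runT p x s w)
      fun b => (hq x).ite_nil (hp x) b).tick
  | loop c p hc hp =>
    intro t w y s w' h
    obtain ⟨v, t₀, rfl, rfl, hl, he⟩ := Regular.loopT hc hp t x t w y s w' h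
    refine ⟨v, t₀, rfl, rfl, hl, fun s' u => ?_⟩
    -- A loop uses its time limit also as the bound on its rounds, so that bound is now `t₀ + s'`
    -- instead of `t₀ + s`. A smaller bound still covers the available time, and a larger one cannot
    -- spoil a successful run.
    rcases le_total s' s with hs | hs
    · rw [← he s' u]
      exact loopT_rounds hc hp le_rfl (by omega) x _
    · exact loopT_mono (by omega) (he s' u)

/-- On the input `x` and with the coins `v`, all of which are used, the program `p` halts within
time `T` with the output `y`. -/
def Runs (p : Prog) (x : BTree) (v : List Bool) (y : BTree) (T : ℕ) : Prop :=
  ∃ t ≤ T, Exec (runT p x) v y t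

namespace Runs

variable {p q c : Prog} {x y z b : BTree} {v v₁ v₂ v₃ : List Bool} {T T' T₁ T₂ T₃ : ℕ}

theorem mono (h : Runs p x v y T) (hT : T ≤ T') : Runs p x v y T' :=
  let ⟨t, ht, he⟩ := h; ⟨t, ht.trans hT, he⟩

theorem id : Runs .id x [] x 1 := ⟨1, le_rfl, fun s u => by rw [Nat.add_comm]; rfl⟩
theorem nil : Runs .nil x [] .nil 1 := ⟨1, le_rfl, fun s u => by rw [Nat.add_comm]; rfl⟩
theorem left : Runs .left x [] x.left 1 := ⟨1, le_rfl, fun s u => by rw [Nat.add_comm]; rfl⟩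
theorem right : Runs .right x [] x.right 1 := ⟨1, le_rfl, fun s u => by rw [Nat.add_comm]; rfl⟩
theorem flip (a : Bool) : Runs .flip x [a] (BTree.ofBool a) 1 :=
  ⟨1, le_rfl, fun s u => by rw [Nat.add_comm]; rfl⟩

theorem pair (hp : Runs p x v₁ y T₁) (hq : Runs q x v₂ z T₂) :
    Runs (.pair p q) x (v₁ ++ v₂) (.cons y z) (T₁ + T₂ + 1) := by
  obtain ⟨t₁, h1, e1⟩ := hp
  obtain ⟨t₂, h2, e2⟩ := hq
  refine ⟨t₁ + t₂ + 1, by omega, (e1.bind (K := fun y s w => (runT q x s w).bind fun r' =>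
      some (BTree.cons y r'.1, r'.2)) ?_).tick⟩
  have := e2.bind (K := fun z s w => some (BTree.cons y z, s, w)) (v₂ := []) (t₂ := 0)
    (z := .cons y z) (fun s u => by simp)
  simpa using this

theorem comp (hp : Runs p x v₁ y T₁) (hq : Runs q y v₂ z T₂) :
    Runs (.comp q p) x (v₁ ++ v₂) z (T₁ + T₂ + 1) := by
  obtain ⟨t₁, h1, e1⟩ := hp
  obtain ⟨t₂, h2, e2⟩ := hq
  exact ⟨t₁ + t₂ + 1, by omega, (e1.bind (K := runT q) e2).tick⟩

theorem ite_pos (hc : Runs c x v₁ b T₁) (hb : b ≠ .nil) (hp : Runs p x v₂ y T₂) :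
    Runs (.ite c p q) x (v₁ ++ v₂) y (T₁ + T₂ + 1) := by
  obtain ⟨t₁, h1, e1⟩ := hc
  obtain ⟨t₂, h2, e2⟩ := hp
  refine ⟨t₁ + t₂ + 1, by omega, (e1.bind (K := fun b s w => if b.isNil then runT q x s w
    else runT p x s w) ?_).tick⟩
  simpa [BTree.isNil_eq_false_iff.2 hb] using e2

theorem ite_neg (hc : Runs c x v₁ .nil T₁) (hq : Runs q x v₂ y T₂) :
    Runs (.ite c p q) x (v₁ ++ v₂) y (T₁ + T₂ + 1) := by
  obtain ⟨t₁, h1, e1⟩ := hc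
  obtain ⟨t₂, h2, e2⟩ := hq
  refine ⟨t₁ + t₂ + 1, by omega, (e1.bind (K := fun b s w => if b.isNil then runT q x s w
    else runT p x s w) ?_).tick⟩
  simpa [BTree.isNil] using e2

theorem loop_stop (hc : Runs c x v .nil T) : Runs (.loop c p) x v x (T + 1) := by
  obtain ⟨t, h, e⟩ := hc
  refine ⟨t + 1, by omega, fun s u => ?_⟩
  rw [Nat.add_right_comm]
  simp only [runT, loopT, tickT, e s u, Option.bind_some]
  simp [BTree.isNil]

theorem loop_step (hc : Runs c x v₁ b T₁) (hb : b ≠ .nil) (hp : Runs p x v₂ y T₂)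
    (hl : Runs (.loop c p) y v₃ z T₃) :
    Runs (.loop c p) x (v₁ ++ (v₂ ++ v₃)) z (T₁ + T₂ + T₃ + 1) := by
  obtain ⟨t₁, h1, e1⟩ := hc
  obtain ⟨t₂, h2, e2⟩ := hp
  obtain ⟨t₃, h3, e3⟩ := hl
  refine ⟨t₁ + t₂ + t₃ + 1, by omega, fun s u => ?_⟩
  have e1 := e1 (t₂ + t₃ + s) (v₂ ++ (v₃ ++ u))
  have e2 := e2 (t₃ + s) (v₃ ++ u)
  have e3 := e3 s u
  rw [show t₁ + (t₂ + t₃ + s) = t₁ + t₂ + t₃ + s by omega] at e1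
  rw [show t₂ + (t₃ + s) = t₂ + t₃ + s by omega] at e2
  rw [Nat.add_right_comm]
  simp only [runT, loopT, tickT, List.append_assoc, e1, Option.bind_some,
    BTree.isNil_eq_false_iff.2 hb, e2] at e3 ⊢
  rw [← e3]
  -- The tail inherits the round bound of the whole loop, which exceeds the one of a loop started
  -- afresh; both are at least the time that is left.
  exact loopT_rounds (regular_runT c) (regular_runT p) (by omega) le_rfl _ _

end Runs

theorem runs_of_runT {p : Prog} {x y : BTree} {t s : ℕ} {w w' : List Bool}
    (h : runT p x t w = some (y, s, w')) :
    ∃ v, w = v ++ w' ∧ v.length ≤ t ∧ Runs p x v y t := by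
  obtain ⟨v, t₀, hw, rfl, hl, he⟩ := regular_runT p x t w y s w' h
  exact ⟨v, hw, by omega, t₀, by omega, he⟩

theorem Runs.runT {p : Prog} {x y : BTree} {v : List Bool} {T : ℕ} (h : Runs p x v y T) {t : ℕ}
    (ht : T ≤ t) (u : List Bool) : ∃ s, runT p x t (v ++ u) = some (y, s, u) := by
  obtain ⟨t₀, h0, he⟩ := h
  refine ⟨t - t₀, ?_⟩
  rw [← he (t - t₀) u]
  congr 1
  omega

end Prog

/-! ### Data types and feasible functions -/

/-- Types whose elements are represented by trees, with a measure of size. -/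
class TreeEnc (α : Type) where
  /-- The representation. -/
  enc : α → BTree
  /-- The size. -/
  sz : α → ℕ

open TreeEnc

/-- Trees themselves are treated as opaque objects of size zero. -/
instance : TreeEnc BTree := ⟨id, fun _ => 0⟩
instance : TreeEnc Unit := ⟨fun _ => .nil, fun _ => 0⟩
instance : TreeEnc Bool := ⟨BTree.ofBool, fun _ => 0⟩
instance : TreeEnc ℕ := ⟨BTree.ofNat, fun n => n⟩
instance {α : Type} [TreeEnc α] : TreeEnc (List α) :=
  ⟨fun l => BTree.ofList (l.map enc), fun l => (l.map fun a => sz a + 1).sum⟩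
instance {α β : Type} [TreeEnc α] [TreeEnc β] : TreeEnc (α × β) :=
  ⟨fun a => .cons (enc a.1) (enc a.2), fun a => sz a.1 + sz a.2⟩
instance {α : Type} [TreeEnc α] : TreeEnc (Option α) :=
  ⟨fun a => a.elim .nil fun a => .cons .nil (enc a), fun a => a.elim 0 sz⟩

section Encodings

variable {α β : Type} [TreeEnc α] [TreeEnc β]

@[simp] theorem enc_prod (a : α × β) : enc a = .cons (enc a.1) (enc a.2) := rfl
@[simp] theorem enc_list_nil : enc ([] : List α) = .nil := rfl
@[simp] theorem enc_list_cons (a : α) (l : List α) : enc (a :: l) = .cons (enc a) (enc l) := rfl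
@[simp] theorem enc_none : enc (none : Option α) = .nil := rfl
@[simp] theorem enc_some (a : α) : enc (some a) = .cons .nil (enc a) := rfl
@[simp] theorem enc_true : enc true = .cons .nil .nil := rfl
@[simp] theorem enc_false : enc false = .nil := rfl
@[simp] theorem enc_unit (a : Unit) : enc a = .nil := rfl
@[simp] theorem enc_btree (x : BTree) : enc x = x := rfl
@[simp] theorem enc_zero : enc 0 = .nil := rfl
@[simp] theorem enc_succ (n : ℕ) : enc (n + 1) = .cons .nil (enc n) := rfl
@[simp] theorem sz_prod (a : α × β) : sz a = sz a.1 + sz a.2 := rfl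
@[simp] theorem sz_list_nil : sz ([] : List α) = 0 := rfl
@[simp] theorem sz_list_cons (a : α) (l : List α) : sz (a :: l) = sz a + 1 + sz l := by
  simp [sz]
@[simp] theorem sz_none : sz (none : Option α) = 0 := rfl
@[simp] theorem sz_some (a : α) : sz (some a) = sz a := rfl
@[simp] theorem sz_bool (a : Bool) : sz a = 0 := rfl
@[simp] theorem sz_unit (a : Unit) : sz a = 0 := rfl
@[simp] theorem sz_btree (x : BTree) : sz x = 0 := rfl
@[simp] theorem sz_nat (n : ℕ) : sz n = n := rfl

@[simp] theorem sz_append (l l' : List α) : sz (l ++ l') = sz l + sz l' := by simp [sz]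

@[simp] theorem sz_reverse (l : List α) : sz l.reverse = sz l := by
  induction l with
  | nil => rfl
  | cons a l ih => simp [ih]; omega

theorem sz_lt_of_mem {a : α} {l : List α} (h : a ∈ l) : sz a < sz l := by
  induction l with
  | nil => simp at h
  | cons b l ih =>
    rcases List.mem_cons.1 h with rfl | h
    · simp; omega
    · have := ih h; simp; omega

theorem length_le_sz (l : List α) : l.length ≤ sz l := by
  induction l with
  | nil => simp
  | cons b l ih => simp; omega

theorem sz_le_of_prefix {l l' : List α} (h : l <+: l') : sz l ≤ sz l' := by
  obtain ⟨t, rfl⟩ := h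
  simp

theorem sz_le_of_suffix {l l' : List α} (h : l <:+ l') : sz l ≤ sz l' := by
  obtain ⟨t, rfl⟩ := h
  simp

theorem sz_le_mul {l : List α} {B : ℕ} (h : ∀ a ∈ l, sz a ≤ B) : sz l ≤ l.length * (B + 1) := by
  induction l with
  | nil => simp
  | cons b l ih =>
    have h1 := h b (by simp)
    have h2 := ih fun a ha => h a (by simp [ha])
    simp only [sz_list_cons, List.length_cons, Nat.add_mul]
    omega

theorem enc_bool_ne_nil {b : Bool} : enc b ≠ .nil ↔ b = true := by
  cases b <;> simp

end Encodings

/-- Functions that are bounded by a polynomial in the size of the argument. -/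
def PolyBdd {α : Type} [TreeEnc α] (T : α → ℕ) : Prop := ∃ c, ∀ a, T a ≤ (sz a + 2) ^ c

namespace PolyBdd

variable {α β : Type} [TreeEnc α] [TreeEnc β] {S T : α → ℕ}

theorem mono (hT : PolyBdd T) (h : ∀ a, S a ≤ T a) : PolyBdd S :=
  let ⟨c, hc⟩ := hT; ⟨c, fun a => (h a).trans (hc a)⟩

theorem const (n : ℕ) : PolyBdd (fun _ : α => n) :=
  ⟨n, fun a => (Nat.lt_two_pow_self).le.trans (Nat.pow_le_pow_left (by omega) n)⟩

theorem size : PolyBdd (fun a : α => sz a) := ⟨1, fun a => by simp⟩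

theorem add (hS : PolyBdd S) (hT : PolyBdd T) : PolyBdd (fun a => S a + T a) := by
  obtain ⟨c, hc⟩ := hS
  obtain ⟨d, hd⟩ := hT
  refine ⟨max c d + 1, fun a => ?_⟩
  have h1 : (sz a + 2) ^ c ≤ (sz a + 2) ^ max c d := Nat.pow_le_pow_right (by omega) (le_max_left _ _)
  have h2 : (sz a + 2) ^ d ≤ (sz a + 2) ^ max c d := Nat.pow_le_pow_right (by omega) (le_max_right _ _)
  have h3 := hc a
  have h4 := hd a
  rw [pow_succ]
  nlinarith

theorem mul (hS : PolyBdd S) (hT : PolyBdd T) : PolyBdd (fun a => S a * T a) := by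
  obtain ⟨c, hc⟩ := hS
  obtain ⟨d, hd⟩ := hT
  exact ⟨c + d, fun a => by rw [pow_add]; exact Nat.mul_le_mul (hc a) (hd a)⟩

theorem comp {T : β → ℕ} {f : α → β} (hT : PolyBdd T) (hf : PolyBdd (fun a => sz (f a))) :
    PolyBdd (fun a => T (f a)) := by
  obtain ⟨c, hc⟩ := hT
  obtain ⟨d, hd⟩ := hf.add (const 2)
  refine ⟨d * c, fun a => (hc _).trans ?_⟩
  rw [pow_mul]
  exact Nat.pow_le_pow_left (hd a) c

/-- Polynomial bounds on `β`, evaluated at a point whose size is bounded polynomially in `a`. -/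
theorem pow_comp (hS : PolyBdd S) (c : ℕ) : PolyBdd (fun a => (S a + 2) ^ c) := by
  obtain ⟨d, hd⟩ := hS.add (const 2)
  refine ⟨d * c, fun a => ?_⟩
  rw [pow_mul]
  exact Nat.pow_le_pow_left (hd a) c

end PolyBdd

/-- `f` is computed by a deterministic program; if `κ` is true, then in polynomial time and with
results of polynomial size. -/
def Fn {α β : Type} [TreeEnc α] [TreeEnc β] (κ : Bool) (f : α → β) : Prop :=
  ∃ (p : Prog) (T : α → ℕ), (∀ a, p.Runs (enc a) [] (enc (f a)) (T a)) ∧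
    (κ = true → PolyBdd T ∧ PolyBdd (fun a => sz (f a)))

/-! ### Folding a program over a list -/

namespace Prog

/-- Run `p` on the triples of the parameter, the current state, and the entries of a list one after
another; the input consists of the list, the parameter and the state. -/
def foldLoop (p : Prog) : Prog :=
  loop left (pair (comp right left) (pair (comp left right)
    (comp p (pair (comp left right) (pair (comp right right) (comp left left))))))

/-- The course of a computation by `Prog.foldLoop`. -/
inductive FoldRuns (p : Prog) (a : BTree) (τ : ℕ) :
    List BTree → BTree → List Bool → BTree → Prop
  | nil (s : BTree) : FoldRuns p a τ [] s [] s
  | cons {b s s₁ s₂ : BTree} {l : List BTree} {v v' : List Bool} :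
      p.Runs (.cons a (.cons s b)) v s₁ τ → FoldRuns p a τ l s₁ v' s₂ →
      FoldRuns p a τ (b :: l) s (v ++ v') s₂

theorem FoldRuns.runs {p : Prog} {a s s' : BTree} {τ : ℕ} {l : List BTree} {v : List Bool}
    (h : FoldRuns p a τ l s v s') :
    (foldLoop p).Runs (.cons (BTree.ofList l) (.cons a s)) v (.cons .nil (.cons a s'))
      ((l.length + 1) * (τ + 40)) := by
  induction h with
  | nil s => exact (Runs.loop_stop Runs.left).mono (by simp)
  | @cons b s s₁ s₂ l v v' h1 h2 ih =>
    have hb := (Runs.comp (x := .cons (BTree.ofList (b :: l)) (.cons a s)) Runs.left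
      (Runs.right (x := BTree.cons b (BTree.ofList l)))).pair
        ((Runs.comp Runs.right Runs.left).pair
          (((Runs.comp Runs.right Runs.left).pair ((Runs.comp Runs.right Runs.right).pair
            (Runs.comp Runs.left (Runs.left (x := BTree.cons b (BTree.ofList l)))))).comp h1))
    have := Runs.loop_step (c := left) (b := .cons b (BTree.ofList l))
      (x := .cons (BTree.ofList (b :: l)) (.cons a s)) Runs.left (by simp) hb ih
    simp only [List.nil_append] at this
    refine this.mono ?_
    simp only [List.length_cons, Nat.add_mul]
    omega

end Prog

/-! ### Closure properties of computable and of polynomial-time functions -/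

namespace Fn

open Prog

/-- The maximal value of `T` during a fold. -/
def foldMax {α β σ : Type} (step : α × σ × β → σ) (T : α × σ × β → ℕ) (a : α) : List β → σ → ℕ
  | [], _ => 0
  | b :: l, s => max (T (a, s, b)) (foldMax step T a l (step (a, s, b)))

/-- Only states reached after a prefix of the list matter. This is why `foldl` asks for a bound on
intermediate states: iterating a polynomial-time step could otherwise blow up. -/
theorem foldMax_le {α β σ : Type} {step : α × σ × β → σ} {T : α × σ × β → ℕ} {a : α} {B : ℕ} {l : List β} {s : σ}
    (h : ∀ l' b, l' ++ [b] <+: l → T (a, l'.foldl (fun s b => step (a, s, b)) s, b) ≤ B) :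
    foldMax step T a l s ≤ B := by
  induction l generalizing s with
  | nil => exact Nat.zero_le _
  | cons b l ih =>
    refine max_le (h [] b (by simp)) (ih fun l' b' hl => ?_)
    exact h (b :: l') b' (by simpa using hl)

variable {α β γ σ : Type} [TreeEnc α] [TreeEnc β] [TreeEnc γ] [TreeEnc σ] {κ : Bool}

theorem weaken {f : α → β} (h : Fn true f) : Fn κ f :=
  let ⟨p, T, h1, h2⟩ := h; ⟨p, T, h1, fun _ => h2 rfl⟩

theorem of_eq {f g : α → β} (h : Fn κ f) (hfg : ∀ a, f a = g a) : Fn κ g :=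
  (funext hfg : f = g) ▸ h

theorem sz_bdd {f : α → β} (h : Fn true f) : PolyBdd (fun a => sz (f a)) :=
  let ⟨_, _, _, h2⟩ := h; (h2 rfl).2

/-- Changes of type that do not change the representation. -/
theorem of_enc_eq {f : α → β} (h : ∀ a, enc (f a) = enc a)
    (hs : κ = true → PolyBdd (fun a => sz (f a))) : Fn κ f :=
  ⟨.id, fun _ => 1, fun a => by rw [h]; exact Runs.id, fun hκ => ⟨PolyBdd.const 1, hs hκ⟩⟩

protected theorem id : Fn κ (fun a : α => a) := of_enc_eq (fun _ => rfl) fun _ => PolyBdd.size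

theorem fst : Fn κ (fun a : α × β => a.1) :=
  ⟨.left, fun _ => 1, fun _ => Runs.left, fun _ => ⟨PolyBdd.const 1,
    PolyBdd.size.mono fun a => by simp⟩⟩

theorem snd : Fn κ (fun a : α × β => a.2) :=
  ⟨.right, fun _ => 1, fun _ => Runs.right, fun _ => ⟨PolyBdd.const 1,
    PolyBdd.size.mono fun a => by simp⟩⟩

theorem comp {g : β → γ} {f : α → β} (hg : Fn κ g) (hf : Fn κ f) : Fn κ (fun a => g (f a)) := by
  obtain ⟨p, T, h1, h2⟩ := hg
  obtain ⟨q, S, h3, h4⟩ := hf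
  refine ⟨.comp p q, fun a => S a + T (f a) + 1, fun a => (h3 a).comp (h1 _), fun hκ => ?_⟩
  exact ⟨((h4 hκ).1.add ((h2 hκ).1.comp (h4 hκ).2)).add (PolyBdd.const 1),
    (h2 hκ).2.comp (h4 hκ).2⟩

theorem pair {f : α → β} {g : α → γ} (hf : Fn κ f) (hg : Fn κ g) : Fn κ (fun a => (f a, g a)) := by
  obtain ⟨p, T, h1, h2⟩ := hf
  obtain ⟨q, S, h3, h4⟩ := hg
  refine ⟨.pair p q, fun a => T a + S a + 1, fun a => (h1 a).pair (h3 a), fun hκ => ?_⟩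
  exact ⟨((h2 hκ).1.add (h4 hκ).1).add (PolyBdd.const 1), (h2 hκ).2.add (h4 hκ).2⟩

theorem exists_const (x : BTree) : ∃ p : Prog, ∃ t, ∀ y, p.Runs y [] x t := by
  induction x with
  | nil => exact ⟨.nil, 1, fun y => Runs.nil⟩
  | cons a b ha hb =>
    obtain ⟨p, t, hp⟩ := ha
    obtain ⟨q, s, hq⟩ := hb
    exact ⟨.pair p q, t + s + 1, fun y => (hp y).pair (hq y)⟩

theorem const (b : β) : Fn κ (fun _ : α => b) := by
  obtain ⟨p, t, hp⟩ := exists_const (enc b)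
  exact ⟨p, fun _ => t, fun a => hp _, fun _ => ⟨PolyBdd.const t, PolyBdd.const _⟩⟩

theorem ite {c : α → Bool} {f g : α → β} (hc : Fn κ c) (hf : Fn κ f) (hg : Fn κ g) :
    Fn κ (fun a => if c a then f a else g a) := by
  obtain ⟨p, T, h1, h2⟩ := hc
  obtain ⟨q, S, h3, h4⟩ := hf
  obtain ⟨r, R, h5, h6⟩ := hg
  refine ⟨.ite p q r, fun a => T a + (S a + R a) + 1, fun a => ?_, fun hκ => ⟨?_, ?_⟩⟩
  · have h := h1 a
    cases hca : c a
    · rw [hca] at h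
      have := Runs.ite_neg (p := q) h (h5 a)
      simpa [hca] using this.mono (T' := T a + (S a + R a) + 1) (by omega)
    · rw [hca] at h
      have := Runs.ite_pos (q := r) h (by simp) (h3 a)
      simpa [hca] using this.mono (T' := T a + (S a + R a) + 1) (by omega)
  · exact ((h2 hκ).1.add ((h4 hκ).1.add (h6 hκ).1)).add (PolyBdd.const 1)
  · refine ((h4 hκ).2.add (h6 hκ).2).mono fun a => ?_
    dsimp only
    split_ifs <;> omega

theorem list_cases {l : α → List β} {f : α → γ} {g : α × β × List β → γ} (hl : Fn κ l)
    (hf : Fn κ f) (hg : Fn κ g) :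
    Fn κ (fun a => match l a with
      | [] => f a
      | b :: bs => g (a, b, bs)) := by
  obtain ⟨p, T, h1, h2⟩ := hl
  obtain ⟨q, S, h3, h4⟩ := hf
  obtain ⟨r, R, h5, h6⟩ := hg
  refine ⟨.comp (.ite .left (.comp r (.pair .right (.pair (.comp .left .left)
    (.comp .right .left)))) (.comp q .right)) (.pair p .id),
    fun a => T a + (S a + (match l a with | [] => 0 | b :: bs => R (a, b, bs))) + 20,
    fun a => ?_, fun hκ => ⟨?_, ?_⟩⟩
  · have h := h1 a
    have h0 := h.pair (Runs.id (x := enc a))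
    cases hla : l a with
    | nil =>
      rw [hla] at h0
      have := h0.comp (Runs.ite_neg (p := .comp r (.pair .right (.pair (.comp .left .left)
        (.comp .right .left)))) Runs.left (Runs.comp Runs.right (h3 a)))
      simp only [hla]
      exact this.mono (by omega)
    | cons b bs =>
      rw [hla] at h0
      have h7 : Runs (.pair .right (.pair (.comp .left .left)
        (.comp .right .left))) (.cons (enc (b :: bs)) (enc a)) [] (enc (a, b, bs)) 9 :=
        Runs.right.pair ((Runs.comp Runs.left Runs.left).pair (Runs.comp Runs.left Runs.right))
      have := h0.comp (Runs.ite_pos (q := .comp q .right) Runs.left (by simp [BTree.left])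
        (Runs.comp h7 (h5 (a, b, bs))))
      simp only [hla]
      exact this.mono (by omega)
  · refine (((h2 hκ).1.add ((h4 hκ).1.add (?_ : PolyBdd _))).add (PolyBdd.const 20))
    obtain ⟨c, hc⟩ := (h6 hκ).1
    refine ((PolyBdd.size.add (h2 hκ).2).pow_comp c).mono fun a => ?_
    cases hla : l a with
    | nil => simp
    | cons b bs =>
      refine (hc _).trans (Nat.pow_le_pow_left ?_ c)
      simp
  · obtain ⟨c, hc⟩ := (h6 hκ).2
    refine (((PolyBdd.size.add (h2 hκ).2).pow_comp c).add (h4 hκ).2).mono fun a => ?_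
    dsimp only
    cases hla : l a with
    | nil => simp
    | cons b bs =>
      refine ((hc (a, b, bs)).trans (Nat.pow_le_pow_left ?_ c)).trans (Nat.le_add_right _ _)
      simp

theorem option_cases {o : α → Option β} {f : α → γ} {g : α × β → γ} (ho : Fn κ o)
    (hf : Fn κ f) (hg : Fn κ g) :
    Fn κ (fun a => match o a with
      | none => f a
      | some b => g (a, b)) := by
  obtain ⟨p, T, h1, h2⟩ := ho
  obtain ⟨q, S, h3, h4⟩ := hf
  obtain ⟨r, R, h5, h6⟩ := hg
  refine ⟨.comp (.ite .left (.comp r (.pair .right (.comp .right .left))) (.comp q .right))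
    (.pair p .id), fun a => T a + (S a + (match o a with | none => 0 | some b => R (a, b))) + 20,
    fun a => ?_, fun hκ => ⟨?_, ?_⟩⟩
  · have h := h1 a
    have h0 := h.pair (Runs.id (x := enc a))
    cases hla : o a with
    | none =>
      rw [hla] at h0
      have := h0.comp (Runs.ite_neg (p := .comp r (.pair .right (.comp .right .left)))
        Runs.left (Runs.comp Runs.right (h3 a)))
      simp only [hla]
      exact this.mono (by omega)
    | some b =>
      rw [hla] at h0
      have h7 : Runs (.pair .right (.comp .right .left))
        (.cons (enc (some b)) (enc a)) [] (enc (a, b)) 5 :=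
        Runs.right.pair (Runs.comp Runs.left Runs.right)
      have := h0.comp (Runs.ite_pos (q := .comp q .right) Runs.left (by simp [BTree.left])
        (Runs.comp h7 (h5 (a, b))))
      simp only [hla]
      exact this.mono (by omega)
  · refine (((h2 hκ).1.add ((h4 hκ).1.add (?_ : PolyBdd _))).add (PolyBdd.const 20))
    obtain ⟨c, hc⟩ := (h6 hκ).1
    refine ((PolyBdd.size.add (h2 hκ).2).pow_comp c).mono fun a => ?_
    cases hla : o a with
    | none => simp
    | some b =>
      refine (hc _).trans (Nat.pow_le_pow_left ?_ c)
      simp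
  · obtain ⟨c, hc⟩ := (h6 hκ).2
    refine (((PolyBdd.size.add (h2 hκ).2).pow_comp c).add (h4 hκ).2).mono fun a => ?_
    dsimp only
    cases hla : o a with
    | none => simp
    | some b =>
      refine ((hc (a, b)).trans (Nat.pow_le_pow_left ?_ c)).trans (Nat.le_add_right _ _)
      simp

theorem foldRuns {p : Prog} {step : α × σ × β → σ} {T : α × σ × β → ℕ}
    (hp : ∀ a, p.Runs (enc a) [] (enc (step a)) (T a)) (a : α) (l : List β) (s : σ) {τ : ℕ}
    (hτ : foldMax step T a l s ≤ τ) :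
    FoldRuns p (enc a) τ (l.map enc) (enc s) []
      (enc (l.foldl (fun s b => step (a, s, b)) s)) := by
  induction l generalizing s with
  | nil => exact .nil _
  | cons b l ih =>
    simp only [foldMax, max_le_iff] at hτ
    exact .cons ((hp (a, s, b)).mono hτ.1) (ih _ hτ.2)

/-- Iteration over a list. -/
theorem foldl {l : α → List β} {s : α → σ} {step : α × σ × β → σ} (hl : Fn κ l) (hs : Fn κ s)
    (hstep : Fn κ step)
    (hb : κ = true → ∃ B : α → ℕ, PolyBdd B ∧ ∀ a l', l' <+: l a →
      sz (l'.foldl (fun s b => step (a, s, b)) (s a)) ≤ B a) :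
    Fn κ (fun a => (l a).foldl (fun s b => step (a, s, b)) (s a)) := by
  obtain ⟨p, T, h1, h2⟩ := hl
  obtain ⟨q, S, h3, h4⟩ := hs
  obtain ⟨r, R, h5, h6⟩ := hstep
  refine ⟨.comp (.comp .right .right) (.comp (foldLoop r) (.pair p (.pair .id q))),
    fun a => T a + S a + ((l a).length + 1) * (foldMax step R a (l a) (s a) + 40) + 20,
    fun a => ?_, fun hκ => ?_⟩
  · have h := ((h1 a).pair (Runs.id.pair (h3 a))).comp (foldRuns h5 a (l a) (s a) le_rfl).runs
    exact (h.comp (Runs.comp Runs.right Runs.right)).mono (by simp only [List.length_map]; omega)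
  · obtain ⟨B, hB, hB'⟩ := hb hκ
    obtain ⟨c, hc⟩ := (h6 hκ).1
    refine ⟨(((h2 hκ).1.add (h4 hκ).1).add (PolyBdd.mul (((h2 hκ).2.mono fun a =>
      length_le_sz (l a)).add (PolyBdd.const 1)) (PolyBdd.add (?_ : PolyBdd _)
        (PolyBdd.const 40)))).add (PolyBdd.const 20), hB.mono fun a => hB' a _ List.prefix_rfl⟩
    refine (((PolyBdd.size.add hB).add (h2 hκ).2).pow_comp c).mono fun a => ?_
    refine foldMax_le fun l' b hl' => (hc _).trans (Nat.pow_le_pow_left ?_ c)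
    have h7 := hB' a l' ((List.prefix_append _ _).trans hl')
    have h8 : sz b < sz (l a) := sz_lt_of_mem (hl'.subset (by simp))
    simp only [sz_prod]
    omega

/-- Iteration over a list when each round increases the state by a bounded amount. -/
theorem foldl_add {l : α → List β} {s : α → σ} {step : α × σ × β → σ} (hl : Fn κ l)
    (hs : Fn κ s) (hstep : Fn κ step)
    (hb : κ = true → ∃ B : α → ℕ, PolyBdd B ∧ ∀ a s b, b ∈ l a →
      sz (step (a, s, b)) ≤ sz s + B a) :
    Fn κ (fun a => (l a).foldl (fun s b => step (a, s, b)) (s a)) := by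
  refine foldl hl hs hstep fun hκ => ?_
  obtain ⟨B, hB, hB'⟩ := hb hκ
  subst hκ
  refine ⟨fun a => sz (s a) + (l a).length * B a, hs.sz_bdd.add ((hl.sz_bdd.mono fun a =>
    length_le_sz (l a)).mul hB), fun a l' hl' => ?_⟩
  have key : ∀ l' : List β, (∀ b ∈ l', b ∈ l a) →
      sz (l'.foldl (fun s b => step (a, s, b)) (s a)) ≤ sz (s a) + l'.length * B a := by
    intro l'
    induction l' using List.reverseRecOn with
    | nil => simp
    | append_singleton l' b ih =>
      intro h
      have h1 := ih fun b hb => h b (by simp [hb])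
      have h2 := hB' a (l'.foldl (fun s b => step (a, s, b)) (s a)) b (h b (by simp))
      simp only [List.foldl_append, List.foldl_cons, List.foldl_nil, List.length_append,
        List.length_singleton, Nat.add_mul]
      omega
  refine (key l' fun b hb => hl'.subset hb).trans ?_
  exact Nat.add_le_add_left (Nat.mul_le_mul_right _ hl'.length_le) _

end Fn

/-! ### A library of feasible functions -/

namespace Fn

variable {α β γ σ : Type} [TreeEnc α] [TreeEnc β] [TreeEnc γ] [TreeEnc σ] {κ : Bool}

/-- The size of a feasible function of two arguments, the second of which is taken from a list. -/
theorem sz_bdd_mem {f : α × β → γ} (hf : Fn true f) {l : α → List β} (hl : Fn true l) :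
    ∃ B : α → ℕ, PolyBdd B ∧ ∀ a b, b ∈ l a → sz (f (a, b)) ≤ B a := by
  obtain ⟨c, hc⟩ := hf.sz_bdd
  refine ⟨_, (PolyBdd.size.add hl.sz_bdd).pow_comp c, fun a b hb => (hc _).trans ?_⟩
  have := sz_lt_of_mem hb
  exact Nat.pow_le_pow_left (by simp; omega) c

theorem some {f : α → β} (hf : Fn κ f) : Fn κ (fun a => Option.some (f a)) := by
  refine comp (g := fun b : β => Option.some b) ?_ hf
  exact ⟨.pair .nil .id, fun _ => 3, fun a => Prog.Runs.nil.pair Prog.Runs.id,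
    fun _ => ⟨PolyBdd.const 3, PolyBdd.size⟩⟩

theorem none : Fn κ (fun _ : α => (Option.none : Option β)) := const _

theorem cons {f : α → β} {g : α → List β} (hf : Fn κ f) (hg : Fn κ g) :
    Fn κ (fun a => f a :: g a) := by
  refine comp (g := fun b : β × List β => b.1 :: b.2) (of_enc_eq (fun _ => rfl) fun _ => ?_)
    (hf.pair hg)
  exact (PolyBdd.size.add (PolyBdd.const 1)).mono fun a => by simp; omega

theorem opaque_of {f : α → β} (hf : Fn κ f) : Fn κ (fun a => enc (f a)) :=
  comp (g := fun b : β => enc b) (of_enc_eq (fun _ => rfl) fun _ => PolyBdd.const 0) hf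

theorem tail {f : α → List β} (hf : Fn κ f) : Fn κ (fun a => (f a).tail) := by
  refine (list_cases hf (const ([] : List β)) (snd.comp snd)).of_eq fun a => ?_
  cases f a <;> rfl

theorem headD {f : α → List β} {d : α → β} (hf : Fn κ f) (hd : Fn κ d) :
    Fn κ (fun a => (f a).headD (d a)) := by
  refine (list_cases hf hd (fst.comp snd)).of_eq fun a => ?_
  cases f a <;> rfl

theorem isEmpty {f : α → List β} (hf : Fn κ f) : Fn κ (fun a => (f a).isEmpty) := by
  refine (list_cases hf (const true) (const false)).of_eq fun a => ?_
  cases f a <;> rfl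

theorem isSome {f : α → Option β} (hf : Fn κ f) : Fn κ (fun a => (f a).isSome) := by
  refine (option_cases hf (const false) (const true)).of_eq fun a => ?_
  cases f a <;> rfl

theorem isNil {f : α → BTree} (hf : Fn κ f) : Fn κ (fun a => (f a).isNil) := by
  refine comp (g := BTree.isNil) ?_ hf
  refine ⟨.ite .id .nil (.pair .nil .nil), fun _ => 5, fun a => ?_,
    fun _ => ⟨PolyBdd.const 5, PolyBdd.const 0⟩⟩
  cases a with
  | nil => exact (Prog.Runs.ite_neg Prog.Runs.id (Prog.Runs.nil.pair Prog.Runs.nil)).mono le_rfl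
  | cons x y => exact (Prog.Runs.ite_pos Prog.Runs.id (by simp) Prog.Runs.nil).mono (by simp)

theorem not {f : α → Bool} (hf : Fn κ f) : Fn κ (fun a => !(f a)) :=
  (ite hf (const false) (const true)).of_eq fun a => by cases f a <;> rfl

theorem and {f g : α → Bool} (hf : Fn κ f) (hg : Fn κ g) : Fn κ (fun a => f a && g a) :=
  (ite hf hg (const false)).of_eq fun a => by cases f a <;> rfl

theorem or {f g : α → Bool} (hf : Fn κ f) (hg : Fn κ g) : Fn κ (fun a => f a || g a) :=
  (ite hf (const true) hg).of_eq fun a => by cases f a <;> rfl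

theorem reverse {l : α → List β} (hl : Fn κ l) : Fn κ (fun a => (l a).reverse) := by
  refine comp (g := fun l : List β => l.reverse) (weaken ?_) hl
  refine (foldl_add (l := fun l : List β => l) (s := fun _ => ([] : List β))
    (step := fun a => a.2.2 :: a.2.1) Fn.id (const _) (cons (snd.comp snd) (fst.comp snd))
    fun _ => ⟨fun l => sz l, PolyBdd.size, fun l s b hb => ?_⟩).of_eq fun l => ?_
  · have := sz_lt_of_mem hb
    simp
    omega
  · rw [List.foldl_flip_cons_eq_append]
    simp

theorem append {l l' : α → List β} (hl : Fn κ l) (hl' : Fn κ l') :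
    Fn κ (fun a => l a ++ l' a) := by
  refine comp (g := fun l : List β × List β => l.1 ++ l.2) (weaken ?_) (hl.pair hl')
  refine (foldl_add (l := fun l : List β × List β => l.1.reverse) (s := fun l => l.2)
    (step := fun a => a.2.2 :: a.2.1) (reverse fst) snd (cons (snd.comp snd) (fst.comp snd))
    fun _ => ⟨fun l => sz l, PolyBdd.size, fun l s b hb => ?_⟩).of_eq fun l => ?_
  · have := sz_lt_of_mem hb
    simp at this ⊢
    omega
  · rw [List.foldl_flip_cons_eq_append]
    simp

theorem map {l : α → List β} {f : α × β → γ} (hl : Fn κ l) (hf : Fn κ f) :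
    Fn κ (fun a => (l a).map fun b => f (a, b)) := by
  refine (reverse (foldl_add (l := l) (s := fun _ => ([] : List γ))
    (step := fun a => f (a.1, a.2.2) :: a.2.1) hl (const _)
    (cons (hf.comp (fst.pair (snd.comp snd))) (fst.comp snd)) fun hκ => ?_)).of_eq fun a => ?_
  · subst hκ
    obtain ⟨B, hB, hB'⟩ := sz_bdd_mem hf hl
    refine ⟨_, hB.add (PolyBdd.const 1), fun a s b hb => ?_⟩
    have := hB' a b hb
    simp
    omega
  · have : ∀ (l : List β) (s : List γ), l.foldl (fun s b => f (a, b) :: s) s =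
        (l.map fun b => f (a, b)).reverse ++ s := by
      intro l
      induction l with
      | nil => simp
      | cons b l ih => intro s; simp [ih]
    simp [this]

theorem flatMap {l : α → List β} {f : α × β → List γ} (hl : Fn κ l) (hf : Fn κ f) :
    Fn κ (fun a => (l a).flatMap fun b => f (a, b)) := by
  refine (foldl_add (l := l) (s := fun _ => ([] : List γ))
    (step := fun a => a.2.1 ++ f (a.1, a.2.2)) hl (const _)
    (append (fst.comp snd) (hf.comp (fst.pair (snd.comp snd)))) fun hκ => ?_).of_eq fun a => ?_
  · subst hκ
    obtain ⟨B, hB, hB'⟩ := sz_bdd_mem hf hl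
    refine ⟨_, hB, fun a s b hb => ?_⟩
    have := hB' a b hb
    simp
    omega
  · have : ∀ (l : List β) (s : List γ), l.foldl (fun s b => s ++ f (a, b)) s =
        s ++ (l.flatMap fun b => f (a, b)) := by
      intro l
      induction l with
      | nil => simp
      | cons b l ih => intro s; simp [ih]
    simp [this]

theorem flatten {l : α → List (List β)} (hl : Fn κ l) : Fn κ (fun a => (l a).flatten) :=
  (flatMap (f := fun a : α × List β => a.2) hl snd).of_eq fun a => by
    simp [List.flatMap_id']

theorem all {l : α → List β} {f : α × β → Bool} (hl : Fn κ l) (hf : Fn κ f) :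
    Fn κ (fun a => (l a).all fun b => f (a, b)) := by
  refine (foldl_add (l := l) (s := fun _ => true)
    (step := fun a => a.2.1 && f (a.1, a.2.2)) hl (const _)
    (and (fst.comp snd) (hf.comp (fst.pair (snd.comp snd))))
    fun hκ => ⟨fun _ => 0, PolyBdd.const 0, fun _ _ _ _ => le_rfl⟩).of_eq fun a => ?_
  have : ∀ (l : List β) (s : Bool), l.foldl (fun s b => s && f (a, b)) s =
      (s && l.all fun b => f (a, b)) := by
    intro l
    induction l with
    | nil => simp
    | cons b l ih => intro s; simp [ih, Bool.and_assoc]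
  simp [this]

theorem find? {l : α → List β} {f : α × β → Bool} (hl : Fn κ l) (hf : Fn κ f) :
    Fn κ (fun a => (l a).find? fun b => f (a, b)) := by
  refine (foldl (l := l) (s := fun _ => (Option.none : Option β))
    (step := fun a => if a.2.1.isSome then a.2.1 else
      if f (a.1, a.2.2) then Option.some a.2.2 else Option.none) hl (const _)
    (ite (isSome (fst.comp snd)) (fst.comp snd)
      (ite (hf.comp (fst.pair (snd.comp snd))) (some (snd.comp snd)) none))
    fun hκ => ?_).of_eq fun a => ?_
  · subst hκ
    refine ⟨_, hl.sz_bdd, fun a l' hl' => ?_⟩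
    have : ∀ (l' : List β) (s : Option β), sz s ≤ sz (l a) → (∀ b ∈ l', b ∈ l a) →
        sz (l'.foldl (fun s b => if s.isSome then s else
          if f (a, b) then Option.some b else Option.none) s) ≤ sz (l a) := by
      intro l'
      induction l' with
      | nil => intro s h _; simpa using h
      | cons b l' ih =>
        intro s hs h
        refine ih _ ?_ fun b hb => h b (by simp [hb])
        have := sz_lt_of_mem (h b (by simp))
        dsimp only
        split_ifs
        · exact hs
        · simp; omega
        · simp
    exact this l' _ (by simp) fun b hb => hl'.subset hb
  · have : ∀ (l : List β) (s : Option β), l.foldl (fun s b => if s.isSome then s else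
          if f (a, b) then Option.some b else Option.none) s = s.or (l.find? fun b => f (a, b)) := by
      intro l
      induction l with
      | nil => simp
      | cons b l ih =>
        intro s
        rw [List.foldl_cons, ih]
        cases s <;> cases h : f (a, b) <;> simp [h]
    simp [this]

/-! ### Bounded iteration and arithmetic in unary -/

theorem length {l : α → List β} (hl : Fn κ l) : Fn κ (fun a => (l a).length) := by
  refine comp (g := fun l : List Unit => l.length)
    (of_enc_eq (fun l => ?_) fun _ => PolyBdd.size.mono fun l => length_le_sz l)
    (map (f := fun _ => ()) hl (const _)) |>.of_eq fun a => by simp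
  induction l with
  | nil => rfl
  | cons b l ih => simp [ih]

theorem replicate_unit {n : α → ℕ} (hn : Fn κ n) : Fn κ (fun a => List.replicate (n a) ()) := by
  refine comp (g := fun n : ℕ => List.replicate n ()) (of_enc_eq (fun n => ?_) fun _ =>
    PolyBdd.size.mono fun n => ?_) hn
  · induction n with
    | zero => rfl
    | succ n ih => simp [List.replicate_succ, ih]
  · simp only [sz_nat]
    induction n with
    | zero => simp
    | succ n ih => simp [List.replicate_succ]; omega

/-- Bounded iteration. -/
theorem iterate {n : α → ℕ} {s : α → σ} {step : α × σ → σ} (hn : Fn κ n) (hs : Fn κ s)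
    (hstep : Fn κ step)
    (hb : κ = true → ∃ B : α → ℕ, PolyBdd B ∧ ∀ a m, m ≤ n a →
      sz ((fun s => step (a, s))^[m] (s a)) ≤ B a) :
    Fn κ (fun a => (fun s => step (a, s))^[n a] (s a)) := by
  have key : ∀ (a : α) (l : List Unit) (s : σ), l.foldl (fun s _ => step (a, s)) s =
      (fun s => step (a, s))^[l.length] s := by
    intro a l
    induction l with
    | nil => simp
    | cons b l ih => intro s; simp [ih]
  refine (foldl (l := fun a => List.replicate (n a) ()) (s := s)
    (step := fun a => step (a.1, a.2.1)) (replicate_unit hn) hs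
    (hstep.comp (fst.pair (fst.comp snd))) fun hκ => ?_).of_eq fun a => by simp [key]
  obtain ⟨B, hB, hB'⟩ := hb hκ
  refine ⟨B, hB, fun a l' hl' => ?_⟩
  rw [key]
  exact hB' a _ (by simpa using hl'.length_le)

theorem succ {n : α → ℕ} (hn : Fn κ n) : Fn κ (fun a => n a + 1) := by
  refine comp (g := fun n : ℕ => n + 1) ?_ hn
  exact ⟨.pair .nil .id, fun _ => 3, fun a => Prog.Runs.nil.pair Prog.Runs.id,
    fun _ => ⟨PolyBdd.const 3, PolyBdd.size.add (PolyBdd.const 1)⟩⟩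

theorem pred {n : α → ℕ} (hn : Fn κ n) : Fn κ (fun a => n a - 1) := by
  refine comp (g := fun n : ℕ => n - 1) ?_ hn
  refine ⟨.right, fun _ => 1, fun a => ?_, fun _ => ⟨PolyBdd.const 1,
    PolyBdd.size.mono fun a => by simp⟩⟩
  cases a <;> exact Prog.Runs.right

theorem add {m n : α → ℕ} (hm : Fn κ m) (hn : Fn κ n) : Fn κ (fun a => m a + n a) :=
  (length (append (replicate_unit hm) (replicate_unit hn))).of_eq fun a => by simp

theorem sub {m n : α → ℕ} (hm : Fn κ m) (hn : Fn κ n) : Fn κ (fun a => m a - n a) := by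
  refine comp (g := fun a : ℕ × ℕ => a.1 - a.2) (weaken ?_) (hm.pair hn)
  have key : ∀ a m : ℕ, (fun s => s - 1)^[m] a = a - m := by
    intro a m
    induction m with
    | zero => rfl
    | succ m ih => rw [Function.iterate_succ_apply', ih]; omega
  refine (iterate (n := fun a : ℕ × ℕ => a.2) (s := fun a => a.1) (step := fun a => a.2 - 1)
    snd fst (pred snd) fun _ => ⟨_, PolyBdd.size, fun a m _ => ?_⟩).of_eq fun a => key _ _
  dsimp only
  rw [key]
  simp
  omega

theorem mul {m n : α → ℕ} (hm : Fn κ m) (hn : Fn κ n) : Fn κ (fun a => m a * n a) := by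
  refine (length (flatMap (f := fun a : α × Unit => List.replicate (n a.1) ()) (replicate_unit hm)
    (replicate_unit (hn.comp fst)))).of_eq fun a => ?_
  simp

theorem eq_zero {n : α → ℕ} (hn : Fn κ n) : Fn κ (fun a => decide (n a = 0)) :=
  (isEmpty (replicate_unit hn)).of_eq fun a => by cases n a <;> simp [List.replicate_succ]

theorem le {m n : α → ℕ} (hm : Fn κ m) (hn : Fn κ n) : Fn κ (fun a => decide (m a ≤ n a)) :=
  (eq_zero (sub hm hn)).of_eq fun a => by simp [Nat.sub_eq_zero_iff_le]

theorem lt {m n : α → ℕ} (hm : Fn κ m) (hn : Fn κ n) : Fn κ (fun a => decide (m a < n a)) :=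
  le (succ hm) hn

theorem eq {m n : α → ℕ} (hm : Fn κ m) (hn : Fn κ n) : Fn κ (fun a => decide (m a = n a)) :=
  (and (le hm hn) (le hn hm)).of_eq fun a => by
    rw [← Bool.decide_and]; congr 1; simp [le_antisymm_iff]

theorem drop {l : α → List β} {n : α → ℕ} (hl : Fn κ l) (hn : Fn κ n) :
    Fn κ (fun a => (l a).drop (n a)) := by
  have key : ∀ (l : List β) m, (fun s => s.tail)^[m] l = l.drop m := by
    intro l m
    induction m with
    | zero => rfl
    | succ m ih => rw [Function.iterate_succ_apply', ih, List.tail_drop]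
  refine comp (g := fun a : List β × ℕ => a.1.drop a.2) (weaken ?_) (hl.pair hn)
  refine (iterate (n := fun a : List β × ℕ => a.2) (s := fun a => a.1) (step := fun a => a.2.tail)
    snd fst (tail snd) fun _ => ⟨_, PolyBdd.size, fun a m _ => ?_⟩).of_eq fun a => key _ _
  dsimp only
  rw [key]
  have := sz_le_of_suffix (List.drop_suffix m a.1)
  simp
  omega

theorem getD {l : α → List β} {n : α → ℕ} {d : α → β} (hl : Fn κ l) (hn : Fn κ n) (hd : Fn κ d) :
    Fn κ (fun a => (l a).getD (n a) (d a)) :=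
  (headD (drop hl hn) hd).of_eq fun a => by
    rw [List.headD_eq_head?_getD, List.head?_drop, List.getD_eq_getElem?_getD]

theorem take {l : α → List β} {n : α → ℕ} (hl : Fn κ l) (hn : Fn κ n) :
    Fn κ (fun a => (l a).take (n a)) := by
  refine (reverse (drop (reverse hl) (sub (length hl) hn))).of_eq fun a => ?_
  rw [List.drop_reverse, List.reverse_reverse]
  rcases le_total (n a) (l a).length with h | h
  · congr 1; omega
  · rw [List.take_of_length_le h, List.take_of_length_le (by omega)]

theorem range {n : α → ℕ} (hn : Fn κ n) : Fn κ (fun a => List.range (n a)) := by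
  refine comp (g := fun n : ℕ => List.range n) (weaken ?_) hn
  have key : ∀ m : ℕ, (fun s : List ℕ => s ++ [s.length])^[m] [] = List.range m := by
    intro m
    induction m with
    | zero => rfl
    | succ m ih => rw [Function.iterate_succ_apply', ih, List.range_succ]; simp
  refine (iterate (n := fun a : ℕ => a) (s := fun _ => ([] : List ℕ))
    (step := fun a => a.2 ++ [a.2.length])
    Fn.id (const _) (append snd (cons (length snd) (const _)))
    fun _ => ⟨_, PolyBdd.size.mul (PolyBdd.size.add (PolyBdd.const 1)), fun a m hm => ?_⟩).of_eq
      fun a => key _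
  dsimp only
  rw [key]
  refine (sz_le_mul (B := a) fun b hb => ?_).trans ?_
  · simp at hb ⊢; omega
  · simp
    gcongr

/-- Repeated subtraction: after `i` rounds the value is below a positive modulus or has dropped by
at least `i`, so as many rounds as the dividend suffice. -/
theorem mod {m n : α → ℕ} (hm : Fn κ m) (hn : Fn κ n) : Fn κ (fun a => m a % n a) := by
  refine comp (g := fun a : ℕ × ℕ => a.1 % a.2) (weaken ?_) (hm.pair hn)
  have key : ∀ a k i : ℕ, (fun s => if decide (k ≤ s) then s - k else s)^[i] a ≤ a ∧
      (fun s => if decide (k ≤ s) then s - k else s)^[i] a % k = a % k ∧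
      (0 < k → (fun s => if decide (k ≤ s) then s - k else s)^[i] a < k ∨
        (fun s => if decide (k ≤ s) then s - k else s)^[i] a + i ≤ a) := by
    intro a k i
    induction i with
    | zero => simp
    | succ i ih =>
      rw [Function.iterate_succ_apply']
      generalize (fun s => if decide (k ≤ s) then s - k else s)^[i] a = r at ih ⊢
      obtain ⟨h1, h2, h3⟩ := ih
      simp only [decide_eq_true_eq]
      split_ifs with h
      · refine ⟨by omega, ?_, fun hk => ?_⟩
        · rw [← h2, ← Nat.mod_eq_sub_mod h]
        · rcases h3 hk with h3 | h3 <;> omega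
      · exact ⟨h1, h2, fun hk => Or.inl (by omega)⟩
  refine (ite (c := fun a : ℕ × ℕ => decide (a.2 = 0)) (f := fun a => a.1) (eq_zero snd) fst
    (iterate (n := fun a : ℕ × ℕ => a.1) (s := fun a => a.1)
    (step := fun a => if decide (a.1.2 ≤ a.2) then a.2 - a.1.2 else a.2)
    fst fst (ite (le (snd.comp fst) snd) (sub snd (snd.comp fst)) snd)
    fun _ => ⟨_, PolyBdd.size, fun a m _ => ?_⟩)).of_eq fun a => ?_
  · have := (key a.1 a.2 m).1
    simp only [sz_nat, sz_prod] at this ⊢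
    omega
  · obtain ⟨h1, h2, h3⟩ := key a.1 a.2 a.1
    dsimp only
    split_ifs with h
    · rw [decide_eq_true_eq] at h
      simp [h]
    · rw [decide_eq_true_eq] at h
      rcases h3 (by omega) with h3 | h3
      · rw [← h2, Nat.mod_eq_of_lt h3]
      · rw [← h2, Nat.mod_eq_of_lt (by omega)]

/-- The quotient counts the positive multiples of the divisor that do not exceed the dividend. -/
theorem div {m n : α → ℕ} (hm : Fn κ m) (hn : Fn κ n) : Fn κ (fun a => m a / n a) := by
  refine comp (g := fun a : ℕ × ℕ => a.1 / a.2) (weaken ?_) (hm.pair hn)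
  refine (length (flatMap (l := fun a : ℕ × ℕ => List.range a.1)
    (f := fun b => if (decide (0 < b.1.2) && decide ((b.2 + 1) * b.1.2 ≤ b.1.1)) then [()] else [])
    (range fst) (ite (and (lt (const 0) (snd.comp fst))
      (le (mul (succ snd) (snd.comp fst)) (fst.comp fst))) (const _) (const _)))).of_eq fun a => ?_
  rcases Nat.eq_zero_or_pos a.2 with h | h
  · simp [h]
  · have key : ∀ m, ((List.range m).flatMap fun b =>
        if (decide (0 < a.2) && decide ((b + 1) * a.2 ≤ a.1)) then [()] else []).length =
          min m (a.1 / a.2) := by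
      intro m
      induction m with
      | zero => simp
      | succ m ih =>
        rw [List.range_succ, List.flatMap_append, List.length_append, ih]
        have h1 : (m + 1) * a.2 ≤ a.1 ↔ m + 1 ≤ a.1 / a.2 := (Nat.le_div_iff_mul_le h).symm
        simp only [h, decide_true, Bool.true_and, h1, List.flatMap_cons, List.flatMap_nil,
          List.append_nil, decide_eq_true_eq]
        split_ifs with h2
        · simp; omega
        · simp; omega
    rw [key]
    exact min_eq_right (Nat.div_le_self _ _)

/-- A counter and a power of two advance together and are frozen when the next doubling would exceed
`n`, which keeps the state of linear size. -/
theorem log_two {n : α → ℕ} (hn : Fn κ n) : Fn κ (fun a => Nat.log 2 (n a)) := by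
  refine comp (g := fun n : ℕ => Nat.log 2 n) (weaken ?_) hn
  have key : ∀ n i : ℕ, (fun s => if decide (2 * s.2 ≤ n) then (s.1 + 1, 2 * s.2) else s)^[i]
      ((0, 1) : ℕ × ℕ) = (min i (Nat.log 2 n), 2 ^ min i (Nat.log 2 n)) := by
    intro n i
    induction i with
    | zero => simp
    | succ i ih =>
      rw [Function.iterate_succ_apply', ih]
      dsimp only
      rcases Nat.eq_zero_or_pos n with rfl | h0
      · simp
      have h1 : 2 * 2 ^ min i (Nat.log 2 n) ≤ n ↔ min i (Nat.log 2 n) + 1 ≤ Nat.log 2 n := by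
        rw [← pow_succ']
        exact (Nat.le_log_iff_pow_le (by norm_num) (by omega)).symm
      simp only [h1, decide_eq_true_eq]
      split_ifs with h2
      · rw [show min (i + 1) (Nat.log 2 n) = min i (Nat.log 2 n) + 1 by omega, pow_succ']
      · rw [show min (i + 1) (Nat.log 2 n) = min i (Nat.log 2 n) by omega]
  refine (fst.comp (iterate (n := fun a : ℕ => a) (s := fun _ => ((0, 1) : ℕ × ℕ))
    (step := fun a => if decide (2 * a.2.2 ≤ a.1) then (a.2.1 + 1, 2 * a.2.2) else a.2)
    Fn.id (const _) (ite (le (mul (const 2) (snd.comp snd)) fst)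
      (pair (succ (fst.comp snd)) (mul (const 2) (snd.comp snd))) snd)
    fun _ => ⟨_, (PolyBdd.size.add PolyBdd.size).add (PolyBdd.const 1), fun n m hm => ?_⟩)).of_eq
    fun n => ?_
  · dsimp only
    rw [key]
    simp only [sz_prod, sz_nat] at hm ⊢
    rcases Nat.eq_zero_or_pos n with rfl | h0
    · simp
    have h1 : 2 ^ min m (Nat.log 2 n) ≤ n :=
      (Nat.pow_le_pow_right (by norm_num) (min_le_right _ _)).trans (Nat.pow_log_le_self 2 (by omega))
    have h2 : min m (Nat.log 2 n) ≤ n := (min_le_left _ _).trans hm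
    omega
  · dsimp only
    rw [key]
    exact min_eq_right (Nat.log_le_self _ _)

end Fn

/-- Whether more than half of the bits in a list are true. -/
def majority (l : List Bool) : Bool := decide (l.length < 2 * l.count true)

theorem Fn.majority {α : Type} [TreeEnc α] {κ : Bool} {l : α → List Bool} (hl : Fn κ l) :
    Fn κ (fun a => majority (l a)) := by
  refine (Fn.lt (length hl) (mul (const 2) (length (flatMap
    (f := fun b : α × Bool => if b.2 then [()] else []) hl
      (ite snd (const _) (const _)))))).of_eq fun a => ?_
  have : ∀ l : List Bool, (l.flatMap fun b => if b then [()] else []).length = l.count true := by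
    intro l
    induction l with
    | nil => rfl
    | cons b l ih => cases b <;> simp_all
  simp only [this, _root_.majority]

/-! ### Clocked runs on a tape are feasible -/

namespace Fn

variable {α β γ σ : Type} [TreeEnc α] [TreeEnc β] [TreeEnc γ] [TreeEnc σ] {κ : Bool}

theorem left {f : α → BTree} (hf : Fn κ f) : Fn κ (fun a => (f a).left) :=
  comp (g := BTree.left) ⟨.left, fun _ => 1, fun _ => Prog.Runs.left,
    fun _ => ⟨PolyBdd.const 1, PolyBdd.const 0⟩⟩ hf

theorem right {f : α → BTree} (hf : Fn κ f) : Fn κ (fun a => (f a).right) :=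
  comp (g := BTree.right) ⟨.right, fun _ => 1, fun _ => Prog.Runs.right,
    fun _ => ⟨PolyBdd.const 1, PolyBdd.const 0⟩⟩ hf

theorem btree_cons {f g : α → BTree} (hf : Fn κ f) (hg : Fn κ g) :
    Fn κ (fun a => BTree.cons (f a) (g a)) :=
  comp (g := fun a : BTree × BTree => BTree.cons a.1 a.2)
    (of_enc_eq (fun _ => rfl) fun _ => PolyBdd.const 0) (hf.pair hg)

theorem option_bind {f : α → Option β} {g : α × β → Option γ} (hf : Fn κ f) (hg : Fn κ g) :
    Fn κ (fun a => (f a).bind fun b => g (a, b)) :=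
  (option_cases hf none hg).of_eq fun a => by cases f a <;> rfl

theorem tickT {t : α → ℕ} {F : α × ℕ → Prog.TapeResult} (ht : Fn κ t) (hF : Fn κ F) :
    Fn κ (fun a => Prog.tickT (t a) fun s => F (a, s)) :=
  (ite (eq_zero ht) none (hF.comp (Fn.id.pair (pred ht)))).of_eq fun a => by
    cases h : t a <;> simp [Prog.tickT]

end Fn

namespace Prog

/-- One round of a loop on a tape; the bit indicates that the loop is finished. -/
def loopStep (c p : BTree → ℕ → List Bool → TapeResult) (st : Bool × TapeResult) :
    Bool × TapeResult :=
  if st.1 then st else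
    match st.2 with
    | none => (true, none)
    | some a =>
      match tickT a.2.1 fun s => c a.1 s a.2.2 with
      | none => (true, none)
      | some r =>
        if r.1.isNil then (true, some (a.1, r.2))
        else
          match p a.1 r.2.1 r.2.2 with
          | none => (true, none)
          | some r' => (false, some r')

theorem loopStep_iterate_true (c p : BTree → ℕ → List Bool → TapeResult) (m : ℕ) (r : TapeResult) :
    (loopStep c p)^[m] (true, r) = (true, r) := by
  induction m with
  | zero => rfl
  | succ m ih => rw [Function.iterate_succ_apply]; simpa [loopStep] using ih

/-- The flag for finished loops turns the recursion into the iteration of a total function, to which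
`Fn.iterate` applies. A loop that is not flagged after `m` rounds has run out of rounds. -/
theorem loopT_eq_iterate (c p : BTree → ℕ → List Bool → TapeResult) (m : ℕ)
    (a : BTree × ℕ × List Bool) :
    loopT c p m a.1 a.2.1 a.2.2 =
      if ((loopStep c p)^[m] (false, some a)).1 then ((loopStep c p)^[m] (false, some a)).2
      else none := by
  induction m generalizing a with
  | zero => simp [loopT]
  | succ m ih =>
    obtain ⟨x, t, w⟩ := a
    rw [Function.iterate_succ_apply]
    cases t with
    | zero => simp [loopT, tickT, loopStep, loopStep_iterate_true]
    | succ t =>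
      cases h1 : c x t w with
      | none => simp [loopT, tickT, loopStep, loopStep_iterate_true, h1]
      | some r =>
        cases h2 : r.1.isNil with
        | true => simp [loopT, tickT, loopStep, loopStep_iterate_true, h1, h2]
        | false =>
          cases h3 : p x r.2.1 r.2.2 with
          | none => simp [loopT, tickT, loopStep, loopStep_iterate_true, h1, h2, h3]
          | some r' =>
            have := ih r'
            simp only [loopT, tickT, h1, h2, h3, loopStep, Option.bind_some, Bool.false_eq_true,
              if_false]
            exact this

theorem Regular.sz_le {F : ℕ → List Bool → TapeResult} (hF : Regular F) {t : ℕ} {w : List Bool}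
    {r : BTree × ℕ × List Bool} (h : F t w = some r) : sz r ≤ t + sz w := by
  obtain ⟨v, t₀, rfl, rfl, _, _⟩ := hF t w r.1 r.2.1 r.2.2 h
  simp
  omega

/-- Trees count as size zero, while time and tape only shrink. This gives the bound on intermediate
states that makes the simulation of loops feasible. -/
theorem sz_loopStep_iterate_le {c p : BTree → ℕ → List Bool → TapeResult}
    (hc : ∀ x, Regular (c x)) (hp : ∀ x, Regular (p x)) (m : ℕ) (a : BTree × ℕ × List Bool) :
    sz ((loopStep c p)^[m] (false, some a)) ≤ sz a := by
  induction m with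
  | zero => simp
  | succ m ih =>
    rw [Function.iterate_succ_apply']
    generalize (loopStep c p)^[m] (false, some a) = st at ih
    obtain ⟨b, r⟩ := st
    refine le_trans ?_ ih
    unfold loopStep
    split_ifs with hb
    · rfl
    · rcases r with _ | ⟨x, t, w⟩
      · simp
      · cases t with
        | zero => simp [tickT]
        | succ t =>
          simp only [tickT]
          cases h1 : c x t w with
          | none => simp
          | some r =>
            have h4 := (hc x).sz_le h1
            simp only [sz_prod, sz_btree, sz_nat] at h4
            dsimp only
            split_ifs with h2
            · simp; omega
            · cases h3 : p x r.2.1 r.2.2 with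
              | none => simp
              | some r' =>
                have h5 := (hp x).sz_le h3
                simp only [sz_prod, sz_btree, sz_nat] at h5
                simp; omega

theorem fn_loopStep {c p : BTree → ℕ → List Bool → TapeResult}
    (hc : Fn true fun a : BTree × ℕ × List Bool => c a.1 a.2.1 a.2.2)
    (hp : Fn true fun a : BTree × ℕ × List Bool => p a.1 a.2.1 a.2.2) :
    Fn true (loopStep c p) := by
  have h1 : Fn true fun a : BTree × ℕ × List Bool => tickT a.2.1 fun s => c a.1 s a.2.2 :=
    Fn.tickT (F := fun a => c a.1.1 a.2 a.1.2.2) (Fn.fst.comp Fn.snd)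
      (hc.comp ((Fn.fst.comp Fn.fst).pair (Fn.snd.pair (Fn.snd.comp (Fn.snd.comp Fn.fst)))))
  have h2 : Fn true fun a : (BTree × ℕ × List Bool) × (BTree × ℕ × List Bool) =>
      p a.1.1 a.2.2.1 a.2.2.2 :=
    hp.comp (f := fun a : (BTree × ℕ × List Bool) × (BTree × ℕ × List Bool) =>
      (a.1.1, a.2.2)) ((Fn.fst.comp Fn.fst).pair (Fn.snd.comp Fn.snd))
  have h3 : Fn true fun a : BTree × ℕ × List Bool =>
      (match tickT a.2.1 fun s => c a.1 s a.2.2 with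
      | none => (true, none)
      | some r =>
        if r.1.isNil then (true, some (a.1, r.2))
        else
          match p a.1 r.2.1 r.2.2 with
          | none => (true, none)
          | some r' => (false, some r') : Bool × TapeResult) :=
    (Fn.option_cases (g := fun a : (BTree × ℕ × List Bool) × (BTree × ℕ × List Bool) =>
      if a.2.1.isNil then (true, some (a.1.1, a.2.2))
        else
          match p a.1.1 a.2.2.1 a.2.2.2 with
          | none => (true, none)
          | some r' => (false, some r')) h1 (Fn.const (true, none))
      (Fn.ite (Fn.isNil (Fn.fst.comp Fn.snd))
        ((Fn.const true).pair (Fn.some ((Fn.fst.comp Fn.fst).pair (Fn.snd.comp Fn.snd))))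
        ((Fn.option_cases (g := fun a => (false, some a.2)) h2 (Fn.const (true, none))
          ((Fn.const false).pair (Fn.some Fn.snd))).of_eq fun a => by
            rcases p a.1.1 a.2.2.1 a.2.2.2 with _ | _ <;> rfl))).of_eq fun a => by
      rcases tickT a.2.1 fun s => c a.1 s a.2.2 with _ | _ <;> rfl
  exact Fn.ite Fn.fst Fn.id ((Fn.option_cases (o := fun a : Bool × TapeResult => a.2) Fn.snd
    (Fn.const (true, none)) (h3.comp Fn.snd)).of_eq fun a => by
      rcases a with ⟨_, _ | _⟩ <;> rfl)

/-- For each program, the function that maps an input, a time limit and a tape to the result of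
the run is feasible. -/
theorem fn_runT (p : Prog) :
    Fn true fun a : BTree × ℕ × List Bool => runT p a.1 a.2.1 a.2.2 := by
  have tk : ∀ {F : BTree → ℕ → List Bool → TapeResult},
      Fn true (fun a : BTree × ℕ × List Bool => F a.1 a.2.1 a.2.2) →
      Fn true (fun a : BTree × ℕ × List Bool => tickT a.2.1 fun s => F a.1 s a.2.2) := fun hF =>
    Fn.tickT (F := fun a : (BTree × ℕ × List Bool) × ℕ => _) (Fn.fst.comp Fn.snd)
      (hF.comp ((Fn.fst.comp Fn.fst).pair (Fn.snd.pair (Fn.snd.comp (Fn.snd.comp Fn.fst)))))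
  induction p with
  | id => exact tk (F := fun x s w => some (x, s, w)) (Fn.some Fn.id)
  | nil => exact tk (F := fun x s w => some (BTree.nil, s, w)) (Fn.some ((Fn.const _).pair Fn.snd))
  | left =>
    exact tk (F := fun x s w => some (x.left, s, w))
      (Fn.some ((Fn.left Fn.fst).pair Fn.snd))
  | right =>
    exact tk (F := fun x s w => some (x.right, s, w))
      (Fn.some ((Fn.right Fn.fst).pair Fn.snd))
  | flip =>
    exact tk (F := fun x s w => match w with
      | [] => none
      | b :: w' => some (BTree.ofBool b, s, w'))
      ((Fn.list_cases (g := fun a : (BTree × ℕ × List Bool) × Bool × List Bool =>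
        some (enc a.2.1, a.1.2.1, a.2.2)) (Fn.snd.comp Fn.snd) Fn.none
        (Fn.some ((Fn.opaque_of (Fn.fst.comp Fn.snd)).pair
          ((Fn.fst.comp (Fn.snd.comp Fn.fst)).pair (Fn.snd.comp Fn.snd))))).of_eq fun a => by
            rcases a with ⟨_, _, _ | _⟩ <;> rfl)
  | pair p q hp hq =>
    refine tk (F := fun x s w => (runT p x s w).bind fun r =>
      (runT q x r.2.1 r.2.2).bind fun r' => some (BTree.cons r.1 r'.1, r'.2)) ?_
    refine Fn.option_bind (g := fun a : (BTree × ℕ × List Bool) × (BTree × ℕ × List Bool) =>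
      (runT q a.1.1 a.2.2.1 a.2.2.2).bind fun r' => some (BTree.cons a.2.1 r'.1, r'.2)) hp ?_
    refine Fn.option_bind (g := fun a : ((BTree × ℕ × List Bool) × (BTree × ℕ × List Bool)) ×
      (BTree × ℕ × List Bool) => some (BTree.cons a.1.2.1 a.2.1, a.2.2))
      (hq.comp (f := fun a : (BTree × ℕ × List Bool) × (BTree × ℕ × List Bool) =>
        (a.1.1, a.2.2)) ((Fn.fst.comp Fn.fst).pair (Fn.snd.comp Fn.snd))) ?_
    exact Fn.some ((Fn.btree_cons (Fn.fst.comp (Fn.snd.comp Fn.fst)) (Fn.fst.comp Fn.snd)).pair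
      (Fn.snd.comp Fn.snd))
  | comp q p hq hp =>
    refine tk (F := fun x s w => (runT p x s w).bind fun r => runT q r.1 r.2.1 r.2.2) ?_
    exact Fn.option_bind (g := fun a : (BTree × ℕ × List Bool) × (BTree × ℕ × List Bool) =>
      runT q a.2.1 a.2.2.1 a.2.2.2) hp (hq.comp Fn.snd)
  | ite c p q hc hp hq =>
    refine tk (F := fun x s w => (runT c x s w).bind fun r =>
      if r.1.isNil then runT q x r.2.1 r.2.2 else runT p x r.2.1 r.2.2) ?_
    have hx : Fn true fun a : (BTree × ℕ × List Bool) × (BTree × ℕ × List Bool) =>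
        (a.1.1, a.2.2) := (Fn.fst.comp Fn.fst).pair (Fn.snd.comp Fn.snd)
    exact Fn.option_bind (g := fun a : (BTree × ℕ × List Bool) × (BTree × ℕ × List Bool) =>
      if a.2.1.isNil then runT q a.1.1 a.2.2.1 a.2.2.2 else runT p a.1.1 a.2.2.1 a.2.2.2) hc
      (Fn.ite (Fn.isNil (Fn.fst.comp Fn.snd)) (hq.comp hx) (hp.comp hx))
  | loop c p hc hp =>
    have hst := Fn.iterate (n := fun a : BTree × ℕ × List Bool => a.2.1)
      (s := fun a => (false, some a)) (step := fun a => loopStep (runT c) (runT p) a.2)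
      (Fn.fst.comp Fn.snd) ((Fn.const false).pair (Fn.some Fn.id))
      ((fn_loopStep hc hp).comp Fn.snd) fun _ => ⟨_, PolyBdd.size, fun a m _ =>
        sz_loopStep_iterate_le (regular_runT c) (regular_runT p) m a⟩
    exact (Fn.ite (Fn.fst.comp hst) (Fn.snd.comp hst) Fn.none).of_eq fun a =>
      (loopT_eq_iterate (runT c) (runT p) a.2.1 a).symm

end Prog

/-! ### Halting and acceptance in terms of tapes -/

namespace Prog

/-- Both runs can be carried out on the common tape with time `T + T'`, where `runT` has a single
value. -/
theorem Runs.det {p : Prog} {x y y' : BTree} {v v' u u' : List Bool} {T T' : ℕ}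
    (h : p.Runs x v y T) (h' : p.Runs x v' y' T') (hv : v ++ u = v' ++ u') : y = y' ∧ v = v' := by
  obtain ⟨s, hs⟩ := h.runT (t := T + T') (by omega) u
  obtain ⟨s', hs'⟩ := h'.runT (t := T + T') (by omega) u'
  rw [hv, hs'] at hs
  simp only [Option.some.injEq, Prod.mk.injEq] at hs
  obtain ⟨rfl, _, rfl⟩ := hs
  exact ⟨rfl, List.append_cancel_right hv⟩

/-- On the input `x`, the program halts within time `t` on every tape of length `t`. -/
def HaltsBy (p : Prog) (x : BTree) (t : ℕ) : Prop :=
  ∀ w : List Bool, w.length = t → ∃ v u y, w = v ++ u ∧ p.Runs x v y t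

theorem HaltsBy.exists_runs {p : Prog} {x : BTree} {t : ℕ} (h : p.HaltsBy x t) {w : List Bool}
    (hw : t ≤ w.length) : ∃ v u y, w = v ++ u ∧ v.length ≤ t ∧ p.Runs x v y t := by
  obtain ⟨v, u, y, hv, hr⟩ := h (w.take t) (by simpa using hw)
  refine ⟨v, u ++ w.drop t, y, ?_, ?_, hr⟩
  · rw [← List.append_assoc, ← hv, List.take_append_drop]
  · have := congrArg List.length hv
    simp at this
    omega

theorem HaltsBy.mono {p : Prog} {x : BTree} {t T : ℕ} (h : p.HaltsBy x t) (hT : t ≤ T) :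
    p.HaltsBy x T := fun w hw =>
  let ⟨v, u, y, hv, _, hr⟩ := h.exists_runs (w := w) (by omega)
  ⟨v, u, y, hv, hr.mono hT⟩

theorem HaltsBy.runT {p : Prog} {x : BTree} {t : ℕ} (h : p.HaltsBy x t) {w : List Bool}
    (hw : t ≤ w.length) : ∃ v u y s, w = v ++ u ∧ p.Runs x v y t ∧ runT p x t w = some (y, s, u) := by
  obtain ⟨v, u, y, rfl, _, hr⟩ := h.exists_runs hw
  obtain ⟨s, hs⟩ := hr.runT le_rfl u
  exact ⟨v, u, y, s, rfl, hr, hs⟩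

theorem haltsBy_iff {p : Prog} {x : BTree} {t : ℕ} : p.HaltsBy x t ↔ eval p x t none = 0 := by
  rw [eval_none_eq_zero_iff p x le_rfl]
  constructor
  · intro h w hw
    obtain ⟨v, u, y, s, _, _, hs⟩ := h.runT hw.ge
    simp [hs]
  · intro h w hw
    obtain ⟨⟨y, s, u⟩, hr⟩ := Option.ne_none_iff_exists'.1 (h w hw)
    obtain ⟨v, hv, _, hr⟩ := runs_of_runT hr
    exact ⟨v, u, y, hv, hr⟩

theorem haltsWithin_iff {p : Prog} {x : BTree} {T : ℝ} :
    p.HaltsWithin x T ↔ ∃ t : ℕ, (t : ℝ) ≤ T ∧ p.HaltsBy x t := by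
  simp only [HaltsWithin, haltsBy_iff]

/-- On the tape `w` the program halts with an output that is not empty. -/
def AcceptsOn (p : Prog) (x : BTree) (w : List Bool) : Prop :=
  ∃ v u y T, w = v ++ u ∧ p.Runs x v y T ∧ y ≠ .nil

theorem AcceptsOn.append {p : Prog} {x : BTree} {w : List Bool} (h : p.AcceptsOn x w)
    (w' : List Bool) : p.AcceptsOn x (w ++ w') := by
  obtain ⟨v, u, y, T, rfl, h⟩ := h
  exact ⟨v, u ++ w', y, T, by simp, h⟩

theorem accepts_runT {p : Prog} {x : BTree} {t : ℕ} {w : List Bool}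
    (h : Accepts (runT p x t w)) : p.AcceptsOn x w := by
  obtain ⟨y, s, u, hr, hy⟩ := h
  obtain ⟨v, hv, _, hr⟩ := runs_of_runT hr
  exact ⟨v, u, y, t, hv, hr, hy⟩

theorem HaltsBy.accepts_iff {p : Prog} {x : BTree} {t : ℕ} (h : p.HaltsBy x t) {w w' : List Bool}
    (hw : t ≤ w.length) : Accepts (Prog.runT p x t w) ↔ p.AcceptsOn x (w ++ w') := by
  refine ⟨fun h => (accepts_runT h).append w', ?_⟩
  rintro ⟨v', u', y', T', hw', hr', hy'⟩
  obtain ⟨v, u, y, s, rfl, hr, hs⟩ := h.runT hw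
  obtain ⟨rfl, _⟩ := hr.det hr' (u := u ++ w') (u' := u') (by simpa using hw')
  exact ⟨y, s, u, hs, hy'⟩

-- By time `t` the program has halted on every tape, so longer time limits accept nothing new and
-- the supremum is attained at `t`.
open Classical in
theorem acceptProb_eq {p : Prog} {x : BTree} {t L : ℕ} (h : p.HaltsBy x t) (hL : t ≤ L) :
    p.acceptProb x = avg L (fun w => if p.AcceptsOn x w then 1 else 0) := by
  apply le_antisymm
  · refine iSup_le fun t' => ?_
    rw [toOuterMeasure_eval p x (L := L + t') (by omega), avg_append]
    refine avg_mono fun v hv => ?_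
    rw [← avg_const t' (if p.AcceptsOn x v then 1 else 0)]
    refine avg_mono fun w _ => ?_
    split_ifs with h1 h2
    · exact le_rfl
    · refine absurd ?_ h2
      have h3 := (h.accepts_iff (w := v) (w' := w) (by omega)).2 (accepts_runT h1)
      exact accepts_runT h3
    · simp
    · simp
  · refine le_iSup_of_le t ?_
    rw [toOuterMeasure_eval p x hL]
    refine avg_mono fun w hw => ?_
    split_ifs with h1 h2 h2
    · exact le_rfl
    · exact absurd ((h.accepts_iff (w' := []) (by omega)).2 (by simpa using h1)) h2
    · simp
    · simp

end Prog

/-! ### Unbounded search -/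

namespace Fn

variable {α β : Type} [TreeEnc α] [TreeEnc β]

-- Unbounded search terminates but has no time bound, hence the parameter `false`. The induction
-- runs over the distance to the first success.
open Prog in
theorem nat_find {q : α × ℕ → Bool} (hq : Fn false q) (h : ∀ a, ∃ n, q (a, n) = true) :
    Fn false (fun a => Nat.find (h a)) := by
  obtain ⟨p, T, hp, -⟩ := not hq
  have key : ∀ a d n, n + d = Nat.find (h a) →
      ∃ t, (loop p (.pair .left (.pair .nil .right))).Runs (enc (a, n)) []
        (enc (a, Nat.find (h a))) t := by
    intro a d
    induction d with
    | zero =>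
      intro n hn
      have h1 := hp (a, n)
      have h2 : q (a, n) = true := by
        have := Nat.find_spec (h a)
        rwa [← hn] at this
      simp only [h2] at h1
      rw [← hn]
      exact ⟨_, Runs.loop_stop h1⟩
    | succ d ih =>
      intro n hn
      obtain ⟨t, ht⟩ := ih (n + 1) (by omega)
      have h1 := hp (a, n)
      have h2 : q (a, n) = false := by
        have := Nat.find_min (h a) (m := n) (by omega)
        simpa using this
      simp only [h2] at h1
      exact ⟨_, Runs.loop_step h1 (by simp)
        (Runs.left.pair (Runs.nil.pair Runs.right)) ht⟩
  choose t ht using fun a => key a _ 0 (Nat.zero_add _)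
  refine ⟨.comp .right (.comp (loop p (.pair .left (.pair .nil .right))) (.pair .id .nil)), _,
    fun a => ((Runs.id.pair Runs.nil).comp (ht a)).comp Runs.right, by simp⟩

end Fn

/-! ### Matrices and graphs -/

/-- Square matrices of bits, as lists of rows. -/
abbrev BitMat : Type := List (List Bool)

/-- The matrix of size `n` with the entries `A u v`. -/
def matOf (n : ℕ) (A : ℕ → ℕ → Bool) : BitMat :=
  (List.range n).map fun u => (List.range n).map fun v => A u v

/-- The entries of a matrix. -/
def entry (X : BitMat) (u v : ℕ) : Bool := (X.getD u []).getD v false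

theorem length_matOf (n : ℕ) (A : ℕ → ℕ → Bool) : (matOf n A).length = n := by simp [matOf]

theorem entry_matOf {n : ℕ} {A : ℕ → ℕ → Bool} {u v : ℕ} (hu : u < n) (hv : v < n) :
    entry (matOf n A) u v = A u v := by
  simp [entry, matOf, List.getD_eq_getElem?_getD, hu, hv]

theorem matOf_congr {n : ℕ} {A B : ℕ → ℕ → Bool} (h : ∀ u < n, ∀ v < n, A u v = B u v) :
    matOf n A = matOf n B := by
  refine List.map_congr_left fun u hu => List.map_congr_left fun v hv => ?_
  exact h u (by simpa using hu) v (by simpa using hv)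

open Classical in
/-- The adjacency function of a graph on `n` labelled vertices. -/
noncomputable def adjFn {n : ℕ} (G : SimpleGraph (Fin n)) (u v : ℕ) : Bool :=
  decide (∃ (hu : u < n) (hv : v < n), G.Adj ⟨u, hu⟩ ⟨v, hv⟩)

@[simp] theorem adjFn_fin {n : ℕ} (G : SimpleGraph (Fin n)) (u v : Fin n) :
    adjFn G u v = true ↔ G.Adj u v := by
  simp [adjFn]

/-- The adjacency matrix of a graph. -/
noncomputable def adjMat {n : ℕ} (G : SimpleGraph (Fin n)) : BitMat := matOf n (adjFn G)

theorem enc_adjMat {n : ℕ} (G : SimpleGraph (Fin n)) : enc (adjMat G) = BTree.ofGraph G := by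
  classical
  have key : ∀ {β : Type} (A : ℕ → β), (List.range n).map A = List.ofFn fun u : Fin n => A u := by
    intro β A
    refine List.ext_getElem (by simp) fun i h1 h2 => by simp
  have e1 : ∀ l : BitMat, enc l = BTree.ofList (l.map enc) := fun _ => rfl
  have e2 : ∀ l : List Bool, enc l = BTree.ofList (l.map BTree.ofBool) := fun _ => rfl
  rw [BTree.ofGraph, adjMat, matOf, e1, key, List.map_ofFn]
  congr 2
  funext u
  rw [Function.comp, e2, key, List.map_ofFn]
  congr 2
  funext v
  simp only [Function.comp]
  congr 1
  rw [Bool.eq_iff_iff]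
  simp

/-- The graph with a given adjacency function. -/
def graphOf (n : ℕ) (A : ℕ → ℕ → Bool) (hs : ∀ u v, A u v = A v u) (hi : ∀ u, A u u = false) :
    SimpleGraph (Fin n) where
  Adj u v := A u v = true
  symm := ⟨fun u v h => by rw [hs]; exact h⟩
  loopless := ⟨fun u h => by simp [hi] at h⟩

theorem matOf_eq_adjMat {n : ℕ} {A : ℕ → ℕ → Bool} {G : SimpleGraph (Fin n)}
    (h : ∀ u v : Fin n, A u v = true ↔ G.Adj u v) : matOf n A = adjMat G :=
  matOf_congr fun u hu v hv => by
    rw [Bool.eq_iff_iff, h ⟨u, hu⟩ ⟨v, hv⟩, ← adjFn_fin]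

theorem length_adjMat {n : ℕ} (G : SimpleGraph (Fin n)) : (adjMat G).length = n := length_matOf _ _

theorem entry_adjMat {n : ℕ} (G : SimpleGraph (Fin n)) (u v : Fin n) :
    entry (adjMat G) u v = true ↔ G.Adj u v := by
  rw [adjMat, entry_matOf u.2 v.2, adjFn_fin]

namespace Fn

variable {α : Type} [TreeEnc α] {κ : Bool}

theorem entry {X : α → BitMat} {u v : α → ℕ} (hX : Fn κ X) (hu : Fn κ u) (hv : Fn κ v) :
    Fn κ (fun a => entry (X a) (u a) (v a)) :=
  getD (getD hX hu (const [])) hv (const false)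

theorem matOf {n : α → ℕ} {A : α × ℕ × ℕ → Bool} (hn : Fn κ n) (hA : Fn κ A) :
    Fn κ (fun a => matOf (n a) fun u v => A (a, u, v)) :=
  map (f := fun b : α × ℕ => (List.range (n b.1)).map fun v => A (b.1, b.2, v)) (range hn)
    (map (f := fun b : (α × ℕ) × ℕ => A (b.1.1, b.1.2, b.2)) (range (hn.comp fst))
      (hA.comp ((fst.comp fst).pair ((snd.comp fst).pair snd))))

end Fn

/-! ### Enumeration of bit strings and of graphs -/

/-- All bit strings of length `L`. -/
def bitStrings (L : ℕ) : List (List Bool) :=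
  (fun s : List (List Bool) => s.map (fun w => true :: w) ++ s.map (fun w => false :: w))^[L] [[]]

theorem bitStrings_succ (L : ℕ) : bitStrings (L + 1) =
    (bitStrings L).map (fun w => true :: w) ++ (bitStrings L).map (fun w => false :: w) :=
  Function.iterate_succ_apply' _ _ _

theorem mem_bitStrings {L : ℕ} {w : List Bool} : w ∈ bitStrings L ↔ w.length = L := by
  induction L generalizing w with
  | zero => simp [bitStrings]
  | succ L ih =>
    rw [bitStrings_succ]
    rcases w with _ | ⟨b, w⟩
    · simp
    · cases b <;> simp [ih]

theorem length_bitStrings (L : ℕ) : (bitStrings L).length = 2 ^ L := by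
  induction L with
  | zero => rfl
  | succ L ih => rw [bitStrings_succ]; simp [ih, pow_succ]; omega

theorem Fn.bitStrings {α : Type} [TreeEnc α] {L : α → ℕ} (hL : Fn false L) :
    Fn false (fun a => bitStrings (L a)) :=
  iterate (step := fun a : α × List (List Bool) =>
      a.2.map (fun w => true :: w) ++ a.2.map (fun w => false :: w)) hL (const _)
    (append (map (f := fun b => true :: b.2) snd (cons (const _) snd))
      (map (f := fun b => false :: b.2) snd (cons (const _) snd))) (by simp)

theorem count_bitStrings (L : ℕ) (f : List Bool → Bool) :
    (((bitStrings L).map f).count true : ℝ≥0∞) =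
      2 ^ L * Prog.avg L (fun w => if f w then 1 else 0) := by
  induction L generalizing f with
  | zero => cases h : f [] <;> simp [bitStrings, Prog.avg, h]
  | succ L ih =>
    rw [bitStrings_succ, List.map_append, List.count_append, List.map_map, List.map_map]
    push_cast
    rw [ih, ih]
    simp only [Prog.avg, Function.comp]
    rw [← mul_add, pow_succ, mul_assoc, ENNReal.mul_div_cancel (by simp) (by simp)]

/-- The graph with `m` vertices described by a bit string. -/
def graphMat (m : ℕ) (w : List Bool) : BitMat :=
  matOf m fun u v => if decide (u < v) then w.getD (u * m + v) false
    else if decide (v < u) then w.getD (v * m + u) false else false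

/-- All graphs with `m` labelled vertices. -/
def graphMats (m : ℕ) : List BitMat := (bitStrings (m * m)).map fun w => graphMat m w

theorem exists_of_mem_graphMats {m : ℕ} {X : BitMat} (h : X ∈ graphMats m) :
    ∃ G : SimpleGraph (Fin m), X = adjMat G := by
  simp only [graphMats, List.mem_map] at h
  obtain ⟨w, _, rfl⟩ := h
  refine ⟨graphOf m (fun u v => if decide (u < v) then w.getD (u * m + v) false
    else if decide (v < u) then w.getD (v * m + u) false else false) (fun u v => ?_) (by simp),
    matOf_eq_adjMat fun u v => Iff.rfl⟩
  rcases lt_trichotomy u v with h | h | h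
  · simp [h, h.not_gt]
  · simp [h]
  · simp [h, h.not_gt]

theorem adjMat_mem_graphMats {m : ℕ} (G : SimpleGraph (Fin m)) : adjMat G ∈ graphMats m := by
  simp only [graphMats, List.mem_map]
  refine ⟨(List.range (m * m)).map fun i => adjFn G (i / m) (i % m),
    mem_bitStrings.2 (by simp), ?_⟩
  refine matOf_eq_adjMat fun u v => ?_
  have key : ∀ u v : Fin m, (((List.range (m * m)).map fun i => adjFn G (i / m) (i % m)).getD
      (u * m + v) false) = adjFn G u v := by
    intro u v
    have h1 : (u : ℕ) * m + v < m * m := by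
      have : ((u : ℕ) + 1) * m ≤ m * m := Nat.mul_le_mul_right _ u.2
      rw [Nat.add_mul] at this
      have := v.2
      omega
    have h2 : ((u : ℕ) * m + v) / m = u := by
      rw [Nat.mul_comm, Nat.mul_add_div u.pos, Nat.div_eq_of_lt v.2, Nat.add_zero]
    have h3 : ((u : ℕ) * m + v) % m = v := by
      rw [Nat.mul_comm, Nat.mul_add_mod, Nat.mod_eq_of_lt v.2]
    simp [List.getD_eq_getElem?_getD, h1, h2, h3]
  rw [key, key]
  rcases lt_trichotomy u v with h | h | h
  · simp [h]
  · simp [h]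
  · have h' : ¬ (u : ℕ) < v := by simpa using h.le
    simp [h, h', G.adj_comm]

theorem Fn.graphMats {α : Type} [TreeEnc α] {m : α → ℕ} (hm : Fn false m) :
    Fn false (fun a => graphMats (m a)) := by
  refine map (f := fun b : α × List Bool => graphMat (m b.1) b.2) (bitStrings (mul hm hm)) ?_
  refine matOf (A := fun b : (α × List Bool) × ℕ × ℕ => if decide (b.2.1 < b.2.2) then
      b.1.2.getD (b.2.1 * m b.1.1 + b.2.2) false
    else if decide (b.2.2 < b.2.1) then b.1.2.getD (b.2.2 * m b.1.1 + b.2.1) false else false)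
    (hm.comp fst) ?_
  have hu : Fn false fun b : (α × List Bool) × ℕ × ℕ => b.2.1 := fst.comp snd
  have hv : Fn false fun b : (α × List Bool) × ℕ × ℕ => b.2.2 := snd.comp snd
  have hw : Fn false fun b : (α × List Bool) × ℕ × ℕ => b.1.2 := snd.comp fst
  have hM : Fn false fun b : (α × List Bool) × ℕ × ℕ => m b.1.1 := hm.comp (fst.comp fst)
  exact ite (lt hu hv) (getD hw (add (mul hu hM) hv) (const false))
    (ite (lt hv hu) (getD hw (add (mul hv hM) hu) (const false)) (const false))

/-! ### Exact decision by enumeration of all coins -/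

/-- The outputs of a run, interpreted as a bit. -/
def outBit (r : Prog.TapeResult) : Bool :=
  match r with
  | none => false
  | some r => !r.1.isNil

theorem outBit_iff {r : Prog.TapeResult} : outBit r = true ↔ Prog.Accepts r := by
  rcases r with _ | ⟨y, s, w⟩
  · simp [outBit, Prog.Accepts]
  · simp [outBit, Prog.Accepts, BTree.isNil_eq_false_iff]

theorem Fn.outBit {α : Type} [TreeEnc α] {κ : Bool} {f : α → Prog.TapeResult} (hf : Fn κ f) :
    Fn κ (fun a => outBit (f a)) :=
  (option_cases hf (const false) (not (isNil (fst.comp snd)))).of_eq fun a => by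
    cases h : f a <;> rfl

namespace Prog

/-- Majority vote over all tapes of length `T`. -/
def vote (A : Prog) (x : BTree) (T : ℕ) : Bool :=
  majority ((bitStrings T).map fun w => outBit (runT A x T w))

/-- All tapes of length `T` are equally likely, so the proportion of accepting ones is the
acceptance probability, which is bounded away from one half on either side. -/
theorem HaltsBy.vote_spec {A : Prog} {x : BTree} {T : ℕ} (h : A.HaltsBy x T) :
    (2 / 3 ≤ A.acceptProb x → vote A x T = true) ∧
      (A.acceptProb x ≤ 1 / 3 → vote A x T = false) := by
  classical
  have h1 : A.acceptProb x = avg T (fun w => if outBit (Prog.runT A x T w) then 1 else 0) := by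
    rw [acceptProb_eq h le_rfl]
    refine avg_congr fun w hw => ?_
    have := h.accepts_iff (w := w) (w' := []) hw.ge
    rw [List.append_nil] at this
    simp only [← this, outBit_iff]
  have h2 := count_bitStrings T fun w => outBit (Prog.runT A x T w)
  rw [← h1] at h2
  set c := ((bitStrings T).map fun w => outBit (Prog.runT A x T w)).count true with hc
  have h3 : vote A x T = decide (2 ^ T < 2 * c) := by
    simp [vote, majority, length_bitStrings, hc]
  have hr : (c : ℝ) = 2 ^ T * (A.acceptProb x).toReal := by
    have := congrArg ENNReal.toReal h2
    simpa using this
  have hfin : A.acceptProb x ≠ ⊤ := by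
    intro htop
    rw [htop, ENNReal.mul_top (by simp)] at h2
    exact ENNReal.natCast_ne_top _ h2
  have hpos : (0 : ℝ) < 2 ^ T := by positivity
  rw [h3]
  constructor
  · intro h4
    have h5 := ENNReal.toReal_mono hfin h4
    rw [ENNReal.toReal_div] at h5
    norm_num at h5
    rw [decide_eq_true_iff]
    have : (2 : ℝ) ^ T < 2 * c := by rw [hr]; nlinarith
    exact_mod_cast this
  · intro h4
    have h5 := ENNReal.toReal_mono (by simp) h4
    rw [ENNReal.toReal_div] at h5
    norm_num at h5
    rw [decide_eq_false_iff_not, not_lt]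
    have : 2 * (c : ℝ) ≤ 2 ^ T := by rw [hr]; nlinarith
    exact_mod_cast this

theorem fn_vote {α : Type} [TreeEnc α] (A : Prog) {x : α → BTree} {T : α → ℕ} (hx : Fn false x)
    (hT : Fn false T) : Fn false (fun a => vote A (x a) (T a)) :=
  Fn.majority (Fn.map (f := fun b : α × List Bool => outBit (runT A (x b.1) (T b.1) b.2))
    (Fn.bitStrings hT) (Fn.outBit ((fn_runT A).weaken.comp
      (f := fun b : α × List Bool => (x b.1, T b.1, b.2))
      ((hx.comp Fn.fst).pair ((hT.comp Fn.fst).pair Fn.snd)))))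

theorem isSome_runT_iff_haltsBy {A : Prog} {x : BTree} {T : ℕ} :
    ((bitStrings T).all fun w => (runT A x T w).isSome) = true ↔ A.HaltsBy x T := by
  rw [haltsBy_iff, eval_none_eq_zero_iff A x le_rfl, List.all_eq_true]
  simp only [mem_bitStrings, Option.isSome_iff_ne_none]

theorem fn_all_isSome {α : Type} [TreeEnc α] (A : Prog) {x : α → BTree} {T : α → ℕ}
    (hx : Fn false x) (hT : Fn false T) :
    Fn false (fun a => (bitStrings (T a)).all fun w => (runT A (x a) (T a) w).isSome) :=
  Fn.all (f := fun b : α × List Bool => (runT A (x b.1) (T b.1) b.2).isSome)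
    (Fn.bitStrings hT) (Fn.isSome ((fn_runT A).weaken.comp
      (f := fun b : α × List Bool => (x b.1, T b.1, b.2))
      ((hx.comp Fn.fst).pair ((hT.comp Fn.fst).pair Fn.snd))))

/-- What a possibly randomized program always outputs can be computed deterministically. -/
theorem fn_of_outputs {E : Prog} {code : ℕ → BTree}
    (hE : ∀ i, E.Outputs (BTree.ofNat i) (code i)) : Fn false code := by
  have key : ∀ i, ∃ t, E.HaltsBy (BTree.ofNat i) t ∧
      ∀ v y T, E.Runs (BTree.ofNat i) v y T → v.length ≤ t → y = code i := by
    intro i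
    obtain ⟨t, ht⟩ := hE i
    have hh : E.HaltsBy (BTree.ofNat i) t := by
      rw [haltsBy_iff]
      by_contra h
      obtain ⟨s, hs⟩ := ht none ((PMF.mem_support_iff _ _).2 h)
      simp at hs
    refine ⟨t, hh, fun v y T hr hv => ?_⟩
    have hw : (v ++ List.replicate (t - v.length) false).length = t := by simp; omega
    obtain ⟨v', u', y', s', hv', hr', hrun⟩ := hh.runT hw.ge
    obtain ⟨rfl, rfl⟩ := hr.det hr' hv'
    by_contra hy
    have h0 : eval E (BTree.ofNat i) t (some (y, s')) = 0 := by
      by_contra h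
      obtain ⟨s, hs⟩ := ht _ ((PMF.mem_support_iff _ _).2 h)
      simp at hs
      exact hy hs.1
    classical
    -- The test function forgets the unread tape, so a result of probability zero occurs on no tape
    -- at all.
    have h1 := simulates_runT E (BTree.ofNat i) t t le_rfl
      (fun r => if r.map (fun r => (r.1, r.2.1)) = some (y, s') then 1 else 0)
      (fun r => if r = some (y, s') then 1 else 0) (by simp) (by simp)
    simp only [mul_ite, mul_one, mul_zero, tsum_ite_eq, h0, avg_eq_zero_iff] at h1
    have h2 := h1 _ hw
    rw [hrun] at h2
    simp at h2
  choose t ht htc using key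
  -- All coins may be taken to be `false`, as every possible outcome is `code i`. The least time at
  -- which such a tape yields a result is at most `t i`, so that `htc` applies to this result.
  have hex : ∀ i, ∃ T, (fun a : ℕ × ℕ => (runT E (enc a.1) a.2
      ((List.range a.2).map fun _ => false)).isSome) (i, T) = true := fun i => by
    obtain ⟨v, u, y, s, _, _, hs⟩ := (ht i).runT
      (w := (List.range (t i)).map fun _ => false) (by simp)
    exact ⟨t i, by simp only [TreeEnc.enc]; rw [hs]; rfl⟩
  have hrun : Fn false fun a : ℕ × ℕ => runT E (enc a.1) a.2
      ((List.range a.2).map fun _ => false) :=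
    (fn_runT E).weaken.comp (f := fun a : ℕ × ℕ => (enc a.1, a.2,
      (List.range a.2).map fun _ => false)) ((Fn.opaque_of Fn.fst).pair
        (Fn.snd.pair (Fn.map (f := fun _ => false) (Fn.range Fn.snd) (Fn.const _))))
  have hfind := Fn.nat_find (Fn.isSome hrun) hex
  have hres := hrun.comp (Fn.id.pair hfind)
  refine (Fn.option_cases hres (Fn.const BTree.nil) (Fn.fst.comp Fn.snd)).of_eq fun i => ?_
  have hspec := Nat.find_spec (hex i)
  have hmin : Nat.find (hex i) ≤ t i := Nat.find_min' (hex i) (by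
    obtain ⟨v, u, y, s, _, _, hs⟩ := (ht i).runT
      (w := (List.range (t i)).map fun _ => false) (by simp)
    simp only [TreeEnc.enc]; rw [hs]; rfl)
  dsimp only at hspec ⊢
  obtain ⟨⟨y, s, u⟩, hs⟩ := Option.isSome_iff_exists.1 hspec
  rw [hs]
  obtain ⟨v, hv, hvl, hr⟩ := runs_of_runT hs
  exact htc i v y _ hr (hvl.trans hmin)

end Prog

/-! ### Finding the patterns -/

/-- An injection between finite sets of equal size is onto, so an induced embedding is then an
isomorphism. -/
theorem exists_iso_of_isIndContained {k m : ℕ} (h : k = m) {H : SimpleGraph (Fin k)}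
    {G : SimpleGraph (Fin m)} (hG : H.IsIndContained G) :
    ∃ H' : SimpleGraph (Fin k), adjMat G = adjMat H' ∧ Nonempty (H ≃g H') := by
  subst h
  obtain ⟨e⟩ := hG
  exact ⟨G, rfl, ⟨RelIso.ofSurjective e (Finite.surjective_of_injective e.injective)⟩⟩

/-- If an algorithm solves induced detection for a sequence of patterns, then the patterns can be
computed up to isomorphism. -/
theorem exists_fn_pattern {A : Prog} {k : ℕ → ℕ} {H : ∀ i, SimpleGraph (Fin (k i))}
    {code : ℕ → BTree} {T : ℕ → ℕ → ℝ} (hcode : Fn false code)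
    (hA : SolvesInducedDetection A H code T) :
    ∃ pat : ℕ → BitMat, Fn false pat ∧ ∀ i, (k i = 0 → (pat i).length = 1) ∧
      (k i ≠ 0 → ∃ H' : SimpleGraph (Fin (k i)), pat i = adjMat H' ∧ Nonempty (H i ≃g H')) := by
  have hx : Fn false fun a : ((ℕ × ℕ) × ℕ) × BitMat => BTree.cons (code a.1.1.1) (enc a.2) :=
    Fn.btree_cons (hcode.comp (Fn.fst.comp (Fn.fst.comp Fn.fst))) (Fn.opaque_of Fn.snd)
  have hq : Fn false fun a : (ℕ × ℕ) × ℕ => (graphMats (a.1.2 + 1)).all fun X =>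
      (bitStrings a.2).all fun w => (Prog.runT A (.cons (code a.1.1) (enc X)) a.2 w).isSome :=
    Fn.all (f := fun b : ((ℕ × ℕ) × ℕ) × BitMat => (bitStrings b.1.2).all fun w =>
      (Prog.runT A (.cons (code b.1.1.1) (enc b.2)) b.1.2 w).isSome)
      (Fn.graphMats (Fn.succ (Fn.snd.comp Fn.fst)))
      (Prog.fn_all_isSome A hx (Fn.snd.comp Fn.fst))
  -- `T` need not be computable, so a common halting time for all hosts on `a.2 + 1` vertices is
  -- found by search. The shift by one avoids the empty host, on which nothing is promised.
  have hex : ∀ a : ℕ × ℕ, ∃ t, ((graphMats (a.2 + 1)).all fun X =>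
      (bitStrings t).all fun w => (Prog.runT A (.cons (code a.1) (enc X)) t w).isSome) = true := by
    intro a
    have h1 : ∀ G : SimpleGraph (Fin (a.2 + 1)), ∃ t,
        A.HaltsBy (.cons (code a.1) (BTree.ofGraph G)) t := fun G =>
      let ⟨t, _, ht⟩ := Prog.haltsWithin_iff.1 (hA a.1 (a.2 + 1) (by omega) G).1
      ⟨t, ht⟩
    choose t ht using h1
    refine ⟨∑ G, t G, ?_⟩
    rw [List.all_eq_true]
    intro X hX
    obtain ⟨G, rfl⟩ := exists_of_mem_graphMats hX
    rw [Prog.isSome_runT_iff_haltsBy, enc_adjMat]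
    exact (ht G).mono (Finset.single_le_sum (f := t) (fun _ _ => Nat.zero_le _) (Finset.mem_univ G))
  have hfind := Fn.nat_find hq hex
  set τ : ℕ × ℕ → ℕ := fun a => Nat.find (hex a) with hτ
  have hhalt : ∀ i m (G : SimpleGraph (Fin (m + 1))),
      A.HaltsBy (.cons (code i) (BTree.ofGraph G)) (τ (i, m)) := by
    intro i m G
    have := Nat.find_spec (hex (i, m))
    rw [List.all_eq_true] at this
    have := this _ (adjMat_mem_graphMats G)
    rwa [Prog.isSome_runT_iff_haltsBy, enc_adjMat] at this
  have hvote : ∀ i m (G : SimpleGraph (Fin (m + 1))),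
      Prog.vote A (.cons (code i) (enc (adjMat G))) (τ (i, m)) = true ↔ (H i).IsIndContained G := by
    intro i m G
    rw [enc_adjMat]
    obtain ⟨h1, h2⟩ := (hhalt i m G).vote_spec
    obtain ⟨-, h3, h4⟩ := hA i (m + 1) (by omega) G
    constructor
    · intro h5
      by_contra h6
      simp [h2 (h4 h6)] at h5
    · exact fun h5 => h1 (h3 h5)
  have hfd : Fn false fun a : ℕ × ℕ => (graphMats (a.2 + 1)).find? fun X =>
      Prog.vote A (.cons (code a.1) (enc X)) (τ a) :=
    Fn.find? (f := fun b : (ℕ × ℕ) × BitMat =>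
      Prog.vote A (.cons (code b.1.1) (enc b.2)) (τ b.1)) (Fn.graphMats (Fn.succ Fn.snd))
      (Prog.fn_vote A (Fn.btree_cons (hcode.comp (Fn.fst.comp Fn.fst)) (Fn.opaque_of Fn.snd))
        (hfind.comp Fn.fst))
  have hfd_some : ∀ i m X, ((graphMats (m + 1)).find? fun X =>
      Prog.vote A (.cons (code i) (enc X)) (τ (i, m))) = some X →
      ∃ G : SimpleGraph (Fin (m + 1)), X = adjMat G ∧ (H i).IsIndContained G := by
    intro i m X h
    obtain ⟨G, rfl⟩ := exists_of_mem_graphMats (List.mem_of_find?_eq_some h)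
    have := List.find?_some h
    exact ⟨G, rfl, (hvote i m G).1 this⟩
  have hfd_isSome : ∀ i m (G : SimpleGraph (Fin (m + 1))), (H i).IsIndContained G →
      ((graphMats (m + 1)).find? fun X =>
        Prog.vote A (.cons (code i) (enc X)) (τ (i, m))).isSome = true := by
    intro i m G h
    rw [List.find?_isSome]
    exact ⟨adjMat G, adjMat_mem_graphMats G, (hvote i m G).2 h⟩
  have hcast : ∀ i m (h : k i = m + 1), ∃ G : SimpleGraph (Fin (m + 1)),
      (H i).IsIndContained G := by
    intro i m h
    rw [← h]
    exact ⟨H i, ⟨.refl⟩⟩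
  -- The pattern is recovered as a host of least positive order that contains it. Minimality makes
  -- the orders equal, except for the empty pattern, where a single vertex results.
  have hex2 : ∀ i, ∃ m, (fun a : ℕ × ℕ => ((graphMats (a.2 + 1)).find? fun X =>
      Prog.vote A (.cons (code a.1) (enc X)) (τ a)).isSome) (i, m) = true := by
    intro i
    rcases Nat.eq_zero_or_pos (k i) with h | h
    · refine ⟨0, hfd_isSome i 0 ⊥ ?_⟩
      have : IsEmpty (Fin (k i)) := by rw [h]; infer_instance
      exact ⟨⟨⟨isEmptyElim, fun x => isEmptyElim x⟩, fun {x} => isEmptyElim x⟩⟩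
    · obtain ⟨G, hG⟩ := hcast i (k i - 1) (by omega)
      exact ⟨k i - 1, hfd_isSome i _ G hG⟩
  have hfind2 := Fn.nat_find (Fn.isSome hfd) hex2
  refine ⟨_, Fn.option_cases (hfd.comp (Fn.id.pair hfind2)) (Fn.const ([] : BitMat)) Fn.snd,
    fun i => ?_⟩
  have hspec := Nat.find_spec (hex2 i)
  have hmin := fun m => Nat.find_min' (hex2 i) (m := m)
  generalize Nat.find (hex2 i) = m at hspec hmin
  dsimp only at hspec hmin
  obtain ⟨X, hX⟩ := Option.isSome_iff_exists.1 hspec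
  dsimp only
  rw [hX]
  obtain ⟨G, rfl, hG⟩ := hfd_some i m X hX
  have hle : k i ≤ m + 1 := by
    obtain ⟨e⟩ := hG
    simpa using Fintype.card_le_of_injective e e.injective
  constructor
  · intro h
    have : m ≤ 0 := hmin 0 (hfd_isSome i 0 ⊥ (by
      have : IsEmpty (Fin (k i)) := by rw [h]; infer_instance
      exact ⟨⟨⟨isEmptyElim, fun x => isEmptyElim x⟩, fun {x} => isEmptyElim x⟩⟩))
    rw [length_adjMat]
    omega
  · intro h
    have : m ≤ k i - 1 := hmin _ (by
      obtain ⟨G, hG⟩ := hcast i (k i - 1) (by omega)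
      exact hfd_isSome i _ G hG)
    exact exists_iso_of_isIndContained (by omega) hG

/-! ### Random vertices from coins -/

/-- Distribute the entries of a list alternately to two lists. -/
def deal {β : Type} (l : List β) : List β × List β :=
  l.foldl (fun s x => (x :: s.2, s.1)) ([], [])

theorem deal_append_singleton {β : Type} (l : List β) (x : β) :
    deal (l ++ [x]) = (x :: (deal l).2, (deal l).1) := by
  simp [deal]

/-- One of the two halves of a list, as long as it has at least two entries. -/
def halve {β : Type} (l : List β) (b : Bool) : List β :=
  if l.tail.isEmpty then l else if b then (deal l).1 else (deal l).2

/-- A random element of `{0, …, n - 1}`, chosen with the coins `w`. -/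
def pick (n : ℕ) (w : List Bool) : ℕ := (w.foldl halve (List.range n)).headD 0

theorem sz_deal {β : Type} [TreeEnc β] (l : List β) :
    sz (deal l).1 + sz (deal l).2 = sz l := by
  induction l using List.reverseRecOn with
  | nil => rfl
  | append_singleton l x ih => rw [deal_append_singleton]; simp; omega

theorem sz_halve_le {β : Type} [TreeEnc β] (l : List β) (b : Bool) : sz (halve l b) ≤ sz l := by
  have := sz_deal l
  unfold halve
  split_ifs <;> omega

namespace Fn

variable {α β : Type} [TreeEnc α] [TreeEnc β] {κ : Bool}

theorem deal {l : α → List β} (hl : Fn κ l) : Fn κ (fun a => deal (l a)) := by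
  refine comp (g := fun l : List β => _root_.deal l) (weaken ?_) hl
  refine foldl (l := fun l : List β => l) (s := fun _ => (([], []) : List β × List β))
    (step := fun a => (a.2.2 :: a.2.1.2, a.2.1.1)) Fn.id (const _)
    (pair (cons (snd.comp snd) (snd.comp (fst.comp snd))) (fst.comp (fst.comp snd))) fun _ =>
      ⟨_, PolyBdd.size, fun l l' hl' => ?_⟩
  have h1 := sz_deal l'
  have h2 := sz_le_of_prefix hl'
  exact h1.le.trans h2

theorem halve {l : α → List β} {b : α → Bool} (hl : Fn κ l) (hb : Fn κ b) :
    Fn κ (fun a => halve (l a) (b a)) :=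
  ite (isEmpty (tail hl)) hl (ite hb (fst.comp (deal hl)) (snd.comp (deal hl)))

theorem pick {n : α → ℕ} {w : α → List Bool} (hn : Fn κ n) (hw : Fn κ w) :
    Fn κ (fun a => pick (n a) (w a)) := by
  refine comp (g := fun a : ℕ × List Bool => _root_.pick a.1 a.2) (weaken ?_) (hn.pair hw)
  refine headD (foldl (l := fun a : ℕ × List Bool => a.2) (s := fun a => List.range a.1)
    (step := fun a => _root_.halve a.2.1 a.2.2) snd (range fst)
    (halve (fst.comp snd) (snd.comp snd))
    fun _ => ⟨fun a => sz (List.range a.1), (range fst).sz_bdd, fun a l' _ => ?_⟩) (const 0)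
  have key : ∀ (w : List Bool) (s : List ℕ), sz (w.foldl _root_.halve s) ≤ sz s := by
    intro w
    induction w with
    | nil => exact fun s => le_rfl
    | cons b w ih => exact fun s => (ih _).trans (sz_halve_le _ _)
  exact key l' _

end Fn

/-! ### The instance -/

/-- The matrix of the complementary graph. -/
def complMat (X : BitMat) : BitMat :=
  matOf X.length fun u v => !entry X u v && !decide (u = v)

theorem complMat_adjMat {n : ℕ} (G : SimpleGraph (Fin n)) : complMat (adjMat G) = adjMat Gᶜ := by
  rw [complMat, length_adjMat]
  refine matOf_eq_adjMat fun u v => ?_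
  have := entry_adjMat G u v
  rw [SimpleGraph.compl_adj, ← this]
  cases entry (adjMat G) u v <;> simp [Fin.ext_iff]

/-- The sequence of random vertices determined by a tape. -/
def picks (n Q : ℕ) (w : List Bool) : List ℕ :=
  (List.range Q).map fun q => pick n ((w.drop (q * n)).take n)

/-- The adjacency matrix on `N` tuples of length `l` of vertices of `X`, coloured by the vertices of
`P`: tuples are adjacent if their colours are, and if all their vertices are adjacent or equal. -/
def tupleMat (P X : BitMat) (N l : ℕ) (vs : List ℕ) : BitMat :=
  matOf N fun i j => entry P (i % P.length) (j % P.length) &&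
    (List.range l).all fun a => (List.range l).all fun b =>
      decide (vs.getD (i * l + a) 0 = vs.getD (j * l + b) 0) ||
        entry X (vs.getD (i * l + a) 0) (vs.getD (j * l + b) 0)

/-- The denser one of a graph and its complement is used for the construction. -/
def instMat (P X : BitMat) (N l : ℕ) (vs : List ℕ) : BitMat :=
  if majority P.flatten then tupleMat P X N l vs
  else complMat (tupleMat (complMat P) X N l vs)

namespace Fn

variable {α : Type} [TreeEnc α] {κ : Bool}

theorem complMat {X : α → BitMat} (hX : Fn κ X) : Fn κ (fun a => complMat (X a)) :=
  matOf (A := fun b : α × ℕ × ℕ => !_root_.entry (X b.1) b.2.1 b.2.2 && !decide (b.2.1 = b.2.2))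
    (length hX) (and (not (entry (hX.comp fst) (fst.comp snd) (snd.comp snd)))
      (not (eq (fst.comp snd) (snd.comp snd))))

theorem picks {n Q : α → ℕ} {w : α → List Bool} (hn : Fn κ n) (hQ : Fn κ Q) (hw : Fn κ w) :
    Fn κ (fun a => picks (n a) (Q a) (w a)) :=
  map (f := fun b : α × ℕ => _root_.pick (n b.1) (((w b.1).drop (b.2 * n b.1)).take (n b.1)))
    (range hQ) (pick (hn.comp fst)
      (take (drop (hw.comp fst) (mul snd (hn.comp fst))) (hn.comp fst)))

theorem tupleMat {P X : α → BitMat} {N l : α → ℕ} {vs : α → List ℕ} (hP : Fn κ P) (hX : Fn κ X)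
    (hN : Fn κ N) (hl : Fn κ l) (hvs : Fn κ vs) :
    Fn κ (fun a => tupleMat (P a) (X a) (N a) (l a) (vs a)) := by
  have hP' : Fn κ fun b : α × ℕ × ℕ => P b.1 := hP.comp fst
  have hl' : Fn κ fun b : α × ℕ × ℕ => l b.1 := hl.comp fst
  have h2 : Fn κ fun c : ((α × ℕ × ℕ) × ℕ) × ℕ => (vs c.1.1.1).getD (c.1.1.2.1 * l c.1.1.1 + c.1.2) 0 :=
    getD (hvs.comp (fst.comp (fst.comp fst))) (add (mul (fst.comp (snd.comp (fst.comp fst)))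
      (hl.comp (fst.comp (fst.comp fst)))) (snd.comp fst)) (const 0)
  have h3 : Fn κ fun c : ((α × ℕ × ℕ) × ℕ) × ℕ => (vs c.1.1.1).getD (c.1.1.2.2 * l c.1.1.1 + c.2) 0 :=
    getD (hvs.comp (fst.comp (fst.comp fst))) (add (mul (snd.comp (snd.comp (fst.comp fst)))
      (hl.comp (fst.comp (fst.comp fst)))) snd) (const 0)
  have h4 := all (l := fun c : (α × ℕ × ℕ) × ℕ => List.range (l c.1.1)) (range (hl.comp (fst.comp fst)))
    (or (eq h2 h3) (entry (hX.comp (fst.comp (fst.comp fst))) h2 h3))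
  have h5 := all (range hl') h4
  exact matOf hN (and (entry hP' (mod (fst.comp snd) (length hP')) (mod (snd.comp snd) (length hP')))
    h5)

theorem instMat {P X : α → BitMat} {N l : α → ℕ} {vs : α → List ℕ} (hP : Fn κ P) (hX : Fn κ X)
    (hN : Fn κ N) (hl : Fn κ l) (hvs : Fn κ vs) :
    Fn κ (fun a => instMat (P a) (X a) (N a) (l a) (vs a)) :=
  ite (majority (flatten hP)) (tupleMat hP hX hN hl hvs)
    (complMat (tupleMat (complMat hP) hX hN hl hvs))

end Fn

/-- Graphs on `N` tuples of vertices, coloured by the vertices of a pattern `P`. -/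
def tupleGraph {k n : ℕ} [NeZero k] (P : SimpleGraph (Fin k)) (G : SimpleGraph (Fin n))
    (N l : ℕ) (S : ℕ → Fin n) : SimpleGraph (Fin N) where
  Adj i j := P.Adj (Fin.ofNat k i) (Fin.ofNat k j) ∧ ∀ a < l, ∀ b < l,
    S (i * l + a) = S (j * l + b) ∨ G.Adj (S (i * l + a)) (S (j * l + b))
  symm := ⟨fun i j h => ⟨h.1.symm, fun a ha b hb => by
    rcases h.2 b hb a ha with h | h
    · exact Or.inl h.symm
    · exact Or.inr h.symm⟩⟩
  loopless := ⟨fun i h => P.irrefl h.1⟩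

theorem tupleMat_eq {k n : ℕ} [NeZero k] (P : SimpleGraph (Fin k)) (G : SimpleGraph (Fin n))
    {N l : ℕ} {vs : List ℕ} {S : ℕ → Fin n} (hS : ∀ q < N * l, vs.getD q 0 = S q) :
    tupleMat (adjMat P) (adjMat G) N l vs = adjMat (tupleGraph P G N l S) := by
  refine matOf_eq_adjMat fun i j => ?_
  have hlt : ∀ (i : Fin N) (a : ℕ), a < l → (i : ℕ) * l + a < N * l := fun i a ha => by
    have : ((i : ℕ) + 1) * l ≤ N * l := Nat.mul_le_mul_right _ i.2
    rw [Nat.add_mul] at this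
    omega
  have h1 := entry_adjMat P (Fin.ofNat k i) (Fin.ofNat k j)
  simp only [Fin.val_ofNat] at h1
  simp only [length_adjMat, Bool.and_eq_true, h1, List.all_eq_true, List.mem_range,
    Bool.or_eq_true, decide_eq_true_eq, tupleGraph]
  refine and_congr_right fun _ => forall_congr' fun a => imp_congr_right fun ha =>
    forall_congr' fun b => imp_congr_right fun hb => ?_
  rw [hS _ (hlt i a ha), hS _ (hlt j b hb), entry_adjMat, Fin.val_inj]

/-- The number of ordered pairs of adjacent vertices of a graph. -/
noncomputable def numAdj {k : ℕ} (P : SimpleGraph (Fin k)) : ℕ :=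
  open Classical in (Finset.univ.filter fun e : Fin k × Fin k => P.Adj e.1 e.2).card

/-- The graph on tuples, or its complement if the pattern has few edges. -/
noncomputable def instGraph {k n : ℕ} [NeZero k] (P : SimpleGraph (Fin k))
    (G : SimpleGraph (Fin n)) (N l : ℕ) (S : ℕ → Fin n) : SimpleGraph (Fin N) :=
  open Classical in
  if k * k < 2 * numAdj P then tupleGraph P G N l S else (tupleGraph Pᶜ G N l S)ᶜ

theorem count_flatten_adjMat {k : ℕ} (P : SimpleGraph (Fin k)) :
    (adjMat P).flatten.count true = numAdj P := by
  classical
  have key : ∀ (n : ℕ) (f : ℕ → Bool), ((List.range n).map f).count true =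
      ∑ i : Fin n, if f i then 1 else 0 := by
    intro n f
    induction n with
    | zero => simp
    | succ n ih =>
      rw [List.range_succ, Fin.sum_univ_castSucc]
      cases h : f n <;> simp [ih, h]
  have key2 : ∀ (n : ℕ) (f : ℕ → ℕ), ((List.range n).map f).sum = ∑ i : Fin n, f i := by
    intro n f
    induction n with
    | zero => simp
    | succ n ih => rw [List.range_succ, Fin.sum_univ_castSucc]; simp [ih]
  rw [List.count_flatten, adjMat, matOf, List.map_map]
  have h2 := key2 k (List.count true ∘ fun u => (List.range k).map fun v => adjFn P u v)
  rw [h2, numAdj, Finset.card_filter, Fintype.sum_prod_type]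
  refine Finset.sum_congr rfl fun u _ => ?_
  simp only [Function.comp, key]
  simp

theorem length_flatten_adjMat {k : ℕ} (P : SimpleGraph (Fin k)) :
    (adjMat P).flatten.length = k * k := by
  rw [List.length_flatten, adjMat, matOf, List.map_map]
  simp [Function.comp_def]

theorem instMat_eq {k n : ℕ} [NeZero k] (P : SimpleGraph (Fin k)) (G : SimpleGraph (Fin n))
    {N l : ℕ} {vs : List ℕ} {S : ℕ → Fin n} (hS : ∀ q < N * l, vs.getD q 0 = S q) :
    instMat (adjMat P) (adjMat G) N l vs = adjMat (instGraph P G N l S) := by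
  rw [instMat, instGraph, majority, count_flatten_adjMat, length_flatten_adjMat]
  simp only [decide_eq_true_eq]
  split_ifs
  · exact tupleMat_eq P G hS
  · rw [complMat_adjMat, tupleMat_eq Pᶜ G hS, complMat_adjMat]

/-! ### Powers, random bits and repeated runs -/

namespace Prog

/-- Powers are not of polynomial size in `n` and `e`, so they lie outside `Fn true`; the time is
polynomial only when the value `n ^ e` is counted as part of the input. The condition `1 ≤ n` keeps
intermediate powers below the last one. -/
theorem exists_powProg : ∃ (p : Prog) (T : ℕ × ℕ → ℕ), PolyBdd T ∧ ∀ n e : ℕ, 1 ≤ n →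
    p.Runs (enc (n, e)) [] (enc (n ^ e)) (T (n ^ e, n) * (e + 1)) := by
  obtain ⟨p, T, hp, hT⟩ := Fn.mul (α := ℕ × ℕ × Unit) (κ := true) (m := fun a => a.2.1)
    (n := fun a => a.1) (Fn.fst.comp Fn.snd) Fn.fst
  obtain ⟨c, hc⟩ := (hT rfl).1
  refine ⟨.comp (.comp .right .right) (.comp (foldLoop p) (.pair .right (.pair .left
    (.pair .nil .nil)))), fun a => (sz a + 2) ^ c + 70,
    PolyBdd.add ⟨c, fun a => le_rfl⟩ (PolyBdd.const 70), fun n e hn => ?_⟩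
  have hfold : ∀ (l : List Unit) (s : ℕ), l.foldl (fun s _ => s * n) s = s * n ^ l.length := by
    intro l
    induction l with
    | nil => simp
    | cons b l ih => intro s; simp [ih, pow_succ]; ring
  have hmax : Fn.foldMax (fun a : ℕ × ℕ × Unit => a.2.1 * a.1) T n (List.replicate e ()) 1 ≤
      (n ^ e + n + 2) ^ c := by
    refine Fn.foldMax_le fun l' b hl' => (hc _).trans (Nat.pow_le_pow_left ?_ c)
    have h1 := hl'.length_le
    simp only [List.length_append, List.length_singleton, List.length_replicate] at h1
    have h2 : n ^ l'.length ≤ n ^ e := Nat.pow_le_pow_right hn (by omega)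
    simp only [sz_prod, sz_nat, sz_unit, hfold]
    omega
  have h1 := (Fn.foldRuns hp n (List.replicate e ()) 1 hmax).runs
  have he : BTree.ofList ((List.replicate e ()).map enc) = enc e := by
    simp [enc, BTree.ofNat]
  rw [he] at h1
  have h2 := (((Runs.right (x := enc (n, e))).pair (Runs.left.pair (Runs.nil.pair Runs.nil))).comp
    h1).comp (Runs.comp Runs.right Runs.right)
  simp only [List.length_map, List.length_replicate, hfold, one_mul] at h2
  refine h2.mono ?_
  simp only [sz_prod, sz_nat]
  ring_nf
  omega

/-- Produce a list of random bits whose length is given in unary. -/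
def genProg : Prog :=
  comp (comp right right) (comp (foldLoop (pair flip (comp left right))) (pair id (pair nil nil)))

/-- The fold prepends each fresh bit, hence the reversal, which `exists_reduction` undoes. -/
theorem genProg_runs (w : List Bool) :
    genProg.Runs (enc w.length) w (enc w.reverse) (60 * (w.length + 2)) := by
  have key : ∀ (w : List Bool) (s : List Bool), FoldRuns (pair flip (comp left right)) .nil 5
      (List.replicate w.length .nil) (enc s) w (enc (w.reverse ++ s)) := by
    intro w
    induction w with
    | nil => exact fun s => .nil _
    | cons b w ih =>
      intro s
      have h1 : (pair flip (comp left right)).Runs (.cons .nil (.cons (enc s) .nil)) [b]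
          (enc (b :: s)) 5 := (Runs.flip b).pair (Runs.comp Runs.right Runs.left)
      have := FoldRuns.cons h1 (ih (b :: s))
      simpa [List.replicate_succ] using this
  have h1 := ((Runs.id.pair (Runs.nil.pair Runs.nil)).comp (key w []).runs).comp
    (Runs.comp Runs.right Runs.right)
  simp only [List.append_nil, List.nil_append, List.length_replicate] at h1
  exact h1.mono (by omega)

/-- The outputs of `r` successive runs of `A` on the input `x`, each of them within time `t`. -/
inductive Multi (A : Prog) (x : BTree) (t : ℕ) : ℕ → List Bool → List BTree → Prop
  | zero : Multi A x t 0 [] []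
  | succ {r : ℕ} {v v' : List Bool} {y : BTree} {ys : List BTree} :
      A.Runs x v y t → Multi A x t r v' ys → Multi A x t (r + 1) (v ++ v') (y :: ys)

theorem Multi.length_eq {A : Prog} {x : BTree} {t r : ℕ} {v : List Bool} {ys : List BTree}
    (h : Multi A x t r v ys) : ys.length = r := by
  induction h with
  | zero => rfl
  | succ _ _ ih => simp [ih]

/-- Run `A` as often as the second component of the input says. -/
def repeatProg (A : Prog) : Prog :=
  comp (comp right right) (comp (foldLoop (pair (comp A left) (comp left right)))
    (pair right (pair left nil)))

theorem Multi.runs {A : Prog} {x : BTree} {t r : ℕ} {v : List Bool} {ys : List BTree}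
    (h : Multi A x t r v ys) :
    (repeatProg A).Runs (enc (x, r)) v (enc ys.reverse) (60 * (r + 1) * (t + 1)) := by
  have key : ∀ s : List BTree, FoldRuns (pair (comp A left) (comp left right)) x (t + 6)
      (List.replicate r .nil) (enc s) v (enc (ys.reverse ++ s)) := by
    induction h with
    | zero => exact fun s => .nil _
    | @succ r v v' y ys h1 _ ih =>
      intro s
      have h2 : (pair (comp A left) (comp left right)).Runs (.cons x (.cons (enc s) .nil)) v
          (enc (y :: s)) (t + 6) := by
        have := (Runs.comp Runs.left h1).pair (Runs.comp (x := .cons x (.cons (enc s) .nil))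
          Runs.right Runs.left)
        simp only [List.nil_append, List.append_nil] at this
        exact this.mono (by omega)
      have := FoldRuns.cons h2 (ih (y :: s))
      simpa [List.replicate_succ] using this
  have h1 := (((Runs.right (x := enc (x, r))).pair (Runs.left.pair Runs.nil)).comp
    (key []).runs).comp
    (Runs.comp Runs.right Runs.right)
  simp only [List.append_nil, List.nil_append, List.length_replicate] at h1
  refine (show (repeatProg A).Runs (enc (x, r)) v (enc ys.reverse) _ from h1).mono ?_
  ring_nf
  omega

theorem HaltsBy.exists_multi {A : Prog} {x : BTree} {t : ℕ} (h : A.HaltsBy x t) (r : ℕ)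
    {w : List Bool} (hw : r * t ≤ w.length) :
    ∃ v u ys, w = v ++ u ∧ v.length ≤ r * t ∧ Multi A x t r v ys := by
  induction r generalizing w with
  | zero => exact ⟨[], w, [], rfl, by simp, .zero⟩
  | succ r ih =>
    rw [Nat.add_mul, one_mul] at hw
    obtain ⟨v, u, y, rfl, hv, hr⟩ := h.exists_runs (w := w) (by omega)
    rw [List.length_append] at hw
    obtain ⟨v', u', ys, rfl, hv', hr'⟩ := ih (w := u) (by omega)
    refine ⟨v ++ v', u', y :: ys, by simp, ?_, .succ hr hr'⟩
    rw [List.length_append, Nat.add_mul, one_mul]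
    omega

end Prog

theorem majority_reverse (l : List Bool) : majority l.reverse = majority l := by
  simp [majority]

/-! ### The reduction -/

/-- The basic length parameter of the reduction. -/
def ellOf (C k n : ℕ) : ℕ := C * (Nat.log 2 n / k + 1)

/-- The patterns that are small, but not too small, in comparison with the host graph. -/
def sizeOK (k n : ℕ) : Bool := decide (16 ≤ k) && decide (k ≤ Nat.log 2 n)

/-- The number of tuples per colour. -/
def numTuples (d C k n : ℕ) : ℕ := n ^ (2 * (d - 1) * ellOf C k n)

/-- The length of the tuples. -/
def tupleLen (d C k n : ℕ) : ℕ := 2 * d * ellOf C k n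

/-- The number of random vertices used by the reduction. -/
def numPicks (d C k n : ℕ) : ℕ := numTuples d C k n * k * tupleLen d C k n

/-- The instance produced from a pattern, a host graph and a tape. -/
def reduce (d C : ℕ) (P X : BitMat) (w : List Bool) : BitMat :=
  instMat P X (numTuples d C P.length X.length * P.length) (tupleLen d C P.length X.length)
    (picks X.length (numPicks d C P.length X.length) w)

theorem Fn.ellOf {α : Type} [TreeEnc α] {κ : Bool} (C : ℕ) {k n : α → ℕ} (hk : Fn κ k)
    (hn : Fn κ n) : Fn κ (fun a => ellOf C (k a) (n a)) :=
  mul (const C) (succ (div (log_two hn) hk))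

open Prog in
/-- A randomized program that builds an instance for the `i`-th pattern and solves it by a majority
vote over many runs of `A`. -/
theorem exists_reduction (A : Prog) {code : ℕ → BTree} {pat : ℕ → BitMat} (hcode : Fn false code)
    (hpat : Fn false pat) (d C : ℕ) :
    ∃ (B : Prog) (c : ℕ) (K : ℕ → ℕ), ∀ (i : ℕ) (X : BitMat),
      (sizeOK (pat i).length X.length = false → ∃ T, B.Runs (enc (i, X)) [] .nil T) ∧
      (sizeOK (pat i).length X.length = true →
        ∀ (w v : List Bool) (t : ℕ) (ys : List BTree),
        w.length = numPicks d C (pat i).length X.length * X.length →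
        Multi A (.cons (code i) (enc (reduce d C (pat i) X w))) t (X.length * X.length) v ys →
        B.Runs (enc (i, X)) (w ++ v) (enc (some (majority (ys.map fun y => !y.isNil))))
          (K i + (sz (pat i) + sz X + numTuples d C (pat i).length X.length + 2) ^ c +
            60 * (X.length * X.length + 1) * (t + 1))) := by
  -- The code and the pattern are computed without any time bound. The cost `T0 i` depends on the
  -- index alone and becomes part of `K`.
  obtain ⟨p0, T0, hp0, -⟩ := hcode.pair hpat
  have hk : ∀ {κ : Bool}, Fn κ fun z : (BTree × BitMat) × BitMat => z.1.2.length :=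
    Fn.length (Fn.snd.comp Fn.fst)
  have hn : ∀ {κ : Bool}, Fn κ fun z : (BTree × BitMat) × BitMat => z.2.length := Fn.length Fn.snd
  obtain ⟨pg, Tg, hpg, hTg⟩ : Fn true fun z : (BTree × BitMat) × BitMat =>
      sizeOK z.1.2.length z.2.length :=
    Fn.and (Fn.le (Fn.const 16) hk) (Fn.le hk (Fn.log_two hn))
  have hell := Fn.ellOf (κ := true) C hk hn
  have he : Fn true fun z : (BTree × BitMat) × BitMat =>
      2 * (d - 1) * ellOf C z.1.2.length z.2.length := Fn.mul (Fn.const (2 * (d - 1))) hell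
  have hl : Fn true fun z : (BTree × BitMat) × BitMat =>
      2 * d * ellOf C z.1.2.length z.2.length := Fn.mul (Fn.const (2 * d)) hell
  obtain ⟨p1, T1, hp1, hT1⟩ := hn.pair he
  obtain ⟨pw, Tw, hTw, hpw⟩ := exists_powProg
  have hN : Fn true fun a : ((BTree × BitMat) × BitMat) × ℕ => a.2 * a.1.1.2.length :=
    Fn.mul Fn.snd (hk.comp Fn.fst)
  have hQ : Fn true fun a : ((BTree × BitMat) × BitMat) × ℕ =>
      a.2 * a.1.1.2.length * (2 * d * ellOf C a.1.1.2.length a.1.2.length) :=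
    Fn.mul hN (hl.comp Fn.fst)
  have hbits := Fn.mul hQ (hn.comp Fn.fst)
  obtain ⟨p2, T2, hp2, hT2⟩ := id hbits
  obtain ⟨p3, T3, hp3, hT3⟩ : Fn true fun a : (((BTree × BitMat) × BitMat) × ℕ) × List Bool =>
      (BTree.cons a.1.1.1.1 (enc (instMat a.1.1.1.2 a.1.1.2 (a.1.2 * a.1.1.1.2.length)
        (2 * d * ellOf C a.1.1.1.2.length a.1.1.2.length)
        (picks a.1.1.2.length (a.1.2 * a.1.1.1.2.length *
          (2 * d * ellOf C a.1.1.1.2.length a.1.1.2.length)) a.2.reverse))),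
        a.1.1.2.length * a.1.1.2.length) :=
    Fn.pair (Fn.btree_cons (Fn.fst.comp (Fn.fst.comp (Fn.fst.comp Fn.fst)))
      (Fn.opaque_of (Fn.instMat (Fn.snd.comp (Fn.fst.comp (Fn.fst.comp Fn.fst)))
        (Fn.snd.comp (Fn.fst.comp Fn.fst)) (hN.comp Fn.fst) (hl.comp (Fn.fst.comp Fn.fst))
        (Fn.picks (hn.comp (Fn.fst.comp Fn.fst)) (hQ.comp Fn.fst) (Fn.reverse Fn.snd)))))
      (Fn.mul (hn.comp (Fn.fst.comp Fn.fst)) (hn.comp (Fn.fst.comp Fn.fst)))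
  obtain ⟨p5, T5, hp5, hT5⟩ : Fn true fun ys : List BTree =>
      some (majority (ys.map fun y => !y.isNil)) :=
    Fn.some (Fn.majority (Fn.map (f := fun b : List BTree × BTree => !b.2.isNil) Fn.id
      (Fn.not (Fn.isNil Fn.snd))))
  obtain ⟨c3, hc3⟩ := (hT3 rfl).1
  obtain ⟨c5, hc5⟩ := (hT5 rfl).1
  have hz : PolyBdd fun a : ((BTree × BitMat) × BitMat) × ℕ => sz a.1 :=
    Fn.sz_bdd Fn.fst
  have hnb : PolyBdd fun a : ((BTree × BitMat) × BitMat) × ℕ => a.1.2.length :=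
    Fn.sz_bdd (hn.comp Fn.fst)
  -- The component `a.2` stands for the number of tuples per colour. It need not be polynomial in
  -- `n`, but once it is counted in the size of `a`, all other costs are polynomial.
  have hpoly : PolyBdd fun a : ((BTree × BitMat) × BitMat) × ℕ =>
      Tg a.1 + T1 a.1 + Tw (a.2, a.1.2.length) *
        (2 * (d - 1) * ellOf C a.1.1.2.length a.1.2.length + 1) + T2 a +
        60 * (a.2 * a.1.1.2.length * (2 * d * ellOf C a.1.1.2.length a.1.2.length) *
          a.1.2.length + 2) +
        (sz a + a.2 * a.1.1.2.length * (2 * d * ellOf C a.1.1.2.length a.1.2.length) *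
          a.1.2.length + 2) ^ c3 + (a.1.2.length * a.1.2.length + 2) ^ c5 + 50 := by
    refine ((((((((hTg rfl).1.comp hz).add ((hT1 rfl).1.comp hz)).add
      ((hTw.comp (f := fun a : ((BTree × BitMat) × BitMat) × ℕ => (a.2, a.1.2.length))
        ((Fn.snd (κ := true)).pair (hn.comp Fn.fst)).sz_bdd).mul
      ((he.comp Fn.fst).sz_bdd.add (PolyBdd.const 1)))).add (hT2 rfl).1).add ?_).add ?_).add ?_).add
      (PolyBdd.const 50)
    · exact (PolyBdd.const 60).mul (hbits.sz_bdd.add (PolyBdd.const 2))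
    · exact (PolyBdd.size.add hbits.sz_bdd).pow_comp c3
    · exact (hnb.mul hnb).pow_comp c5
  obtain ⟨c, hc⟩ := hpoly
  -- Refusal is `nil` and an answer has the form `some b`, so that a negative answer differs from no
  -- answer when many indices are tried in parallel.
  refine ⟨.comp (.ite pg (.comp p5 (.comp (repeatProg A) (.comp p3 (.comp (.pair .id
    (.comp genProg p2)) (.pair .id (.comp pw p1)))))) .nil) (.pair (.comp p0 .left) .right), c,
    fun i => T0 i + 20, fun i X => ?_⟩
  have hstart := (Runs.comp (x := enc (i, X)) Runs.left (hp0 i)).pair (Runs.right (x := enc (i, X)))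
  set z : (BTree × BitMat) × BitMat := ((code i, pat i), X) with hzdef
  have hgz := hpg z
  constructor
  · intro hg
    simp only [hzdef, hg] at hgz
    exact ⟨_, hstart.comp (Runs.ite_neg hgz Runs.nil)⟩
  · intro hg w v t ys hw hm
    have hg' : sizeOK z.1.2.length z.2.length = true := hg
    have hX : 1 ≤ X.length := by
      by_contra h0
      have : X.length = 0 := by omega
      simp only [sizeOK, this, Bool.and_eq_true, decide_eq_true_eq, Nat.log_zero_right] at hg
      omega
    simp only [hg'] at hgz
    have h1 := (Runs.id (x := enc z)).pair ((hp1 z).comp (hpw _ _ hX))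
    set a : ((BTree × BitMat) × BitMat) × ℕ :=
      (z, X.length ^ (2 * (d - 1) * ellOf C z.1.2.length z.2.length)) with hadef
    have hw' : w.length = a.2 * a.1.1.2.length *
      (2 * d * ellOf C a.1.1.2.length a.1.2.length) * a.1.2.length := hw
    have h2' : p2.Runs (enc a) [] (enc w.length) (T2 a) := by
      rw [hw']
      exact hp2 a
    have h2 := (Runs.id (x := enc a)).pair (h2'.comp (genProg_runs w))
    have h3 := hp3 (a, w.reverse)
    simp only [List.reverse_reverse] at h3
    have h5 := hp5 ys.reverse
    simp only [List.map_reverse, majority_reverse] at h5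
    have hfin := hstart.comp (Runs.ite_pos (q := .nil) hgz (by simp)
      ((((h1.comp h2).comp h3).comp hm.runs).comp h5))
    simp only [List.nil_append, List.append_nil] at hfin
    refine hfin.mono ?_
    have hca := hc a
    dsimp only at hca
    have hc3a := hc3 (a, w.reverse)
    have hc5a := hc5 ys.reverse
    have hsw : sz w = w.length := by
      clear * -
      induction w with
      | nil => rfl
      | cons b w ih => simp [ih]; omega
    have hsy : sz ys = ys.length := by
      clear * -
      induction ys with
      | nil => rfl
      | cons b w ih => simp [ih]; omega
    rw [sz_prod, sz_reverse, hsw, hw'] at hc3a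
    rw [sz_reverse, hsy, hm.length_eq] at hc5a
    have hsza : sz a = sz (pat i) + sz X + numTuples d C (pat i).length X.length := by
      simp [hadef, hzdef, numTuples]
    rw [hsza] at hca hc3a
    rw [hw']
    simp only [hadef, hzdef] at hca hc3a hc5a ⊢
    omega

/-! ### The error of majority votes -/

namespace Prog

/-- The number of accepting runs among `r` successive runs on a tape. -/
def multiCount (A : Prog) (x : BTree) (t : ℕ) : ℕ → List Bool → ℕ
  | 0, _ => 0
  | r + 1, u =>
    match runT A x t u with
    | none => 0
    | some a => (if a.1.isNil then 0 else 1) + multiCount A x t r a.2.2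

theorem Multi.multiCount_eq {A : Prog} {x : BTree} {t r : ℕ} {v : List Bool} {ys : List BTree}
    (h : Multi A x t r v ys) (u : List Bool) :
    multiCount A x t r (v ++ u) = (ys.map fun y => !y.isNil).count true := by
  induction h with
  | zero => rfl
  | @succ r v v' y ys h1 _ ih =>
    obtain ⟨s, hs⟩ := h1.runT le_rfl (v' ++ u)
    rw [← List.append_assoc] at hs
    simp only [multiCount, hs, ih]
    cases hy : y.isNil <;> simp [hy, Nat.add_comm]

/-- A halting run puts no mass on `none`, so whether its output is nonempty is a Bernoulli variable
with parameter `A.acceptProb x`. -/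
theorem tsum_eval_accept {A : Prog} {x : BTree} {t : ℕ} (h : A.HaltsBy x t) (a b : ℝ≥0∞)
    {c : Result → ℝ≥0∞} (hc : ∀ y s, c (some (y, s)) = if y.isNil then b else a) :
    ∑' r, eval A x t r * c r = A.acceptProb x * a + (1 - A.acceptProb x) * b := by
  classical
  have hP : A.acceptProb x =
      ∑' r, eval A x t r * (if ∃ y s, r = some (y, s) ∧ y ≠ BTree.nil then 1 else 0) := by
    rw [acceptProb_eq h le_rfl]
    have h1 := toOuterMeasure_eval A x (le_refl t)
    rw [PMF.toOuterMeasure_apply] at h1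
    have h2 : avg t (fun w => if A.AcceptsOn x w then (1 : ℝ≥0∞) else 0) =
        avg t (fun w => if Accepts (Prog.runT A x t w) then 1 else 0) := by
      refine avg_congr fun w hw => ?_
      have := h.accepts_iff (w := w) (w' := []) hw.ge
      rw [List.append_nil] at this
      simp only [this]
    rw [h2, ← h1]
    refine tsum_congr fun r => ?_
    simp [Set.indicator]
  have hnone := haltsBy_iff.1 h
  have hsum : A.acceptProb x +
      ∑' r, eval A x t r * (if ∃ y s, r = some (y, s) ∧ y ≠ BTree.nil then 0 else 1) = 1 := by
    rw [hP, ← ENNReal.tsum_add, ← (eval A x t).tsum_coe]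
    refine tsum_congr fun r => ?_
    split_ifs <;> simp
  have hle : A.acceptProb x ≤ 1 := by
    rw [← hsum]; exact le_self_add
  have hQ : ∑' r, eval A x t r * (if ∃ y s, r = some (y, s) ∧ y ≠ BTree.nil then 0 else 1) =
      1 - A.acceptProb x := by
    refine ENNReal.eq_sub_of_add_eq' ENNReal.one_ne_top ?_
    rw [add_comm]
    exact hsum
  rw [← hQ]
  nth_rw 1 [hP]
  rw [← ENNReal.tsum_mul_right, ← ENNReal.tsum_mul_right, ← ENNReal.tsum_add]
  refine tsum_congr fun r => ?_
  rcases r with _ | ⟨y, s⟩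
  · simp [hnone]
  · rw [hc]
    cases y <;> simp [BTree.isNil]

theorem acceptProb_le_one {A : Prog} {x : BTree} {t : ℕ} (h : A.HaltsBy x t) :
    A.acceptProb x ≤ 1 := by
  classical
  rw [acceptProb_eq h le_rfl, ← avg_const t 1]
  exact avg_mono fun w _ => by split_ifs <;> simp

/-- Successive runs use fresh coins, so their variances add up. The offset `a` carries the
induction: the first run shifts it by a variable of mean zero and variance `p * (1 - p)`, and the
mixed term disappears. -/
theorem avg_variance {A : Prog} {x : BTree} {t : ℕ} (h : A.HaltsBy x t) (r : ℕ) (a : ℝ) {L : ℕ}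
    (hL : r * t ≤ L) :
    avg L (fun u => ENNReal.ofReal ((a + multiCount A x t r u - r * (A.acceptProb x).toReal) ^ 2)) =
      ENNReal.ofReal (a ^ 2 + r * ((A.acceptProb x).toReal * (1 - (A.acceptProb x).toReal))) := by
  have hle := acceptProb_le_one h
  have hfin : A.acceptProb x ≠ ⊤ := ne_top_of_le_ne_top ENNReal.one_ne_top hle
  have hp : ENNReal.ofReal (A.acceptProb x).toReal = A.acceptProb x := ENNReal.ofReal_toReal hfin
  set p := (A.acceptProb x).toReal with hpdef
  have hp0 : 0 ≤ p := ENNReal.toReal_nonneg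
  have hp1 : p ≤ 1 := by
    have := ENNReal.toReal_mono ENNReal.one_ne_top hle
    simpa using this
  induction r generalizing a L with
  | zero => simp [multiCount]
  | succ r ih =>
    rw [Nat.add_mul, one_mul] at hL
    have h1 := simulates_runT A x t L (by omega)
      (fun o => match o with
        | none => 0
        | some b => ENNReal.ofReal ((a + (if b.1.isNil then 0 else 1) - p +
            multiCount A x t r b.2.2 - r * p) ^ 2))
      (fun o => match o with
        | none => 0
        | some b => if b.1.isNil then ENNReal.ofReal ((a - p) ^ 2 + r * (p * (1 - p)))
            else ENNReal.ofReal ((a + 1 - p) ^ 2 + r * (p * (1 - p)))) rfl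
      (by
        intro y s L' hs hL'
        dsimp only
        refine (ih (a + (if y.isNil then 0 else 1) - p) (L := L') (by omega)).trans ?_
        split_ifs <;> simp)
    rw [tsum_eval_accept h (ENNReal.ofReal ((a + 1 - p) ^ 2 + r * (p * (1 - p))))
      (ENNReal.ofReal ((a - p) ^ 2 + r * (p * (1 - p)))) (fun y s => rfl)] at h1
    rw [← hp, ← ENNReal.ofReal_one, ← ENNReal.ofReal_sub _ hp0, ← ENNReal.ofReal_mul hp0,
      ← ENNReal.ofReal_mul (by linarith), ← ENNReal.ofReal_add] at h1
    · rw [show a ^ 2 + ((r + 1 : ℕ) : ℝ) * (p * (1 - p)) =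
        p * ((a + 1 - p) ^ 2 + r * (p * (1 - p))) + (1 - p) * ((a - p) ^ 2 + r * (p * (1 - p))) by
          push_cast; ring, ← h1]
      refine avg_congr fun w hw => ?_
      obtain ⟨v, u, y, s, _, _, hs⟩ := h.runT (w := w) (by omega)
      simp only [multiCount, hs]
      congr 2
      push_cast
      ring
    · have := mul_nonneg hp0 (sub_nonneg.2 hp1)
      positivity
    · have := mul_nonneg hp0 (sub_nonneg.2 hp1)
      have := sub_nonneg.2 hp1
      positivity

/-- The majority vote over `r` runs errs with probability at most `9 / r`. -/
theorem vote_error {A : Prog} {x : BTree} {t : ℕ} (h : A.HaltsBy x t) {r L : ℕ} (hr : 0 < r)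
    (hL : r * t ≤ L) :
    (2 / 3 ≤ A.acceptProb x →
      avg L (fun u => if r < 2 * multiCount A x t r u then 0 else 1) ≤ 9 / r) ∧
    (A.acceptProb x ≤ 1 / 3 →
      avg L (fun u => if r < 2 * multiCount A x t r u then 1 else 0) ≤ 9 / r) := by
  have hle := acceptProb_le_one h
  have hfin : A.acceptProb x ≠ ⊤ := ne_top_of_le_ne_top ENNReal.one_ne_top hle
  have hvar := avg_variance h r 0 hL
  set p := (A.acceptProb x).toReal with hpdef
  have hr' : (0 : ℝ) < r := by exact_mod_cast hr
  -- Chebyshev's inequality: `p` differs from one half by at least `1 / 6`, so an error means a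
  -- deviation of at least `r / 6`, while the variance is at most `r / 4`.
  have main : ∀ f : List Bool → ℝ≥0∞, (∀ u, f u ≤ ENNReal.ofReal (36 / r ^ 2) *
      ENNReal.ofReal ((0 + multiCount A x t r u - r * p) ^ 2)) → avg L f ≤ 9 / r := by
    intro f hf
    refine (avg_mono fun u _ => hf u).trans ?_
    rw [avg_mul_left, hvar, ← ENNReal.ofReal_mul (by positivity)]
    rw [show (9 : ℝ≥0∞) / r = ENNReal.ofReal (9 / r) by
      rw [ENNReal.ofReal_div_of_pos hr']; simp]
    refine ENNReal.ofReal_le_ofReal ?_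
    have : p * (1 - p) ≤ 1 / 4 := by nlinarith [sq_nonneg (p - 1 / 2)]
    calc 36 / (r : ℝ) ^ 2 * ((0 : ℝ) ^ 2 + (r : ℝ) * (p * (1 - p)))
        ≤ 36 / (r : ℝ) ^ 2 * ((0 : ℝ) ^ 2 + (r : ℝ) * (1 / 4)) := by gcongr
      _ = 9 / (r : ℝ) := by field_simp; norm_num; ring
  have one_le : ∀ z : ℝ, (r / 6 : ℝ) ^ 2 ≤ z ^ 2 →
      1 ≤ ENNReal.ofReal (36 / r ^ 2) * ENNReal.ofReal (z ^ 2) := by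
    intro z hz
    rw [← ENNReal.ofReal_mul (by positivity), ENNReal.one_le_ofReal]
    calc (1 : ℝ) = 36 / r ^ 2 * (r / 6) ^ 2 := by field_simp; norm_num
      _ ≤ _ := by gcongr
  constructor
  · intro hacc
    have hp : 2 / 3 ≤ p := by
      have := ENNReal.toReal_mono hfin hacc
      rw [ENNReal.toReal_div] at this
      simpa using this
    refine main _ fun u => ?_
    split_ifs with hu
    · simp
    · refine one_le _ ?_
      rw [not_lt] at hu
      have hu' : 2 * (multiCount A x t r u : ℝ) ≤ r := by exact_mod_cast hu
      rw [sq_le_sq, abs_of_pos (by positivity)]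
      refine le_abs.2 (Or.inr ?_)
      nlinarith
  · intro hacc
    have hp : p ≤ 1 / 3 := by
      have := ENNReal.toReal_mono (by simp) hacc
      rw [ENNReal.toReal_div] at this
      simpa using this
    refine main _ fun u => ?_
    split_ifs with hu
    · refine one_le _ ?_
      have hu' : (r : ℝ) < 2 * (multiCount A x t r u : ℝ) := by exact_mod_cast hu
      rw [sq_le_sq, abs_of_pos (by positivity)]
      refine le_abs.2 (Or.inl ?_)
      nlinarith
    · simp

end Prog

/-! ### Running a program on many inputs in parallel -/

namespace Prog

theorem runT_zero (p : Prog) (x : BTree) (w : List Bool) : runT p x 0 w = none := by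
  cases p <;> rfl

/-- The output of a run, if it is finished, and the empty tree otherwise. -/
def outTree (r : TapeResult) : BTree :=
  match r with
  | none => .nil
  | some r => r.1

/-- The first nonempty output among the runs of `B` on the inputs `(i, X)` on the tape `w`, with the
length of the tape as time limit. -/
def firstAnswer (B : Prog) (X : BitMat) (w : List Bool) : BTree :=
  (List.range X.length).foldl (fun s i =>
    if s.isNil then outTree (runT B (enc (i, X)) w.length w) else s) .nil

theorem foldl_first (f : ℕ → BTree) (l : List ℕ) (s : BTree) :
    (l.foldl (fun s i => if s.isNil then f i else s) s = s ∧ (s ≠ .nil ∨ ∀ i ∈ l, f i = .nil)) ∨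
      ∃ i ∈ l, f i ≠ .nil ∧ l.foldl (fun s i => if s.isNil then f i else s) s = f i := by
  induction l generalizing s with
  | nil => simp
  | cons j l ih =>
    rw [List.foldl_cons]
    cases hs : s with
    | cons a b =>
      rw [if_neg (by simp [BTree.isNil])]
      rcases ih (.cons a b) with ⟨h1, _⟩ | ⟨i, hi, h1, h2⟩
      · exact Or.inl ⟨h1, Or.inl (by simp)⟩
      · exact Or.inr ⟨i, by simp [hi], h1, h2⟩
    | nil =>
      rw [if_pos (by simp [BTree.isNil])]
      rcases ih (f j) with ⟨h1, h2⟩ | ⟨i, hi, h1, h2⟩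
      · by_cases hj : f j = .nil
        · refine Or.inl ⟨by rw [h1, hj], Or.inr ?_⟩
          rcases h2 with h2 | h2
          · exact absurd hj h2
          · simpa [hj] using h2
        · exact Or.inr ⟨j, by simp, hj, h1⟩
      · exact Or.inr ⟨i, by simp [hi], h1, h2⟩

theorem firstAnswer_nil (B : Prog) (X : BitMat) : firstAnswer B X [] = .nil := by
  rcases foldl_first (fun i => outTree (runT B (enc (i, X)) 0 [])) (List.range X.length) .nil with
    ⟨h, _⟩ | ⟨i, _, h, _⟩
  · exact h
  · simp [runT_zero, outTree] at h

theorem firstAnswer_spec {B : Prog} {X : BitMat} {w : List Bool} (h : firstAnswer B X w ≠ .nil) :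
    ∃ i < X.length, ∃ v u, w = v ++ u ∧ B.Runs (enc (i, X)) v (firstAnswer B X w) w.length := by
  rcases foldl_first (fun i => outTree (runT B (enc (i, X)) w.length w)) (List.range X.length) .nil
    with ⟨h1, _⟩ | ⟨i, hi, h1, h2⟩
  · exact absurd h1 h
  · refine ⟨i, by simpa using hi, ?_⟩
    rw [show firstAnswer B X w = _ from h2]
    cases hr : runT B (enc (i, X)) w.length w with
    | none => exact absurd (congrArg outTree hr) h1
    | some r =>
      obtain ⟨v, hv, _, hr'⟩ := runs_of_runT (p := B) (y := r.1) (s := r.2.1) (w' := r.2.2) hr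
      exact ⟨v, _, hv, hr'⟩

theorem firstAnswer_ne_nil {B : Prog} {X : BitMat} {v u : List Bool} {i t : ℕ} {y : BTree}
    (hi : i < X.length) (h : B.Runs (enc (i, X)) v y t) (hy : y ≠ .nil)
    (ht : t ≤ (v ++ u).length) : firstAnswer B X (v ++ u) ≠ .nil := by
  rcases foldl_first (fun i => outTree (runT B (enc (i, X)) (v ++ u).length (v ++ u)))
    (List.range X.length) .nil with ⟨_, h2⟩ | ⟨j, hj, h1, h2⟩
  · obtain ⟨s, hs⟩ := h.runT ht u
    rcases h2 with h2 | h2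
    · exact absurd rfl h2
    · have := h2 i (by simpa using hi)
      rw [hs] at this
      exact absurd this hy
  · rw [show firstAnswer B X (v ++ u) = _ from h2]
    exact h1

/-- The state of the fold is an output tree, which has size zero, so the clocked runs for all
indices can be combined without any growth. -/
theorem fn_firstAnswer (B : Prog) :
    Fn true fun a : BitMat × List Bool => firstAnswer B a.1 a.2 := by
  have h1 : Fn true fun a : (BitMat × List Bool) × BTree × ℕ =>
      runT B (enc (a.2.2, a.1.1)) a.1.2.length a.1.2 :=
    (fn_runT B).comp (f := fun a : (BitMat × List Bool) × BTree × ℕ =>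
      (enc (a.2.2, a.1.1), a.1.2.length, a.1.2))
      ((Fn.opaque_of ((Fn.snd.comp Fn.snd).pair (Fn.fst.comp Fn.fst))).pair
        ((Fn.length (Fn.snd.comp Fn.fst)).pair (Fn.snd.comp Fn.fst)))
  have h2 : Fn true fun a : (BitMat × List Bool) × BTree × ℕ =>
      outTree (runT B (enc (a.2.2, a.1.1)) a.1.2.length a.1.2) :=
    (Fn.option_cases h1 (Fn.const BTree.nil) (Fn.fst.comp Fn.snd)).of_eq fun a => by
      cases h : runT B (enc (a.2.2, a.1.1)) a.1.2.length a.1.2 <;> rfl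
  exact Fn.foldl_add (l := fun a : BitMat × List Bool => List.range a.1.length)
    (s := fun _ => BTree.nil) (step := fun a => if a.2.1.isNil then
      outTree (runT B (enc (a.2.2, a.1.1)) a.1.2.length a.1.2) else a.2.1)
    (Fn.range (Fn.length Fn.fst)) (Fn.const _)
    (Fn.ite (Fn.isNil (Fn.fst.comp Fn.snd)) h2 (Fn.fst.comp Fn.snd))
    fun _ => ⟨fun _ => 0, PolyBdd.const 0, fun _ _ _ _ => by simp⟩

/-- Run `B` on the inputs `(i, X)`, for all `i` smaller than the number of rows of `X`, in parallel
and on the same coins, until there is a first nonempty output; then return its right subtree. -/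
theorem exists_parallel (B : Prog) : ∃ (P : Prog) (c : ℕ), ∀ (X : BitMat) (t i : ℕ),
    i < X.length → (∀ w : List Bool, w.length = t → ∃ v u y, w = v ++ u ∧
      B.Runs (enc (i, X)) v y t ∧ y ≠ .nil) →
    ∀ w : List Bool, t < w.length → ∃ v u z, w = v ++ u ∧
      P.Runs (enc X) v z ((sz X + t + 2) ^ c) ∧
      ∃ j < X.length, ∃ v' u' y T, w = v' ++ u' ∧ B.Runs (enc (j, X)) v' y T ∧ y ≠ .nil ∧
        z = y.right := by
  obtain ⟨q, S, hq, hS⟩ : Fn true fun a : Bool × BitMat × List Bool × BTree =>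
      (a.2.1, a.2.2.1 ++ [a.1], firstAnswer B a.2.1 (a.2.2.1 ++ [a.1])) := by
    have h1 : Fn true fun a : Bool × BitMat × List Bool × BTree => a.2.2.1 ++ [a.1] :=
      Fn.append (Fn.fst.comp (Fn.snd.comp Fn.snd)) (Fn.cons Fn.fst (Fn.const []))
    have h2 : Fn true fun a : Bool × BitMat × List Bool × BTree => a.2.1 := Fn.fst.comp Fn.snd
    exact h2.pair (h1.pair ((fn_firstAnswer B).comp (h2.pair h1)))
  obtain ⟨c₀, hc₀⟩ := (hS rfl).1
  obtain ⟨e, Te, he, hTe⟩ : Fn true fun a : BitMat × List Bool × BTree => a.2.2.isNil :=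
    Fn.isNil (Fn.snd.comp Fn.snd)
  obtain ⟨c₁, hc₁⟩ := (hTe rfl).1
  have hpoly : PolyBdd fun a : BitMat × ℕ => (a.2 + 2) *
      ((sz a + 4 + 2) ^ c₀ + (sz a + 4 + 2) ^ c₁ + 20) + 20 :=
    (((Fn.sz_bdd (Fn.snd : Fn true fun a : BitMat × ℕ => a.2)).add (PolyBdd.const 2)).mul
      ((((PolyBdd.size.add (PolyBdd.const 4)).pow_comp c₀).add
        ((PolyBdd.size.add (PolyBdd.const 4)).pow_comp c₁)).add (PolyBdd.const 20))).add
      (PolyBdd.const 20)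
  obtain ⟨c, hc⟩ := hpoly
  refine ⟨.comp (.comp .right (.comp .right .right)) (.comp (.loop e (.comp q (.pair .flip .id)))
    (.pair .id (.pair .nil .nil))), c, fun X t i hi hB w hw => ?_⟩
  -- A bound for one round of the loop, in which all runs are restarted on the tape extended by one
  -- coin.
  set τ := (sz X + t + 4 + 2) ^ c₀ + (sz X + t + 4 + 2) ^ c₁ + 20 with hτ
  have hsw : ∀ w : List Bool, sz w = w.length := by
    intro w
    induction w with
    | nil => rfl
    | cons b w ih => simp [ih]; omega
  -- The state consists of the matrix, the coins `s` seen so far and the first answer on `s`; `d` is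
  -- the number of coins missing from `t + 1`. When none is missing, the run for `i` has certainly
  -- answered, so the loop stops.
  have key : ∀ (d : ℕ) (s w : List Bool), s.length + d = t + 1 → w.length = d →
      ∃ v u, w = v ++ u ∧ (Prog.loop e (.comp q (.pair .flip .id))).Runs
        (enc (X, s, firstAnswer B X s)) v (enc (X, s ++ v, firstAnswer B X (s ++ v)))
          ((d + 1) * τ) ∧ firstAnswer B X (s ++ v) ≠ .nil := by
    intro d
    induction d with
    | zero =>
      intro s w hs hw
      obtain ⟨v, u, y, hv, hr, hy⟩ := hB (s.take t) (by simp; omega)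
      have hne : firstAnswer B X s ≠ .nil := by
        have := firstAnswer_ne_nil (u := u ++ s.drop t) hi hr hy (by
          rw [← List.append_assoc, ← hv, List.take_append_drop]; omega)
        rwa [← List.append_assoc, ← hv, List.take_append_drop] at this
      have h1 := he (X, s, firstAnswer B X s)
      simp only [BTree.isNil_eq_false_iff.2 hne] at h1
      refine ⟨[], w, rfl, ?_, by simpa using hne⟩
      rw [List.append_nil]
      refine (Runs.loop_stop h1).mono ?_
      have h2 := hc₁ (X, s, firstAnswer B X s)
      have h3 : (sz (X, s, firstAnswer B X s) + 2) ^ c₁ ≤ (sz X + t + 4 + 2) ^ c₁ :=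
        Nat.pow_le_pow_left (by simp [hsw]; omega) _
      omega
    | succ d ih =>
      intro s w hs hw
      have h1 := he (X, s, firstAnswer B X s)
      have h2 := hc₁ (X, s, firstAnswer B X s)
      have h3 : (sz (X, s, firstAnswer B X s) + 2) ^ c₁ ≤ (sz X + t + 4 + 2) ^ c₁ :=
        Nat.pow_le_pow_left (by simp [hsw]; omega) _
      by_cases hne : firstAnswer B X s = .nil
      · simp only [BTree.isNil_iff.2 hne] at h1
        obtain ⟨b, w, rfl⟩ : ∃ b w', w = b :: w' := by
          cases w with
          | nil => simp at hw
          | cons b w => exact ⟨b, w, rfl⟩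
        obtain ⟨v, u, rfl, hr, hfin⟩ := ih (s ++ [b]) w (by simp; omega) (by simpa using hw)
        have h4 := ((Runs.flip (x := enc (X, s, firstAnswer B X s)) b).pair Runs.id).comp
          (hq (b, X, s, firstAnswer B X s))
        have h5 := Runs.loop_step h1 (by simp) h4 hr
        rw [List.append_assoc] at hfin hr
        refine ⟨b :: v, u, rfl, ?_, hfin⟩
        simp only [List.nil_append, List.append_assoc, List.singleton_append,
          List.append_nil] at h5
        refine h5.mono ?_
        have h6 := hc₀ (b, X, s, firstAnswer B X s)
        have h7 : (sz (b, X, s, firstAnswer B X s) + 2) ^ c₀ ≤ (sz X + t + 4 + 2) ^ c₀ :=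
          Nat.pow_le_pow_left (by simp [hsw]; omega) _
        have h8 : (d + 1 + 1) * τ = (d + 1) * τ + τ := by ring
        omega
      · simp only [BTree.isNil_eq_false_iff.2 hne] at h1
        refine ⟨[], w, rfl, ?_, by simpa using hne⟩
        rw [List.append_nil]
        refine (Runs.loop_stop h1).mono ?_
        have h8 : (d + 1 + 1) * τ = (d + 1) * τ + τ := by ring
        omega
  obtain ⟨v, u, hv, hr, hne⟩ := key (t + 1) [] (w.take (t + 1)) (by simp) (by simp; omega)
  rw [firstAnswer_nil] at hr
  simp only [List.nil_append] at hr hne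
  have hw' : w = v ++ (u ++ w.drop (t + 1)) := by
    rw [← List.append_assoc, ← hv, List.take_append_drop]
  refine ⟨v, u ++ w.drop (t + 1), (firstAnswer B X v).right, hw', ?_, ?_⟩
  · have h1 := ((Runs.id (x := enc X)).pair (Runs.nil.pair Runs.nil)).comp hr
    have h2 := h1.comp (Runs.comp (Runs.comp Runs.right Runs.right) Runs.right)
    simp only [List.nil_append, List.append_nil] at h2
    refine (show Runs _ (enc X) v (firstAnswer B X v).right _ from h2).mono ?_
    have h3 := hc (X, t)
    simp only [sz_prod, sz_nat, ← hτ] at h3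
    rw [show t + 1 + 1 = t + 2 from rfl]
    omega
  · obtain ⟨j, hj, v', u', hv', hr'⟩ := firstAnswer_spec hne
    exact ⟨j, hj, v', u' ++ (u ++ w.drop (t + 1)), _, _, by rw [← List.append_assoc, ← hv', ← hw'],
      hr', hne, rfl⟩

end Prog

/-! ### Independence of the blocks of a tape -/

namespace Prog

/-- The `j`-th block of length `b` of a tape. -/
def block (b : ℕ) (w : List Bool) (j : ℕ) : List Bool := (w.drop (j * b)).take b

theorem avg_mul_right {L : ℕ} (a : ℝ≥0∞) (Φ : List Bool → ℝ≥0∞) :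
    avg L (fun w => Φ w * a) = avg L Φ * a := by
  simp only [mul_comm _ a, avg_mul_left]

/-- Disjoint blocks of coins are independent; the induction splits off the first block. -/
theorem avg_prod_block (b R : ℕ) (F : ℕ → List Bool → ℝ≥0∞) :
    avg (R * b) (fun w => ∏ j ∈ Finset.range R, F j (block b w j)) =
      ∏ j ∈ Finset.range R, avg b (F j) := by
  induction R generalizing F with
  | zero => simp
  | succ R ih =>
    rw [show (R + 1) * b = b + R * b by ring, avg_append, Finset.prod_range_succ',
      ← ih fun j => F (j + 1), ← avg_mul_left]
    refine avg_congr fun v hv => ?_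
    rw [← avg_mul_right]
    refine avg_congr fun w _ => ?_
    rw [Finset.prod_range_succ']
    have h0 : block b (v ++ w) 0 = v := by
      simp [block, ← hv]
    rw [h0]
    congr 1
    refine Finset.prod_congr rfl fun j _ => ?_
    congr 1
    simp only [block]
    rw [show (j + 1) * b = v.length + j * b by rw [hv]; ring]
    rw [← List.drop_drop, List.drop_left]

end Prog

/-! ### The distribution of random vertices -/

theorem length_deal {β : Type} (l : List β) :
    (deal l).1.length = (l.length + 1) / 2 ∧ (deal l).2.length = l.length / 2 := by
  induction l using List.reverseRecOn with
  | nil => simp [deal]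
  | append_singleton l x ih => rw [deal_append_singleton]; simp; omega

theorem deal_perm {β : Type} (l : List β) : ((deal l).1 ++ (deal l).2).Perm l := by
  induction l using List.reverseRecOn with
  | nil => exact .refl _
  | append_singleton l x ih =>
    rw [deal_append_singleton]
    simp only [List.cons_append]
    refine ((List.perm_append_comm.trans ih).cons x).trans ?_
    exact List.perm_append_comm (l₁ := [x])

theorem halve_eq_self {β : Type} {l : List β} (h : l.length ≤ 1) (b : Bool) : halve l b = l := by
  rcases l with _ | ⟨x, _ | ⟨y, l⟩⟩
  · rfl
  · rfl
  · simp at h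

theorem halve_eq {β : Type} {l : List β} (h : 2 ≤ l.length) (b : Bool) :
    halve l b = if b then (deal l).1 else (deal l).2 := by
  rcases l with _ | ⟨x, _ | ⟨y, l⟩⟩
  · simp at h
  · simp at h
  · rfl

theorem foldl_halve_eq_self {β : Type} {l : List β} (h : l.length ≤ 1) (w : List Bool) :
    w.foldl halve l = l := by
  induction w with
  | nil => rfl
  | cons b w ih => rw [List.foldl_cons, halve_eq_self h, ih]

theorem foldl_halve_subset {β : Type} {l : List β} (hl : l ≠ []) (w : List Bool) :
    w.foldl halve l ≠ [] ∧ w.foldl halve l ⊆ l := by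
  induction w generalizing l with
  | nil => exact ⟨hl, List.Subset.refl _⟩
  | cons b w ih =>
    rw [List.foldl_cons]
    rcases Nat.lt_or_ge l.length 2 with h | h
    · rw [halve_eq_self (by omega)]
      exact ih hl
    · have h1 := length_deal l
      have h2 : halve l b ≠ [] := by
        rw [halve_eq h, ← List.length_pos_iff_ne_nil]
        split_ifs <;> omega
      refine ⟨(ih h2).1, fun x hx => (deal_perm l).subset ?_⟩
      replace hx := (ih h2).2 hx
      rw [halve_eq h] at hx
      split_ifs at hx <;> simp [hx]

theorem headD_foldl_halve_mem {l : List ℕ} (hl : l ≠ []) (w : List Bool) :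
    (w.foldl halve l).headD 0 ∈ l := by
  obtain ⟨h1, h2⟩ := foldl_halve_subset hl w
  cases h : w.foldl halve l with
  | nil => exact absurd h h1
  | cons x s =>
    rw [h] at h2
    exact h2 (by simp)

theorem pick_lt {n : ℕ} (hn : 0 < n) (w : List Bool) : pick n w < n := by
  have := headD_foldl_halve_mem (l := List.range n) (by simp; omega) w
  exact List.mem_range.1 this

namespace Prog

/-- Each coin keeps a given entry with probability at least one half, and after `e` halvings a list
of at most `2 ^ e` entries is down to one. -/
theorem le_avg_halve {e m : ℕ} (hem : e ≤ m) {l : List ℕ} (hl : l.length ≤ 2 ^ e) {x : ℕ}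
    (hx : x ∈ l) :
    (2⁻¹ : ℝ≥0∞) ^ e ≤ avg m (fun w => if (w.foldl halve l).headD 0 = x then 1 else 0) := by
  have short : ∀ {l : List ℕ} (m : ℕ), l.length ≤ 1 → x ∈ l →
      avg m (fun w => if (w.foldl halve l).headD 0 = x then (1 : ℝ≥0∞) else 0) = 1 := by
    intro l m h hx
    rw [← avg_const m 1]
    refine avg_congr fun w _ => ?_
    rw [foldl_halve_eq_self h]
    rcases l with _ | ⟨y, _ | ⟨z, l⟩⟩
    · simp at hx
    · simp at hx
      simp [hx]
    · simp at h
  induction e generalizing m l with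
  | zero => rw [short m (by simpa using hl) hx, pow_zero]
  | succ e ih =>
    rcases Nat.lt_or_ge l.length 2 with h | h
    · rw [short m (by omega) hx]
      exact pow_le_one₀ (by simp) (by simp)
    · obtain ⟨m, rfl⟩ : ∃ m', m = m' + 1 := ⟨m - 1, by omega⟩
      have h1 := length_deal l
      have h2 : x ∈ (deal l).1 ++ (deal l).2 := (deal_perm l).symm.subset hx
      rw [pow_succ] at hl
      simp only [avg, List.foldl_cons, halve_eq h, if_true, Bool.false_eq_true, if_false]
      rw [pow_succ, ENNReal.div_eq_inv_mul, mul_comm]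
      refine mul_le_mul_right ?_ _
      rcases List.mem_append.1 h2 with h2 | h2
      · exact (ih (by omega) (by omega) h2).trans le_self_add
      · exact (ih (by omega) (by omega) h2).trans le_add_self

/-- Without repetitions an entry lies in only one of the two halves, so each genuine halving loses
it with probability one half. A list of at least `2 ^ e` entries allows `e` of them. -/
theorem avg_halve_le {e m : ℕ} (hem : e ≤ m) {l : List ℕ} (hl : 2 ^ e ≤ l.length)
    (hnd : l.Nodup) (x : ℕ) :
    avg m (fun w => if (w.foldl halve l).headD 0 = x then 1 else 0) ≤ (2⁻¹ : ℝ≥0∞) ^ e := by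
  have zero : ∀ {l : List ℕ} (m : ℕ), l ≠ [] → x ∉ l →
      avg m (fun w => if (w.foldl halve l).headD 0 = x then (1 : ℝ≥0∞) else 0) = 0 := by
    intro l m hl hx
    rw [avg_eq_zero_iff]
    intro w _
    rw [if_neg]
    rintro rfl
    exact hx (headD_foldl_halve_mem hl w)
  induction e generalizing m l with
  | zero =>
    rw [pow_zero, ← avg_const m 1]
    exact avg_mono fun w _ => by split_ifs <;> simp
  | succ e ih =>
    obtain ⟨m, rfl⟩ : ∃ m', m = m' + 1 := ⟨m - 1, by omega⟩
    rw [pow_succ] at hl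
    have hpos : 0 < 2 ^ e := by positivity
    have h : 2 ≤ l.length := by omega
    have h1 := length_deal l
    have hnd' := (deal_perm l).nodup_iff.2 hnd
    rw [List.nodup_append] at hnd'
    obtain ⟨hn1, hn2, hdis⟩ := hnd'
    simp only [avg, List.foldl_cons, halve_eq h, if_true, Bool.false_eq_true, if_false]
    rw [pow_succ, ENNReal.div_eq_inv_mul, mul_comm]
    refine mul_le_mul_left ?_ _
    by_cases hx : x ∈ (deal l).1
    · rw [zero m (l := (deal l).2) (by rw [← List.length_pos_iff_ne_nil]; omega)
        fun hx' => hdis x hx x hx' rfl, add_zero]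
      exact ih (by omega) (by omega) hn1
    · rw [zero m (l := (deal l).1) (by rw [← List.length_pos_iff_ne_nil]; omega) hx, zero_add]
      exact ih (by omega) (by omega) hn2

/-- The powers of two next to `n` bound the number of halvings. So `pick` is uniform up to a factor
of two in either direction, which is all the later estimates need. -/
theorem avg_pick_le {n : ℕ} (hn : 0 < n) (x : ℕ) :
    avg n (fun w => if pick n w = x then 1 else 0) ≤ 2 / n := by
  have h1 := Nat.pow_log_le_self 2 hn.ne'
  have h2 := Nat.lt_pow_succ_log_self (b := 2) (by norm_num) n
  refine (avg_halve_le (e := Nat.log 2 n) (m := n) (Nat.log_le_self 2 n) (l := List.range n)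
    (by simpa using h1) List.nodup_range x).trans ?_
  rw [ENNReal.le_div_iff_mul_le (by simp [hn.ne']) (by simp), ← ENNReal.inv_pow,
    ← ENNReal.div_eq_inv_mul]
  refine ENNReal.div_le_of_le_mul ?_
  rw [← pow_succ']
  exact_mod_cast h2.le

theorem le_avg_pick {n : ℕ} (x : ℕ) (hx : x < n) :
    1 / (2 * n) ≤ avg n (fun w => if pick n w = x then 1 else 0) := by
  have hn : 0 < n := by omega
  have h1 := Nat.pow_log_le_self 2 hn.ne'
  have h2 := Nat.lt_pow_succ_log_self (b := 2) (by norm_num) n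
  rcases Nat.lt_or_ge n 2 with h | h
  · obtain rfl : n = 1 := by omega
    obtain rfl : x = 0 := by omega
    simp [avg, pick, halve, ENNReal.div_self, one_add_one_eq_two]
  have h3 : Nat.log 2 n < n := Nat.log_lt_self 2 (by omega)
  refine le_trans ?_ (le_avg_halve (e := Nat.log 2 n + 1) (m := n) h3 (l := List.range n)
    (by simpa using h2.le) (by simpa using hx))
  rw [← ENNReal.inv_pow, one_div]
  refine ENNReal.inv_le_inv.2 ?_
  rw [pow_succ']
  exact_mod_cast Nat.mul_le_mul_left 2 h1

open Classical in
theorem avg_pick_mem {n : ℕ} [NeZero n] (U : Finset (Fin n)) :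
    avg n (fun w => if Fin.ofNat n (pick n w) ∈ U then 1 else 0) =
      ∑ x ∈ U, avg n (fun w => if pick n w = x then 1 else 0) := by
  rw [← avg_sum]
  refine avg_congr fun w _ => ?_
  have h : ∀ x : Fin n, pick n w = x ↔ Fin.ofNat n (pick n w) = x := by
    intro x
    rw [Fin.ext_iff, Fin.val_ofNat, Nat.mod_eq_of_lt (pick_lt (NeZero.pos n) w)]
  simp only [h]
  simp

open Classical in
theorem avg_pick_mem_le {n : ℕ} [NeZero n] (U : Finset (Fin n)) :
    avg n (fun w => if Fin.ofNat n (pick n w) ∈ U then 1 else 0) ≤ U.card * (2 / n) := by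
  rw [avg_pick_mem, ← nsmul_eq_mul]
  exact Finset.sum_le_card_nsmul _ _ _ fun x _ => avg_pick_le (NeZero.pos n) x

open Classical in
theorem le_avg_pick_mem {n : ℕ} [NeZero n] (U : Finset (Fin n)) :
    U.card * (1 / (2 * n)) ≤ avg n (fun w => if Fin.ofNat n (pick n w) ∈ U then 1 else 0) := by
  rw [avg_pick_mem, ← nsmul_eq_mul]
  exact Finset.card_nsmul_le_sum _ _ _ fun x _ => le_avg_pick x x.2

end Prog

/-! ### Random graphs -/

/-- Graphs embed into the relations on a finite type via their adjacency, and finite sets of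
relations are measurable. Measurability is thereby trivial in all integrals over graphs. -/
instance SimpleGraph.instDiscreteMeasurableSpaceFin (n : ℕ) :
    DiscreteMeasurableSpace (SimpleGraph (Fin n)) where
  forall_measurableSet s := by
    refine ⟨SimpleGraph.Adj '' s, (Set.toFinite _).measurableSet, ?_⟩
    exact Set.preimage_image_eq _ SimpleGraph.adj_injective

instance (n : ℕ) : IsProbabilityMeasure (erdosRenyiHalf n) := by
  unfold erdosRenyiHalf
  infer_instance

/-- A random graph contains a given set of edges with probability `2 ^ (-m)`. -/
theorem erdosRenyiHalf_superset {n : ℕ} (E : Finset (Sym2 (Fin n))) (hE : ∀ e ∈ E, ¬ e.IsDiag) :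
    erdosRenyiHalf n {G | ∀ e ∈ E, e ∈ G.edgeSet} = (2⁻¹ : ℝ≥0∞) ^ E.card := by
  -- The event is a cylinder: only the coordinates in `E` are prescribed. Loops, which `fromEdgeSet`
  -- would discard, do not occur in `E`.
  have h1 : ((fun p : Sym2 (Fin n) → Prop => {e | p e}) ⁻¹'
      (SimpleGraph.fromEdgeSet ⁻¹' {G | ∀ e ∈ E, e ∈ G.edgeSet})) =
      Set.pi E fun _ => {True} := by
    ext p
    simp only [Set.mem_preimage, Set.mem_ofPred_eq, SimpleGraph.edgeSet_fromEdgeSet, Set.mem_pi,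
      Set.mem_singleton_iff, Finset.mem_coe]
    refine forall₂_congr fun e he => ?_
    simp [hE e he]
  rw [erdosRenyiHalf, SimpleGraph.binomialRandom_eq_map, Measure.map_apply
    SimpleGraph.measurable_fromEdgeSet (.of_discrete), ProbabilityTheory.setBernoulli_apply', h1,
    Measure.infinitePi_pi _ fun _ _ => MeasurableSet.of_discrete, ← Finset.prod_const]
  refine Finset.prod_congr rfl fun e he => ?_
  have h2 : (unitInterval.toNNReal ⟨1 / 2, by norm_num, by norm_num⟩ : ℝ≥0∞) = 2⁻¹ := by
    rw [← ENNReal.coe_two, ← ENNReal.coe_inv two_ne_zero, ENNReal.coe_inj]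
    ext
    simp
  simpa [hE e he] using h2

theorem lintegral_avg {n L : ℕ} (μ : Measure (SimpleGraph (Fin n)))
    (Φ : SimpleGraph (Fin n) → List Bool → ℝ≥0∞) :
    ∫⁻ G, Prog.avg L (Φ G) ∂μ = Prog.avg L (fun w => ∫⁻ G, Φ G w ∂μ) := by
  induction L generalizing Φ with
  | zero => rfl
  | succ L ih =>
    simp only [Prog.avg, ENNReal.div_eq_inv_mul]
    rw [lintegral_const_mul _ .of_discrete, lintegral_add_left .of_discrete, ih, ih]

/-! ### Random tuples -/

/-- The vertices in the `j`-th tuple. -/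
def tupleSet {n : ℕ} (l : ℕ) (S : ℕ → Fin n) (j : ℕ) : Finset (Fin n) :=
  (Finset.range l).image fun a => S (j * l + a)

/-- The sequence of random vertices determined by a tape. -/
def seqOf (n : ℕ) [NeZero n] (w : List Bool) (q : ℕ) : Fin n := Fin.ofNat n (pick n (Prog.block n w q))

/-- The `j`-th tuple is read off the `j`-th block of `l * n` coins, so that distinct tuples are
independent by `Prog.avg_prod_block`. -/
theorem tupleSet_seqOf {n l : ℕ} [NeZero n] (w : List Bool) (j : ℕ) :
    tupleSet l (seqOf n w) j = tupleSet l (seqOf n (Prog.block (l * n) w j)) 0 := by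
  refine Finset.image_congr fun a ha => ?_
  have ha : a < l := by simpa using ha
  simp only [seqOf]
  congr 2
  simp only [Prog.block, Nat.zero_mul, Nat.zero_add, List.drop_take, List.drop_drop]
  rw [List.take_take, min_eq_left]
  · congr 2
    ring
  · have : (a + 1) * n ≤ l * n := Nat.mul_le_mul_right _ ha
    rw [Nat.add_mul] at this
    omega

open Classical in
theorem avg_tupleSet_subset {n : ℕ} [NeZero n] (l : ℕ) (U : Finset (Fin n)) :
    Prog.avg (l * n) (fun v => if tupleSet l (seqOf n v) 0 ⊆ U then 1 else 0) =
      (Prog.avg n fun w => if Fin.ofNat n (pick n w) ∈ U then 1 else 0) ^ l := by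
  rw [← Finset.card_range l, ← Finset.prod_const, Finset.card_range, ← Prog.avg_prod_block]
  refine Prog.avg_congr fun v _ => ?_
  rw [Finset.prod_ite_zero, Finset.prod_const_one]
  simp [tupleSet, Finset.image_subset_iff, seqOf]

/-- Any `r` tuples have together more than `u` vertices. -/
def Spread {n : ℕ} (N l r u : ℕ) (S : ℕ → Fin n) : Prop :=
  ∀ J ∈ (Finset.range N).powersetCard r, u < (J.biUnion (tupleSet l S)).card

-- Union bound over the sets `J` of `r` tuples and the sets `U` of `u` vertices that might contain
-- them all. Each of the `l * r` random vertices concerned lies in `U` with probability at most `2 *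
-- u / n`.
open Classical in
theorem avg_not_spread_le {n : ℕ} [NeZero n] (N l r : ℕ) {u : ℕ} (hu : u ≤ n) :
    Prog.avg (N * l * n) (fun w => if Spread N l r u (seqOf n w) then 0 else 1) ≤
      N ^ r * (n ^ u * (u * (2 / n)) ^ (l * r)) := by
  have h1 : ∀ J ∈ (Finset.range N).powersetCard r, ∀ U ∈ (Finset.univ : Finset (Fin n)).powersetCard u,
      Prog.avg (N * l * n) (fun w => ∏ j ∈ Finset.range N,
        if j ∈ J then if tupleSet l (seqOf n (Prog.block (l * n) w j)) 0 ⊆ U then 1 else 0 else 1) ≤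
        ((u : ℝ≥0∞) * (2 / n)) ^ (l * r) := by
    intro J hJ U hU
    rw [Finset.mem_powersetCard] at hJ hU
    rw [Nat.mul_assoc, Prog.avg_prod_block (l * n) N fun j v =>
      if j ∈ J then if tupleSet l (seqOf n v) 0 ⊆ U then 1 else 0 else 1]
    have h2 : ∀ j ∈ Finset.range N, Prog.avg (l * n) (fun v =>
        if j ∈ J then if tupleSet l (seqOf n v) 0 ⊆ U then 1 else 0 else 1) ≤
        if j ∈ J then ((u : ℝ≥0∞) * (2 / n)) ^ l else 1 := by
      intro j _
      split_ifs with hj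
      · rw [avg_tupleSet_subset, ← hU.2]
        exact pow_le_pow_left₀ (by simp) (Prog.avg_pick_mem_le U) l
      · simp
    refine (Finset.prod_le_prod' h2).trans ?_
    rw [Finset.prod_ite_mem, Finset.inter_eq_right.2 hJ.1, Finset.prod_const, hJ.2, pow_mul]
  calc Prog.avg (N * l * n) (fun w => if Spread N l r u (seqOf n w) then 0 else 1)
      ≤ Prog.avg (N * l * n) (fun w => ∑ J ∈ (Finset.range N).powersetCard r,
          ∑ U ∈ (Finset.univ : Finset (Fin n)).powersetCard u, ∏ j ∈ Finset.range N,
          if j ∈ J then if tupleSet l (seqOf n (Prog.block (l * n) w j)) 0 ⊆ U then 1 else 0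
          else 1) := by
        refine Prog.avg_mono fun w _ => ?_
        split_ifs with h
        · simp
        · simp only [Spread, not_forall, not_lt] at h
          obtain ⟨J, hJ, hc⟩ := h
          obtain ⟨U, hU, hUc⟩ := Finset.exists_superset_card_eq hc (by simpa using hu)
          refine le_trans ?_ (Finset.single_le_sum (fun _ _ => by simp) hJ)
          refine le_trans ?_ (Finset.single_le_sum (fun _ _ => by simp)
            (Finset.mem_powersetCard.2 ⟨Finset.subset_univ U, hUc⟩))
          refine le_of_eq (Finset.prod_eq_one fun j _ => ?_).symm
          split_ifs with h2 h3
          · rfl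
          · refine absurd ?_ h3
            rw [← tupleSet_seqOf]
            exact (Finset.subset_biUnion_of_mem _ h2).trans hU
          · rfl
    _ = ∑ J ∈ (Finset.range N).powersetCard r,
          ∑ U ∈ (Finset.univ : Finset (Fin n)).powersetCard u,
          Prog.avg (N * l * n) (fun w => ∏ j ∈ Finset.range N,
          if j ∈ J then if tupleSet l (seqOf n (Prog.block (l * n) w j)) 0 ⊆ U then 1 else 0
          else 1) := by
        rw [Prog.avg_sum]
        exact Finset.sum_congr rfl fun J _ => Prog.avg_sum _ _
    _ ≤ ∑ J ∈ (Finset.range N).powersetCard r,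
          ∑ U ∈ (Finset.univ : Finset (Fin n)).powersetCard u, ((u : ℝ≥0∞) * (2 / n)) ^ (l * r) :=
        Finset.sum_le_sum fun J hJ => Finset.sum_le_sum fun U hU => h1 J hJ U hU
    _ = (N.choose r : ℝ≥0∞) * ((n.choose u : ℝ≥0∞) * (u * (2 / n)) ^ (l * r)) := by
        simp [Finset.card_powersetCard]
    _ ≤ _ := by
        gcongr
        · exact_mod_cast Nat.choose_le_pow N r
        · exact_mod_cast Nat.choose_le_pow n u

/-! ### Patterns in random graphs -/

/-- The denser one of a pattern and its complement. -/
noncomputable def densePattern {k : ℕ} (P : SimpleGraph (Fin k)) : SimpleGraph (Fin k) :=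
  open Classical in if k * k < 2 * numAdj P then P else Pᶜ

/-- Induced containment is invariant under complementing both graphs, and `instGraph` is
complemented exactly when `densePattern` is. So only dense patterns have to be analysed. -/
theorem isIndContained_instGraph_iff {k n : ℕ} [NeZero k] {P : SimpleGraph (Fin k)}
    {G : SimpleGraph (Fin n)} {N l : ℕ} {S : ℕ → Fin n} :
    P.IsIndContained (instGraph P G N l S) ↔
      (densePattern P).IsIndContained (tupleGraph (densePattern P) G N l S) := by
  unfold instGraph densePattern
  split_ifs
  · rfl
  · rw [← SimpleGraph.compl_isIndContained_compl, compl_compl]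

theorem numAdj_add_compl {k : ℕ} (P : SimpleGraph (Fin k)) :
    numAdj P + numAdj Pᶜ + k = k * k := by
  classical
  have h : (Finset.univ : Finset (Fin k × Fin k)) =
      ((Finset.univ.filter fun e => P.Adj e.1 e.2) ∪ Finset.univ.filter fun e => Pᶜ.Adj e.1 e.2) ∪
        Finset.univ.image fun a => (a, a) := by
    ext ⟨a, b⟩
    by_cases h : a = b
    · simp [h]
    · simp [SimpleGraph.compl_adj, h, em]
  have h2 := congrArg Finset.card h
  rw [Finset.card_union_of_disjoint, Finset.card_union_of_disjoint,
    Finset.card_image_of_injective _ fun a b h => (Prod.ext_iff.1 h).1] at h2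
  · simp only [Finset.card_univ, Fintype.card_prod, Fintype.card_fin] at h2
    unfold numAdj
    convert h2.symm
  · rw [Finset.disjoint_left]
    rintro ⟨a, b⟩ h
    simp only [Finset.mem_filter] at h
    simp [SimpleGraph.compl_adj, h.2]
  · rw [Finset.disjoint_right]
    rintro ⟨a, b⟩ h
    simp only [Finset.mem_image, Finset.mem_univ, Prod.mk.injEq, true_and] at h
    obtain ⟨c, rfl, rfl⟩ := h
    simp

/-- If `P` has at most half of all ordered pairs, its complement has at least `k * k / 2 - k` of
them, which is a quarter or more as `4 ≤ k`. -/
theorem le_numAdj_densePattern {k : ℕ} (hk : 4 ≤ k) (P : SimpleGraph (Fin k)) :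
    k * k ≤ 4 * numAdj (densePattern P) := by
  have h := numAdj_add_compl P
  have h2 : 4 * k ≤ k * k := Nat.mul_le_mul_right k hk
  unfold densePattern
  split_ifs <;> omega

-- Counting by degrees: with fewer than `r` vertices of degree at least `r` there would be fewer
-- than `r * k + k * r ≤ k * k / 4` ordered adjacent pairs.
open Classical in
theorem card_highDegree {k r : ℕ} (hr : 8 * r ≤ k) {D : SimpleGraph (Fin k)}
    (hD : k * k ≤ 4 * numAdj D) :
    r ≤ (Finset.univ.filter fun a => r ≤ (Finset.univ.filter fun b => D.Adj a b).card).card := by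
  set W := Finset.univ.filter fun a => r ≤ (Finset.univ.filter fun b => D.Adj a b).card with hW
  have h1 : numAdj D = ∑ a, (Finset.univ.filter fun b => D.Adj a b).card := by
    rw [numAdj, Finset.card_filter, Fintype.sum_prod_type]
    exact Finset.sum_congr rfl fun a _ => (Finset.card_filter _ _).symm
  have h2 : numAdj D ≤ ∑ a, ((if a ∈ W then k else 0) + r) := by
    rw [h1]
    refine Finset.sum_le_sum fun a _ => ?_
    have h3 := Finset.card_le_univ (Finset.univ.filter fun b => D.Adj a b)
    rw [Fintype.card_fin] at h3
    split_ifs with h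
    · omega
    · simp [hW] at h
      omega
  rw [Finset.sum_add_distrib, Finset.sum_ite_mem, Finset.univ_inter, Finset.sum_const,
    Finset.sum_const, Finset.card_univ, Fintype.card_fin, smul_eq_mul, smul_eq_mul] at h2
  by_contra hlt
  rw [not_le] at hlt
  have hk : 0 < k := by omega
  nlinarith [Nat.mul_le_mul_right k (Nat.succ_le_of_lt hlt), Nat.mul_le_mul_right k hr]

/-- At least `r` vertices of `D` have degree at least `r`, so by `Spread` more than `u` vertices `x`
of the host lie in their tuples. The tuples of the neighbours again have more than `u` vertices in
total, and `x` must be adjacent to all of these except possibly itself. Overlaps between tuples are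
harmless, as `x = y` is the only exemption. The set `E` depends on `φ` and `S` but not on `G`, as
the union bound requires. -/
theorem exists_forced_edges {k n N l r u : ℕ} (hr : 8 * r ≤ k) {D : SimpleGraph (Fin k)}
    (hD : k * k ≤ 4 * numAdj D) {S : ℕ → Fin n} (hS : Spread N l r u S) (φ : Fin k ↪ Fin N) :
    ∃ E : Finset (Sym2 (Fin n)), (∀ e ∈ E, ¬ e.IsDiag) ∧ u * (u + 1) ≤ 2 * E.card ∧
      ∀ G : SimpleGraph (Fin n), (∀ a b, D.Adj a b → ∀ x ∈ tupleSet l S (φ a),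
        ∀ y ∈ tupleSet l S (φ b), x = y ∨ G.Adj x y) → ∀ e ∈ E, e ∈ G.edgeSet := by
  classical
  have hspread : ∀ Z : Finset (Fin k), r ≤ Z.card →
      u < (Z.biUnion fun a => tupleSet l S (φ a)).card := by
    intro Z hZ
    obtain ⟨Z', hZ', hc⟩ := Finset.exists_subset_card_eq hZ
    have h1 := hS (Z'.image fun a => (φ a : ℕ)) (Finset.mem_powersetCard.2 ⟨by
      intro x hx
      simp only [Finset.mem_image] at hx
      obtain ⟨a, _, rfl⟩ := hx
      simp, by
      rw [Finset.card_image_of_injective _ fun a b h => φ.injective (Fin.ext h), hc]⟩)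
    rw [Finset.image_biUnion] at h1
    exact h1.trans_le (Finset.card_le_card (Finset.biUnion_subset_biUnion_of_subset_left _ hZ'))
  set R : Fin n → Fin n → Prop := fun x y => x ≠ y ∧
    ∃ a b, D.Adj a b ∧ x ∈ tupleSet l S (φ a) ∧ y ∈ tupleSet l S (φ b) with hR
  set F := (Finset.univ : Finset (Fin n × Fin n)).filter fun p => R p.1 p.2 with hF
  refine ⟨F.image fun p => s(p.1, p.2), ?_, ?_, ?_⟩
  · intro e he
    simp only [Finset.mem_image, hF, Finset.mem_filter] at he
    obtain ⟨p, hp, rfl⟩ := he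
    exact hp.2.1
  · have h1 : F.card ≤ 2 * (F.image fun p => s(p.1, p.2)).card := by
      refine Finset.card_le_mul_card_image _ _ fun e he => ?_
      simp only [Finset.mem_image] at he
      obtain ⟨p, _, rfl⟩ := he
      refine (Finset.card_le_card (t := {p, p.swap}) fun q hq => ?_).trans Finset.card_le_two
      simp only [Finset.mem_filter, Sym2.eq_iff] at hq
      simp only [Finset.mem_insert, Finset.mem_singleton, Prod.ext_iff, Prod.fst_swap,
        Prod.snd_swap]
      exact hq.2
    refine le_trans ?_ h1
    set W := Finset.univ.filter fun a => r ≤ (Finset.univ.filter fun b => D.Adj a b).card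
    have h2 := hspread W (card_highDegree hr hD)
    have h3 : F.card = ∑ x, (Finset.univ.filter fun y => R x y).card := by
      rw [hF, Finset.card_filter, Fintype.sum_prod_type]
      exact Finset.sum_congr rfl fun a _ => (Finset.card_filter _ _).symm
    rw [h3]
    calc u * (u + 1) ≤ (W.biUnion fun a => tupleSet l S (φ a)).card * u := by
          rw [mul_comm]
          exact Nat.mul_le_mul_right _ h2
      _ ≤ ∑ x ∈ W.biUnion fun a => tupleSet l S (φ a), (Finset.univ.filter fun y => R x y).card := by
          rw [← smul_eq_mul]
          refine Finset.card_nsmul_le_sum _ _ _ fun x hx => ?_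
          simp only [Finset.mem_biUnion] at hx
          obtain ⟨a, ha, hx⟩ := hx
          have h4 := hspread _ (Finset.mem_filter.1 ha).2
          -- Discarding `x` itself turns "more than `u`" into "at least `u`".
          have h5 := Finset.pred_card_le_card_erase (a := x)
            (s := (Finset.univ.filter fun b => D.Adj a b).biUnion fun a => tupleSet l S (φ a))
          refine le_trans (by omega) (h5.trans (Finset.card_le_card fun y hy => ?_))
          simp only [Finset.mem_erase, Finset.mem_biUnion, Finset.mem_filter, Finset.mem_univ,
            true_and] at hy
          obtain ⟨hy1, b, hb, hy2⟩ := hy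
          simp only [Finset.mem_filter, Finset.mem_univ, true_and]
          exact ⟨Ne.symm hy1, a, b, hb, hx, hy2⟩
      _ ≤ _ := Finset.sum_le_sum_of_subset (Finset.subset_univ _)
  · intro G hG e he
    simp only [Finset.mem_image, hF, Finset.mem_filter] at he
    obtain ⟨p, ⟨_, hp, a, b, hab, hx, hy⟩, rfl⟩ := he
    exact (hG a b hab _ hx _ hy).resolve_left hp

theorem tupleGraph_adj_iff {k n : ℕ} [NeZero k] {P : SimpleGraph (Fin k)} {G : SimpleGraph (Fin n)}
    {N l : ℕ} {S : ℕ → Fin n} {i j : Fin N} : (tupleGraph P G N l S).Adj i j ↔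
      P.Adj (Fin.ofNat k i) (Fin.ofNat k j) ∧ ∀ x ∈ tupleSet l S i, ∀ y ∈ tupleSet l S j,
        x = y ∨ G.Adj x y := by
  simp [tupleGraph, tupleSet]

/-- Union bound over the at most `N ^ k` injections `φ`, which need not respect colours. With the
tuples fixed, each injection requires a fixed set of at least `m` edges. -/
theorem erdosRenyiHalf_isIndContained_le {k n N l r u m : ℕ} [NeZero k] (hk : 4 ≤ k)
    (hr : 8 * r ≤ k) (hm : 2 * m ≤ u * (u + 1)) (P : SimpleGraph (Fin k)) {S : ℕ → Fin n}
    (hS : Spread N l r u S) :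
    erdosRenyiHalf n {G | P.IsIndContained (instGraph P G N l S)} ≤ N ^ k * 2⁻¹ ^ m := by
  classical
  have hD := le_numAdj_densePattern hk P
  choose E hE1 hE2 hE3 using fun φ : Fin k ↪ Fin N => exists_forced_edges hr hD hS φ
  calc erdosRenyiHalf n {G | P.IsIndContained (instGraph P G N l S)}
      ≤ erdosRenyiHalf n (⋃ φ ∈ (Finset.univ : Finset (Fin k ↪ Fin N)),
          {G | ∀ e ∈ E φ, e ∈ G.edgeSet}) := by
        refine measure_mono fun G hG => ?_
        obtain ⟨φ⟩ := isIndContained_instGraph_iff.1 hG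
        simp only [Set.mem_iUnion]
        refine ⟨φ.toEmbedding, Finset.mem_univ _, hE3 _ G fun a b hab => ?_⟩
        exact (tupleGraph_adj_iff.1 (φ.map_adj_iff.2 hab)).2
    _ ≤ ∑ φ : Fin k ↪ Fin N, erdosRenyiHalf n {G | ∀ e ∈ E φ, e ∈ G.edgeSet} :=
        measure_biUnion_finset_le _ _
    _ ≤ ∑ φ : Fin k ↪ Fin N, 2⁻¹ ^ m := by
        refine Finset.sum_le_sum fun φ _ => ?_
        rw [erdosRenyiHalf_superset _ (hE1 φ)]
        refine pow_le_pow_of_le_one (by simp) (by simp) ?_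
        have := hE2 φ
        omega
    _ ≤ _ := by
        rw [Finset.sum_const, nsmul_eq_mul, Finset.card_univ, Fintype.card_embedding_eq,
          Fintype.card_fin, Fintype.card_fin]
        gcongr
        exact_mod_cast Nat.descFactorial_le_pow N k

open Classical in
/-- The probability that the reduction produces a yes-instance from a random graph. -/
theorem lintegral_avg_isIndContained_le {k n N l r u m : ℕ} [NeZero k] [NeZero n] (hk : 4 ≤ k)
    (hr : 8 * r ≤ k) (hm : 2 * m ≤ u * (u + 1)) (hu : u ≤ n) (P : SimpleGraph (Fin k)) :
    ∫⁻ G, Prog.avg (N * l * n) (fun w =>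
      if P.IsIndContained (instGraph P G N l (seqOf n w)) then 1 else 0) ∂(erdosRenyiHalf n) ≤
      N ^ r * (n ^ u * (u * (2 / n)) ^ (l * r)) + N ^ k * 2⁻¹ ^ m := by
  rw [lintegral_avg]
  calc _ ≤ Prog.avg (N * l * n) (fun w => (if Spread N l r u (seqOf n w) then 0 else 1) +
        (N : ℝ≥0∞) ^ k * 2⁻¹ ^ m) := by
        refine Prog.avg_mono fun w _ => ?_
        have h1 : ∫⁻ G, (if P.IsIndContained (instGraph P G N l (seqOf n w)) then 1 else 0)
            ∂(erdosRenyiHalf n) =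
            erdosRenyiHalf n {G | P.IsIndContained (instGraph P G N l (seqOf n w))} := by
          rw [← lintegral_indicator_one .of_discrete]
          rfl
        rw [h1]
        split_ifs with h
        · rw [zero_add]
          exact erdosRenyiHalf_isIndContained_le hk hr hm P h
        · exact prob_le_one.trans le_self_add
    _ ≤ _ := by
        rw [Prog.avg_add, Prog.avg_const]
        gcongr
        exact avg_not_spread_le N l r hu

/-! ### Patterns in graphs with planted cliques -/

/-- Inside the clique the condition on the vertices of two tuples holds automatically, so one tuple
per colour reproduces the dense pattern, non-edges included. -/
theorem isIndContained_instGraph_of_clique {k n M l : ℕ} [NeZero k] (P : SimpleGraph (Fin k))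
    (G : SimpleGraph (Fin n)) (K : Finset (Fin n)) (S : ℕ → Fin n)
    (h : ∀ c < k, ∃ m < M, tupleSet l S (m * k + c) ⊆ K) :
    P.IsIndContained (instGraph P (G ⊔ cliqueOn K) (M * k) l S) := by
  rw [isIndContained_instGraph_iff]
  choose m hm hK using fun c : Fin k => h c c.2
  have hlt : ∀ c : Fin k, m c * k + c < M * k := fun c => by
    have : (m c + 1) * k ≤ M * k := Nat.mul_le_mul_right _ (hm c)
    rw [Nat.add_mul] at this
    omega
  have hmod : ∀ c : Fin k, Fin.ofNat k (m c * k + c) = c := fun c => by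
    ext
    simp [Nat.mod_eq_of_lt c.2]
  refine ⟨⟨⟨fun c => ⟨m c * k + c, hlt c⟩, fun a b hab => ?_⟩, fun {a b} => ?_⟩⟩
  · rw [← hmod a, ← hmod b]
    simp only [Fin.mk.injEq] at hab
    rw [hab]
  · refine tupleGraph_adj_iff.trans ?_
    change (densePattern P).Adj (Fin.ofNat k (m a * k + a)) (Fin.ofNat k (m b * k + b)) ∧ _ ↔ _
    rw [hmod, hmod]
    refine and_iff_left_of_imp fun _ x hx y hy => or_iff_not_imp_left.2 fun hxy => Or.inr ?_
    rw [cliqueOn, SimpleGraph.fromRel_adj]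
    exact ⟨hxy, Or.inl ⟨hK a hx, hK b hy⟩⟩

open Classical in
/-- The probability that the reduction produces a no-instance from a graph with a planted clique. -/
theorem avg_not_isIndContained_le {k n M l : ℕ} [NeZero k] [NeZero n] (P : SimpleGraph (Fin k))
    (G : SimpleGraph (Fin n)) (K : Finset (Fin n)) :
    Prog.avg (M * k * l * n) (fun w => if P.IsIndContained
      (instGraph P (G ⊔ cliqueOn K) (M * k) l (seqOf n w)) then 0 else 1) ≤
      k * (1 - (K.card * (1 / (2 * n))) ^ l) ^ M := by
  set F : ℕ → List Bool → ℝ≥0∞ := fun c v =>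
    if tupleSet l (seqOf n v) 0 ⊆ K then 0 else 1 with hF
  have hF1 : ∀ c, Prog.avg (l * n) (F c) ≤ 1 - (K.card * (1 / (2 * n))) ^ l := by
    intro c
    have h1 : Prog.avg (l * n) (F c) +
        Prog.avg (l * n) (fun v => if tupleSet l (seqOf n v) 0 ⊆ K then 1 else 0) = 1 := by
      rw [← Prog.avg_add, ← Prog.avg_const (l * n) 1]
      exact Prog.avg_congr fun v _ => by simp only [hF]; split_ifs <;> simp
    refine ENNReal.le_sub_of_add_le_right ?_ ?_
    · exact ENNReal.pow_ne_top (ENNReal.mul_ne_top (by simp) (by simp [NeZero.ne n]))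
    · refine le_trans ?_ h1.le
      rw [avg_tupleSet_subset]
      exact add_le_add_right (pow_le_pow_left₀ (by simp) (Prog.le_avg_pick_mem K) l) _
  -- Failure means that for some colour `c` none of the tuples `j` with `j % k = c` lies in `K`.
  -- This is a union bound over `c`, followed by independence over `j`.
  calc _ ≤ Prog.avg (M * k * l * n) (fun w => ∑ c ∈ Finset.range k,
          ∏ j ∈ Finset.range (M * k), if j % k = c then F c (Prog.block (l * n) w j) else 1) := by
        refine Prog.avg_mono fun w _ => ?_
        split_ifs with h
        · simp
        · have h1 : ¬ ∀ c < k, ∃ m < M, tupleSet l (seqOf n w) (m * k + c) ⊆ K :=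
            fun h' => h (isIndContained_instGraph_of_clique P G K _ h')
          push Not at h1
          obtain ⟨c, hc, h1⟩ := h1
          refine le_trans ?_ (Finset.single_le_sum (fun _ _ => by simp) (Finset.mem_range.2 hc))
          refine le_of_eq (Finset.prod_eq_one fun j hj => ?_).symm
          split_ifs with h2
          · have h3 := h1 (j / k) (Nat.div_lt_of_lt_mul (by
              rw [mul_comm]; exact Finset.mem_range.1 hj))
            rw [← h2, Nat.div_add_mod', tupleSet_seqOf] at h3
            simp [hF, h3]
          · rfl
    _ = ∑ c ∈ Finset.range k, ∏ j ∈ Finset.range (M * k),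
          if j % k = c then Prog.avg (l * n) (F c) else 1 := by
        rw [Prog.avg_sum]
        refine Finset.sum_congr rfl fun c _ => ?_
        rw [Nat.mul_assoc (M * k), Prog.avg_prod_block (l * n) (M * k)
          fun j v => if j % k = c then F c v else 1]
        refine Finset.prod_congr rfl fun j _ => ?_
        split_ifs <;> simp
    _ ≤ ∑ c ∈ Finset.range k, (1 - ((K.card : ℝ≥0∞) * (1 / (2 * n))) ^ l) ^ M := by
        refine Finset.sum_le_sum fun c hc => ?_
        have hc := Finset.mem_range.1 hc
        rw [Finset.prod_ite, Finset.prod_const_one, mul_one, Finset.prod_const]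
        have h1 : ((Finset.range (M * k)).filter fun j => j % k = c).card = M := by
          have h2 : ((Finset.range (M * k)).filter fun j => j % k = c) =
              (Finset.range M).image fun m => m * k + c := by
            ext j
            simp only [Finset.mem_filter, Finset.mem_range, Finset.mem_image]
            constructor
            · rintro ⟨h3, h4⟩
              exact ⟨j / k, Nat.div_lt_of_lt_mul (by rwa [mul_comm]), by
                rw [← h4, Nat.div_add_mod']⟩
            · rintro ⟨m, hm, rfl⟩
              have : (m + 1) * k ≤ M * k := Nat.mul_le_mul_right _ hm
              rw [Nat.add_mul] at this
              exact ⟨by omega, by simp [Nat.mod_eq_of_lt hc]⟩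
          rw [h2, Finset.card_image_of_injective, Finset.card_range]
          intro a b hab
          exact Nat.eq_of_mul_eq_mul_right (NeZero.pos k) (Nat.add_right_cancel hab)
        rw [h1]
        exact pow_le_pow_left₀ (by simp) (hF1 c) M
    _ = _ := by simp

/-! ### The choice of the parameters -/

theorem ENNReal.natCast_div_le_one_div {X Y Z : ℕ} (hY : Y ≠ 0) (hZ : Z ≠ 0) (h : X * Z ≤ Y) :
    (X : ℝ≥0∞) / Y ≤ 1 / Z := by
  rw [ENNReal.div_le_iff (by simpa using hY) (by simp), one_div, ← ENNReal.div_eq_inv_mul,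
    ENNReal.le_div_iff_mul_le (by simp [hZ]) (by simp)]
  exact_mod_cast h

theorem le_ellOf (C k n : ℕ) : C ≤ ellOf C k n := Nat.le_mul_of_pos_right _ (Nat.succ_pos _)

theorem mul_ellOf_le {C k n : ℕ} (hk : k ≤ Nat.log 2 n) : k * ellOf C k n ≤ C * (2 * Nat.log 2 n) := by
  have := Nat.mul_div_le (Nat.log 2 n) k
  calc k * ellOf C k n = C * (k * (Nat.log 2 n / k) + k) := by unfold ellOf; ring
    _ ≤ _ := Nat.mul_le_mul_left _ (by omega)

theorem le_mul_ellOf {C k n : ℕ} (hk : 0 < k) : C * Nat.log 2 n ≤ k * ellOf C k n := by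
  have := Nat.lt_mul_div_succ (Nat.log 2 n) hk
  calc _ ≤ C * (k * (Nat.log 2 n / k + 1)) := Nat.mul_le_mul_left _ this.le
    _ = _ := by unfold ellOf; ring

/-- With `e = ellOf C k n`, `r = k / 8` and `u = r * e`, the powers of `n` combine to the exponent
`2 * (d - 1) * u + u - 2 * d * u = -u`. What remains, `k ^ r * (2 * u) ^ (2 * d * u)`, is at most
the `u`-th power of a polynomial in `log n` that `hn` bounds by the square root of `n`. So at most
`n ^ (-u / 2)` is left, and `u ≥ 4`. -/
theorem spread_bound {d C k n : ℕ} (hd : 1 ≤ d) (hC : 4 ≤ C) (hk : 16 ≤ k) (hkn : k ≤ Nat.log 2 n)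
    (hn : (Nat.log 2 n * (C * Nat.log 2 n) ^ (2 * d)) ^ 2 ≤ n) :
    k / 8 * ellOf C k n ≤ n ∧ ((numTuples d C k n * k : ℕ) : ℝ≥0∞) ^ (k / 8) *
      (n ^ (k / 8 * ellOf C k n) * (((k / 8 * ellOf C k n : ℕ) : ℝ≥0∞) * (2 / n)) ^
        (tupleLen d C k n * (k / 8))) ≤ 1 / (n ^ 2 : ℕ) := by
  set L := Nat.log 2 n with hL
  set e := ellOf C k n with he
  set r := k / 8 with hr
  set u := r * e with hu
  have hn0 : 0 < n := by
    by_contra h0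
    obtain rfl : n = 0 := by omega
    simp at hL
    omega
  have he4 : 4 ≤ e := hC.trans (le_ellOf C k n)
  have hr2 : 2 ≤ r := by omega
  have hu4 : 4 ≤ u := by nlinarith
  have hru : r ≤ u := by nlinarith
  have h2u : 2 * u ≤ C * L := by
    have h1 : k * e ≤ C * (2 * L) := mul_ellOf_le hkn
    have h2 : 8 * r * e ≤ k * e := Nat.mul_le_mul_right _ (by omega)
    nlinarith
  have hL1 : 1 ≤ L := by omega
  have hCL : 1 ≤ C * L := by nlinarith
  have hbase : C * L ≤ n := by
    refine le_trans ?_ hn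
    calc C * L ≤ (C * L) ^ (2 * d) := Nat.le_self_pow (by omega) _
      _ ≤ L * (C * L) ^ (2 * d) := Nat.le_mul_of_pos_left _ hL1
      _ ≤ _ := Nat.le_self_pow (by omega) _
  refine ⟨by omega, ?_⟩
  have hmain : k ^ r * (2 * u) ^ (2 * d * u) * n ^ 2 ≤ n ^ u := by
    have h1 : k ^ r * (2 * u) ^ (2 * d * u) ≤ (L * (C * L) ^ (2 * d)) ^ u := by
      calc k ^ r * (2 * u) ^ (2 * d * u) ≤ L ^ u * (C * L) ^ (2 * d * u) := by
            refine Nat.mul_le_mul ((Nat.pow_le_pow_left hkn r).trans (Nat.pow_le_pow_right hL1 hru))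
              (Nat.pow_le_pow_left h2u _)
        _ = _ := by rw [mul_pow L, ← pow_mul]
    rw [← Nat.pow_le_pow_iff_left (n := 2) (by norm_num)]
    calc (k ^ r * (2 * u) ^ (2 * d * u) * n ^ 2) ^ 2
        ≤ ((L * (C * L) ^ (2 * d)) ^ u * n ^ 2) ^ 2 :=
          Nat.pow_le_pow_left (Nat.mul_le_mul_right _ h1) _
      _ = ((L * (C * L) ^ (2 * d)) ^ 2) ^ u * n ^ 4 := by ring
      _ ≤ n ^ u * n ^ u := Nat.mul_le_mul (Nat.pow_le_pow_left hn _) (Nat.pow_le_pow_right hn0 hu4)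
      _ = _ := by ring
  have hlr : tupleLen d C k n * r = 2 * d * u := by
    simp only [tupleLen, ← he, hu]; ring
  have hn' : (n : ℝ≥0∞) ≠ 0 := by exact_mod_cast hn0.ne'
  have heq : ((numTuples d C k n * k : ℕ) : ℝ≥0∞) ^ r * (n ^ u * ((u : ℝ≥0∞) * (2 / n)) ^
      (tupleLen d C k n * r)) = (((numTuples d C k n * k) ^ r * (n ^ u * (2 * u) ^ (2 * d * u)) : ℕ) :
      ℝ≥0∞) / (n ^ (2 * d * u) : ℕ) := by
    rw [hlr, ← mul_div_assoc, div_eq_mul_inv, mul_pow, ← ENNReal.inv_pow, div_eq_mul_inv]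
    push_cast
    ring
  rw [heq]
  refine ENNReal.natCast_div_le_one_div (pow_ne_zero _ hn0.ne') (pow_ne_zero _ hn0.ne') ?_
  obtain ⟨d, rfl⟩ : ∃ d', d = d' + 1 := ⟨d - 1, by omega⟩
  calc (numTuples (d + 1) C k n * k) ^ r * (n ^ u * (2 * u) ^ (2 * (d + 1) * u)) * n ^ 2
      = n ^ (2 * d * u + u) * (k ^ r * (2 * u) ^ (2 * (d + 1) * u) * n ^ 2) := by
        simp only [numTuples, ← he, Nat.add_sub_cancel, mul_pow, ← pow_mul, hu]
        ring
    _ ≤ n ^ (2 * d * u + u) * n ^ u := Nat.mul_le_mul_left _ hmain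
    _ = _ := by ring

/-- The number of forced edges is of order `(k * e) ^ 2`, while counting the maps takes about `2 * d
* k * e * log₂ n` bits; `k * e ≥ C * log₂ n` decides in favour of the edges. The constant collects
`16 ^ 2` from `k ≤ 16 * r`, a factor `2` from halving in `m`, another `2` from `L + 1 ≤ 2 * L`, and
`2 * d + 2`. -/
theorem edges_bound {d C k n : ℕ} (hd : 1 ≤ d) (hC : C = 2048 * (d + 1)) (hk : 16 ≤ k)
    (hkn : k ≤ Nat.log 2 n) :
    ((numTuples d C k n * k : ℕ) : ℝ≥0∞) ^ k *
      2⁻¹ ^ (k / 8 * ellOf C k n * (k / 8 * ellOf C k n + 1) / 2) ≤ 1 / (n ^ 2 : ℕ) := by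
  set L := Nat.log 2 n with hL
  set e := ellOf C k n with he
  set r := k / 8 with hr
  set u := r * e with hu
  set m := u * (u + 1) / 2 with hm
  have hn0 : 0 < n := by
    by_contra h0
    obtain rfl : n = 0 := by omega
    simp at hL
    omega
  have he1 : 1 ≤ e := le_trans (by omega) (le_ellOf C k n)
  have hnL : n ≤ 2 ^ (L + 1) := (Nat.lt_pow_succ_log_self (by norm_num) n).le
  have hkn' : k ≤ n := hkn.trans (Nat.log_le_self 2 n)
  have hm' : u * u ≤ 2 * m := by
    have h1 : 2 * m + 1 ≥ u * (u + 1) := by omega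
    rcases Nat.eq_zero_or_pos u with h0 | h0
    · simp [h0]
    · nlinarith
  have hke : C * L ≤ k * e := le_mul_ellOf (by omega)
  have h16 : k * e ≤ 16 * u := by
    have : k * e ≤ 16 * r * e := Nat.mul_le_mul_right _ (by omega)
    rw [hu]; linarith
  have hexp : (L + 1) * (2 * d * e * k + 2) ≤ m := by
    have h1 : (k * e) * (C * L) ≤ (16 * u) * (16 * u) :=
      Nat.mul_le_mul h16 (hke.trans h16)
    have h2 : 1 ≤ k * e := by nlinarith
    have h3 : 2 * d * e * k + 2 ≤ (2 * d + 2) * (k * e) := by nlinarith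
    have h4 : (L + 1) * (2 * d * e * k + 2) ≤ (2 * L) * ((2 * d + 2) * (k * e)) :=
      Nat.mul_le_mul (by omega) h3
    have h5 : 512 * ((2 * L) * ((2 * d + 2) * (k * e))) = (k * e) * (C * L) := by rw [hC]; ring
    nlinarith
  have hN : numTuples d C k n * k ≤ n ^ (2 * d * e) := by
    calc numTuples d C k n * k ≤ n ^ (2 * (d - 1) * e) * n ^ 1 := by
          rw [pow_one]
          exact Nat.mul_le_mul_left _ hkn'
      _ = n ^ (2 * (d - 1) * e + 1) := by rw [pow_add]
      _ ≤ _ := by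
          refine Nat.pow_le_pow_right hn0 ?_
          obtain ⟨d, rfl⟩ : ∃ d', d = d' + 1 := ⟨d - 1, by omega⟩
          rw [Nat.add_sub_cancel]
          nlinarith
  have heq : ((numTuples d C k n * k : ℕ) : ℝ≥0∞) ^ k * 2⁻¹ ^ m =
      (((numTuples d C k n * k) ^ k : ℕ) : ℝ≥0∞) / (2 ^ m : ℕ) := by
    push_cast
    rw [← ENNReal.inv_pow, ENNReal.div_eq_inv_mul, mul_comm]
  rw [heq]
  refine ENNReal.natCast_div_le_one_div (by positivity) (pow_ne_zero _ hn0.ne') ?_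
  calc (numTuples d C k n * k) ^ k * n ^ 2 ≤ (n ^ (2 * d * e)) ^ k * n ^ 2 :=
        Nat.mul_le_mul_right _ (Nat.pow_le_pow_left hN _)
    _ = n ^ (2 * d * e * k + 2) := by rw [← pow_mul, ← pow_add]
    _ ≤ (2 ^ (L + 1)) ^ (2 * d * e * k + 2) := Nat.pow_le_pow_left hnL _
    _ = 2 ^ ((L + 1) * (2 * d * e * k + 2)) := by rw [← pow_mul]
    _ ≤ _ := Nat.pow_le_pow_right (by norm_num) hexp

/-- The condition `n ^ 2 ≤ κ ^ d` makes `M * (κ / (2 * n)) ^ l`, the guaranteed expected number of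
tuples of one colour inside the clique, at least `n`. Hence some colour is missed with probability
at most `n * exp (-n)`. -/
theorem clique_bound {d C k n κ : ℕ} (hd : 1 ≤ d) (hC : 1 ≤ C) (hn0 : 0 < n) (hkn : k ≤ n)
    (hκn : κ ≤ n) (hκ : n ^ 2 ≤ κ ^ d) (hn : 4 ^ d ≤ n)
    (hexp : (n : ℝ) ^ 3 ≤ Real.exp n) :
    (k : ℝ≥0∞) * (1 - ((κ : ℝ≥0∞) * (1 / (2 * n))) ^ tupleLen d C k n) ^ numTuples d C k n ≤
      1 / (n ^ 2 : ℕ) := by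
  set e := ellOf C k n with he
  have he1 : 1 ≤ e := hC.trans (le_ellOf C k n)
  set l := tupleLen d C k n with hl
  set M := numTuples d C k n with hM
  have hnR : (0 : ℝ) < n := by exact_mod_cast hn0
  -- The surplus on the right is `n ^ (2 * e)`: one half of it absorbs `2 ^ l = (4 ^ d) ^ e`, the
  -- other half the factor `n`.
  have hnat : n * (2 * n) ^ l ≤ M * κ ^ l := by
    obtain ⟨d, rfl⟩ : ∃ d', d = d' + 1 := ⟨d - 1, by omega⟩
    have hll : l = 2 * (d + 1) * e := rfl
    have hMM : M = n ^ (2 * d * e) := rfl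
    have h1 : n ^ (4 * e) ≤ κ ^ l := by
      calc n ^ (4 * e) = (n ^ 2) ^ (2 * e) := by rw [← pow_mul]; congr 1; ring
        _ ≤ (κ ^ (d + 1)) ^ (2 * e) := Nat.pow_le_pow_left hκ _
        _ = κ ^ l := by rw [← pow_mul, hll]; congr 1; ring
    calc n * (2 * n) ^ l = n * (4 ^ (d + 1)) ^ e * n ^ (2 * (d + 1) * e) := by
          rw [hll, mul_pow, ← pow_mul, show (4 : ℕ) = 2 ^ 2 by norm_num, ← pow_mul]
          rw [show 2 * ((d + 1) * e) = 2 * (d + 1) * e by ring]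
          ring
      _ ≤ n ^ e * n ^ e * n ^ (2 * (d + 1) * e) := by
          refine Nat.mul_le_mul_right _ (Nat.mul_le_mul (Nat.le_self_pow (by omega) _)
            (Nat.pow_le_pow_left hn _))
      _ = n ^ (2 * d * e) * n ^ (4 * e) := by ring
      _ ≤ M * κ ^ l := by rw [hMM]; exact Nat.mul_le_mul_left _ h1
  set x : ℝ := ((κ : ℝ) / (2 * n)) ^ l with hx
  have hx0 : 0 ≤ x := by positivity
  have hx1 : x ≤ 1 := by
    refine pow_le_one₀ (by positivity) ?_
    rw [div_le_one (by positivity)]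
    have : (κ : ℝ) ≤ n := by exact_mod_cast hκn
    linarith
  have hMx : (n : ℝ) ≤ M * x := by
    rw [hx, div_pow, ← mul_div_assoc, le_div_iff₀ (by positivity)]
    exact_mod_cast hnat
  have hpow : (1 - x) ^ M ≤ Real.exp (-n) := by
    calc (1 - x) ^ M ≤ (Real.exp (-x)) ^ M :=
          pow_le_pow_left₀ (by linarith) (Real.one_sub_le_exp_neg x) M
      _ = Real.exp (-(M * x)) := by rw [← Real.exp_nat_mul]; congr 1; ring
      _ ≤ _ := Real.exp_le_exp.2 (by linarith)
  have heq : (κ : ℝ≥0∞) * (1 / (2 * n)) = ENNReal.ofReal ((κ : ℝ) / (2 * n)) := by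
    rw [ENNReal.ofReal_div_of_pos (by positivity), ENNReal.ofReal_mul (by norm_num), mul_one_div]
    simp
  rw [heq, ← ENNReal.ofReal_pow (by positivity), ← hx, ← ENNReal.ofReal_one,
    ← ENNReal.ofReal_sub _ hx0, ← ENNReal.ofReal_pow (by linarith)]
  have h2 : ENNReal.ofReal 1 / (n ^ 2 : ℕ) = ENNReal.ofReal (1 / n ^ 2) := by
    rw [ENNReal.ofReal_div_of_pos (by positivity)]
    congr 1
    rw [← ENNReal.ofReal_natCast]
    push_cast
    rfl
  rw [h2, ← ENNReal.ofReal_natCast, ← ENNReal.ofReal_mul (by positivity)]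
  refine ENNReal.ofReal_le_ofReal ?_
  have hk' : (k : ℝ) ≤ n := by exact_mod_cast hkn
  calc (k : ℝ) * (1 - x) ^ M ≤ n * Real.exp (-n) := by
        refine mul_le_mul hk' hpow (pow_nonneg (by linarith) _) hnR.le
    _ ≤ 1 / n ^ 2 := by
        rw [Real.exp_neg, le_div_iff₀ (by positivity), ← div_eq_mul_inv, div_mul_eq_mul_div,
          div_le_one (Real.exp_pos _)]
        linarith [hexp, show (n : ℝ) * n ^ 2 = n ^ 3 by ring]

/-- A polynomial in `L = Nat.log 2 n` is eventually below `2 ^ L ≤ n`. -/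
theorem eventually_log_pow_le (C d : ℕ) :
    ∀ᶠ n : ℕ in atTop, (Nat.log 2 n * (C * Nat.log 2 n) ^ (2 * d)) ^ 2 ≤ n := by
  have h1 := tendsto_pow_const_div_const_pow_of_one_lt (4 * d + 2) (r := 2) (by norm_num)
  have h2 : ∀ᶠ L : ℕ in atTop, (L * (C * L) ^ (2 * d)) ^ 2 ≤ 2 ^ L := by
    have h3 : (0 : ℝ) < 1 / (C ^ (4 * d) + 1) := by positivity
    filter_upwards [h1.eventually (gt_mem_nhds h3)] with L hL
    rw [div_lt_div_iff₀ (by positivity) (by positivity)] at hL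
    have h4 : ((L * (C * L) ^ (2 * d)) ^ 2 : ℝ) = L ^ (4 * d + 2) * C ^ (4 * d) := by
      rw [mul_pow, ← pow_mul, mul_pow]; ring
    have h5 : ((L * (C * L) ^ (2 * d)) ^ 2 : ℝ) ≤ 2 ^ L := by
      rw [h4]
      have : (0 : ℝ) ≤ (L : ℝ) ^ (4 * d + 2) := by positivity
      nlinarith
    exact_mod_cast h5
  have h3 : Tendsto (Nat.log 2) atTop atTop :=
    Filter.tendsto_atTop_atTop.2 fun b => ⟨2 ^ b, fun n hn => by
      have := Nat.log_mono_right (b := 2) hn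
      rwa [Nat.log_pow (by norm_num)] at this⟩
  filter_upwards [h3.eventually h2, eventually_gt_atTop 0] with n hn hn0
  exact hn.trans (Nat.pow_log_le_self 2 hn0.ne')

theorem eventually_pow_three_le_exp : ∀ᶠ n : ℕ in atTop, (n : ℝ) ^ 3 ≤ Real.exp n := by
  have h := (Real.tendsto_pow_mul_exp_neg_atTop_nhds_zero 3).comp tendsto_natCast_atTop_atTop
  filter_upwards [h.eventually (gt_mem_nhds zero_lt_one)] with n hn
  simp only [Function.comp, Real.exp_neg, ← div_eq_mul_inv] at hn
  exact ((div_lt_one (Real.exp_pos _)).1 hn).le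

open Classical in
/-- The parameters of the reduction can be chosen such that it is correct with high probability. -/
theorem exists_reduction_params {δ : ℝ} (hδ : 0 < δ) : ∃ d C : ℕ, ∀ᶠ n : ℕ in atTop,
    ∀ (_ : NeZero n) (k : ℕ) (_ : NeZero k), sizeOK k n = true → ∀ P : SimpleGraph (Fin k),
      (∫⁻ G, Prog.avg (numPicks d C k n * n) (fun w => if P.IsIndContained
        (instGraph P G (numTuples d C k n * k) (tupleLen d C k n) (seqOf n w)) then 1 else 0)
          ∂(erdosRenyiHalf n) ≤ 2 / (n ^ 2 : ℕ)) ∧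
      ∀ (K : Finset (Fin n)) (G : SimpleGraph (Fin n)), K.card = ⌈(n : ℝ) ^ δ⌉₊ →
        Prog.avg (numPicks d C k n * n) (fun w => if P.IsIndContained
          (instGraph P (G ⊔ cliqueOn K) (numTuples d C k n * k) (tupleLen d C k n) (seqOf n w))
            then 0 else 1) ≤ 1 / (n ^ 2 : ℕ) := by
  -- Chosen such that a clique of size `κ ≥ n ^ δ` satisfies `n ^ 2 ≤ κ ^ d`.
  obtain ⟨d, hd⟩ := exists_nat_ge (2 / δ)
  rw [div_le_iff₀ hδ] at hd
  have hd1 : 1 ≤ d := by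
    by_contra h0
    obtain rfl : d = 0 := by omega
    norm_num at hd
  refine ⟨d, 2048 * (d + 1), ?_⟩
  filter_upwards [eventually_log_pow_le (2048 * (d + 1)) d, eventually_pow_three_le_exp,
    eventually_ge_atTop (4 ^ d)] with n h1 h2 h3
  intro _ k _ hk P
  simp only [sizeOK, Bool.and_eq_true, decide_eq_true_eq] at hk
  obtain ⟨hk16, hkL⟩ := hk
  have hn0 : 0 < n := NeZero.pos n
  constructor
  · obtain ⟨hu, hs⟩ := spread_bound hd1 (by omega) hk16 hkL h1
    have he := edges_bound (C := 2048 * (d + 1)) hd1 rfl hk16 hkL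
    refine (lintegral_avg_isIndContained_le (r := k / 8) (u := k / 8 * ellOf (2048 * (d + 1)) k n)
      (m := k / 8 * ellOf (2048 * (d + 1)) k n * (k / 8 * ellOf (2048 * (d + 1)) k n + 1) / 2)
      (by omega) (by omega) (Nat.mul_div_le _ 2) hu P).trans ?_
    refine (add_le_add hs he).trans (le_of_eq ?_)
    rw [ENNReal.div_add_div_same, one_add_one_eq_two]
  · intro K G hK
    refine (avg_not_isIndContained_le P G K).trans ?_
    have hKn : K.card ≤ n := by simpa using Finset.card_le_univ K
    refine clique_bound hd1 (by omega) hn0 (hkL.trans (Nat.log_le_self 2 n)) hKn ?_ h3 h2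
    have h4 : (n : ℝ) ^ δ ≤ (K.card : ℝ) := by
      rw [hK]
      exact Nat.le_ceil _
    have h5 : ((n : ℝ) ^ 2) ≤ (K.card : ℝ) ^ d := by
      calc ((n : ℝ) ^ 2) = (n : ℝ) ^ (2 : ℝ) := by norm_cast
        _ ≤ (n : ℝ) ^ (δ * d) := Real.rpow_le_rpow_of_exponent_le (by exact_mod_cast hn0)
            (by linarith)
        _ = ((n : ℝ) ^ δ) ^ d := by rw [Real.rpow_mul (by positivity), Real.rpow_natCast]
        _ ≤ _ := pow_le_pow_left₀ (by positivity) h4 d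
    exact_mod_cast h5

/-! ### The distinguisher -/

theorem reduce_adjMat {k n : ℕ} [NeZero k] [NeZero n] (d C : ℕ) (P : SimpleGraph (Fin k))
    (G : SimpleGraph (Fin n)) (w : List Bool) :
    reduce d C (adjMat P) (adjMat G) w = adjMat (instGraph P G (numTuples d C k n * k)
      (tupleLen d C k n) (seqOf n w)) := by
  rw [reduce, length_adjMat, length_adjMat]
  refine instMat_eq P G fun q hq => ?_
  have hq' : q < numPicks d C k n := hq
  rw [seqOf, Fin.val_ofNat, Nat.mod_eq_of_lt (pick_lt (NeZero.pos n) _)]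
  simp [picks, hq', Prog.block]

theorem sz_adjMat {n : ℕ} (G : SimpleGraph (Fin n)) : sz (adjMat G) = n * (n + 1) := by
  have h1 : ∀ w : List Bool, sz w = w.length := by
    intro w
    induction w with
    | nil => rfl
    | cons b w ih => simp [ih]; omega
  have h2 : ∀ (X : BitMat) (m : ℕ), (∀ w ∈ X, w.length = m) → sz X = X.length * (m + 1) := by
    intro X m hX
    induction X with
    | nil => simp
    | cons w X ih =>
      have h3 := ih fun w hw => hX w (by simp [hw])
      simp [h1, hX w (by simp), h3]
      ring
  rw [h2 _ n, length_adjMat]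
  intro w hw
  simp only [adjMat, matOf, List.mem_map] at hw
  obtain ⟨u, _, rfl⟩ := hw
  simp

namespace Prog

-- The first `L₁` coins fix the instance, and the rest are fresh for the vote. A wrong final answer
-- is due either to the instance, which is what `Y` measures, or to the vote.
open Classical in
theorem avg_vote_le {A : Prog} {x : List Bool → BTree} {t r L₁ L₂ : ℕ} (hr : 0 < r)
    (hL : r * t ≤ L₂) (hA : ∀ v, A.HaltsBy (x v) t) (Y : List Bool → Prop)
    (hyes : ∀ v, Y v → 2 / 3 ≤ A.acceptProb (x v)) (hno : ∀ v, ¬ Y v → A.acceptProb (x v) ≤ 1 / 3) :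
    avg (L₁ + L₂) (fun w => if r < 2 * multiCount A (x (w.take L₁)) t r (w.drop L₁) then 1 else 0) ≤
      avg L₁ (fun v => if Y v then 1 else 0) + 9 / r ∧
    avg (L₁ + L₂) (fun w => if r < 2 * multiCount A (x (w.take L₁)) t r (w.drop L₁) then 0 else 1) ≤
      avg L₁ (fun v => if Y v then 0 else 1) + 9 / r := by
  have hle : ∀ f : List Bool → ℝ≥0∞, (∀ w, f w ≤ 1) → avg L₂ f ≤ 1 := fun f hf =>
    (avg_mono fun w _ => hf w).trans (avg_const L₂ 1).le
  rw [avg_append, avg_append]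
  constructor
  · rw [← avg_const L₁ (9 / r), ← avg_add]
    refine avg_mono fun v hv => ?_
    simp only [← hv, List.take_left', List.drop_left']
    split_ifs with h
    · exact (hle _ fun w => by split_ifs <;> simp).trans le_self_add
    · rw [zero_add]
      exact (vote_error (hA v) hr hL).2 (hno v h)
  · rw [← avg_const L₁ (9 / r), ← avg_add]
    refine avg_mono fun v hv => ?_
    simp only [← hv, List.take_left', List.drop_left']
    split_ifs with h
    · rw [zero_add]
      exact (vote_error (hA v) hr hL).1 (hyes v h)
    · exact (hle _ fun w => by split_ifs <;> simp).trans le_self_add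

end Prog

/-- The time bound for the distinguisher, up to a polynomial. -/
noncomputable def baseTime (d C : ℕ) (K : ℕ → ℕ) (k : ℕ → ℕ) (T : ℕ → ℕ → ℝ) (i n : ℕ) : ℕ :=
  K i + n + numTuples d C (k i) n + ⌊T i (numTuples d C (k i) n * k i)⌋₊ + 2

/-- Each of the five summands is at most `Z ^ (2 * c + 9)`, and `Z ^ 3 ≥ 8` makes up for their
number. -/
theorem total_time_le {Z a p n M τ k l q D s c : ℕ} (hZ : 2 ≤ Z) (ha : a ≤ Z) (hp : p + n + M + 2 ≤ Z)
    (hτ : τ + 1 ≤ Z) (hq : q = M * k * l) (hk : k ≤ Z) (hl : l ≤ D * (n + 1)) (hD : D ≤ Z)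
    (hs : s = n * (n + 1)) :
    a + (p + s + M + 2) ^ c + 60 * (n * n + 1) * (τ + 1) + q * n + n * n * τ ≤
      Z ^ (2 * c + 12) := by
  have hZ1 : 1 ≤ Z := by omega
  have hn : n + 1 ≤ Z := by omega
  have hM : M ≤ Z := by omega
  have b1 : a ≤ Z ^ (2 * c + 9) := ha.trans (Nat.le_self_pow (by omega) _)
  have b2 : (p + s + M + 2) ^ c ≤ Z ^ (2 * c + 9) := by
    have : p + s + M + 2 ≤ Z ^ 2 := by rw [hs]; nlinarith
    calc _ ≤ (Z ^ 2) ^ c := Nat.pow_le_pow_left this c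
      _ = Z ^ (2 * c) := by rw [pow_mul]
      _ ≤ _ := Nat.pow_le_pow_right hZ1 (by omega)
  have h64 : 60 ≤ Z ^ 6 := le_trans (by norm_num) (Nat.pow_le_pow_left hZ 6)
  have b3 : 60 * (n * n + 1) * (τ + 1) ≤ Z ^ (2 * c + 9) := by
    have : n * n + 1 ≤ Z ^ 2 := by nlinarith
    calc _ ≤ Z ^ 6 * Z ^ 2 * Z := Nat.mul_le_mul (Nat.mul_le_mul h64 this) hτ
      _ = Z ^ 9 := by ring
      _ ≤ _ := Nat.pow_le_pow_right hZ1 (by omega)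
  have b4 : q * n ≤ Z ^ (2 * c + 9) := by
    have : l ≤ Z * Z := hl.trans (Nat.mul_le_mul hD hn)
    calc q * n ≤ Z * Z * (Z * Z) * Z := by
          rw [hq]
          exact Nat.mul_le_mul (Nat.mul_le_mul (Nat.mul_le_mul hM hk) this) (by omega)
      _ = Z ^ 5 := by ring
      _ ≤ _ := Nat.pow_le_pow_right hZ1 (by omega)
  have b5 : n * n * τ ≤ Z ^ (2 * c + 9) := by
    calc n * n * τ ≤ Z * Z * Z :=
          Nat.mul_le_mul (Nat.mul_le_mul (by omega) (by omega)) (by omega)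
      _ = Z ^ 3 := by ring
      _ ≤ _ := Nat.pow_le_pow_right hZ1 (by omega)
  have b6 : 8 * Z ^ (2 * c + 9) ≤ Z ^ (2 * c + 12) := by
    have : 8 ≤ Z ^ 3 := le_trans (by norm_num) (Nat.pow_le_pow_left hZ 3)
    calc _ ≤ Z ^ 3 * Z ^ (2 * c + 9) := Nat.mul_le_mul_right _ this
      _ = _ := by ring
  omega

theorem outer_time_le {Z s t c c' : ℕ} (hZ : 2 ≤ Z) (hs : s ≤ Z * Z) (ht : t ≤ Z ^ (2 * c + 12)) :
    (s + t + 2) ^ c' + t + 1 ≤ Z ^ ((2 * c + 14) * (c' + 1)) := by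
  have hZ1 : 1 ≤ Z := by omega
  have h1 : s + t + 2 ≤ Z ^ (2 * c + 14) := by
    have h2 : Z * Z ≤ Z ^ (2 * c + 12) := by
      rw [← pow_two]; exact Nat.pow_le_pow_right hZ1 (by omega)
    have h3 : 4 * Z ^ (2 * c + 12) ≤ Z ^ (2 * c + 14) := by
      have : 4 ≤ Z ^ 2 := Nat.pow_le_pow_left hZ 2
      calc _ ≤ Z ^ 2 * Z ^ (2 * c + 12) := Nat.mul_le_mul_right _ this
        _ = _ := by ring
    have h4 : 4 ≤ Z ^ (2 * c + 12) := by
      calc 4 ≤ Z ^ 2 := Nat.pow_le_pow_left hZ 2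
        _ ≤ _ := Nat.pow_le_pow_right hZ1 (by omega)
    omega
  set W := Z ^ (2 * c + 14) with hW
  have h5 : t + 1 + 1 ≤ W := by omega
  have h6 : 1 ≤ W ^ c' := Nat.one_le_pow _ _ (by omega)
  calc (s + t + 2) ^ c' + t + 1 ≤ W ^ c' + (t + 1) := by
        have := Nat.pow_le_pow_left h1 c'
        omega
    _ ≤ W ^ c' * (t + 1 + 1) := by nlinarith
    _ ≤ W ^ c' * W := Nat.mul_le_mul_left _ h5
    _ = _ := by rw [hW, ← pow_mul, ← pow_add, pow_mul]; ring

open Classical in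
open Prog in
/-- From an algorithm for induced pattern detection one obtains a program that detects planted
cliques, on average over the coins. -/
theorem exists_distinguisher {A : Prog} {k : ℕ → ℕ} {H : ∀ i, SimpleGraph (Fin (k i))}
    {code : ℕ → BTree} {T : ℕ → ℕ → ℝ} (hcode : Fn false code)
    (hA : SolvesInducedDetection A H code T) (d C : ℕ) :
    ∃ (P : Prog) (c : ℕ) (K : ℕ → ℕ) (Q : ∀ i, SimpleGraph (Fin (k i))), ∀ (n : ℕ) (_ : NeZero n)
      (G : SimpleGraph (Fin n)) (i : ℕ), i < n → sizeOK (k i) n = true →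
      P.HaltsBy (BTree.ofGraph G) (baseTime d C K k T i n ^ c) ∧
      ∀ ε : ℕ → ℝ≥0∞,
        ((∀ j < n, ∀ (_ : NeZero (k j)), sizeOK (k j) n = true →
          avg (numPicks d C (k j) n * n) (fun w => if (Q j).IsIndContained
            (instGraph (Q j) G (numTuples d C (k j) n * k j) (tupleLen d C (k j) n) (seqOf n w))
              then 1 else 0) ≤ ε j) →
          P.acceptProb (BTree.ofGraph G) ≤ ∑ j ∈ Finset.range n, (ε j + 9 / (n ^ 2 : ℕ))) ∧
        ((∀ j < n, ∀ (_ : NeZero (k j)), sizeOK (k j) n = true →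
          avg (numPicks d C (k j) n * n) (fun w => if (Q j).IsIndContained
            (instGraph (Q j) G (numTuples d C (k j) n * k j) (tupleLen d C (k j) n) (seqOf n w))
              then 0 else 1) ≤ ε j) →
          1 ≤ P.acceptProb (BTree.ofGraph G) + ∑ j ∈ Finset.range n, (ε j + 9 / (n ^ 2 : ℕ))) := by
  obtain ⟨pat, hpat, hpat'⟩ := exists_fn_pattern hcode hA
  obtain ⟨B, c, K, hB⟩ := exists_reduction A hcode hpat d C
  obtain ⟨P, c', hP⟩ := exists_parallel B
  have hQ : ∀ i, ∃ Q : SimpleGraph (Fin (k i)), k i ≠ 0 → pat i = adjMat Q ∧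
      Nonempty (H i ≃g Q) := by
    intro i
    by_cases h : k i = 0
    · exact ⟨⊥, fun h' => absurd h h'⟩
    · obtain ⟨Q, hQ⟩ := (hpat' i).2 h
      exact ⟨Q, fun _ => hQ⟩
  choose Q hQ using hQ
  -- Everything that depends on the index alone is moved into the new `K`, so that a power of
  -- `baseTime` bounds the total time.
  refine ⟨P, (2 * c + 14) * (c' + 1), fun i => K i + sz (pat i) + k i + 2 * d * C, Q,
    fun n _ G i hi hsize => ?_⟩
  -- The empty pattern is represented by a graph with one vertex, but `sizeOK` rejects both sizes.
  have hlen : ∀ j, sizeOK (pat j).length n = sizeOK (k j) n := by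
    intro j
    by_cases h : k j = 0
    · rw [(hpat' j).1 h, h]
      rfl
    · rw [(hQ j h).1, length_adjMat]
  set X := adjMat G with hX
  have hXl : X.length = n := length_adjMat G
  have hr : 0 < n * n := Nat.mul_pos (NeZero.pos n) (NeZero.pos n)
  -- the time of a single run of `A`
  set τ : ℕ → ℕ := fun j => ⌊T j (numTuples d C (k j) n * k j)⌋₊ with hτ
  set Lw : ℕ → ℕ := fun j => numPicks d C (k j) n * n with hLw
  set x : ℕ → List Bool → BTree := fun j v => .cons (code j) (enc (reduce d C (pat j) X v)) with hx
  have hne : ∀ j, sizeOK (k j) n = true → NeZero (k j) := by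
    intro j hj
    simp only [sizeOK, Bool.and_eq_true, decide_eq_true_eq] at hj
    exact ⟨by omega⟩
  have hxeq : ∀ j (_ : NeZero (k j)), ∀ v, x j v = .cons (code j) (BTree.ofGraph
      (instGraph (Q j) G (numTuples d C (k j) n * k j) (tupleLen d C (k j) n) (seqOf n v))) := by
    intro j _ v
    simp only [hx]
    rw [(hQ j (NeZero.ne _)).1, hX, reduce_adjMat, enc_adjMat]
  have hN1 : ∀ j, sizeOK (k j) n = true → 1 ≤ numTuples d C (k j) n * k j := fun j hj =>
    Nat.mul_pos (Nat.pow_pos (NeZero.pos n)) (hne j hj).pos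
  have hhalt : ∀ j, sizeOK (k j) n = true → ∀ v, A.HaltsBy (x j v) (τ j) := by
    intro j hj v
    rw [hxeq j (hne j hj)]
    obtain ⟨t, ht, hh⟩ := haltsWithin_iff.1 (hA j _ (hN1 j hj) _).1
    exact hh.mono (Nat.le_floor ht)
  have hBrun : ∀ j, sizeOK (k j) n = true → ∀ w : List Bool, Lw j + n * n * τ j ≤ w.length →
      ∃ v u, w = v ++ u ∧ B.Runs (enc (j, X)) v (enc (some (decide
        (n * n < 2 * multiCount A (x j (w.take (Lw j))) (τ j) (n * n) (w.drop (Lw j))))))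
        (K j + (sz (pat j) + sz X + numTuples d C (k j) n + 2) ^ c +
            60 * (n * n + 1) * (τ j + 1)) := by
    intro j hj w hw
    have hpl : (pat j).length = k j := by
      rw [(hQ j (hne j hj).out).1, length_adjMat]
    obtain ⟨v, u, ys, hv, -, hm⟩ := (hhalt j hj (w.take (Lw j))).exists_multi (n * n)
      (w := w.drop (Lw j)) (by rw [List.length_drop]; omega)
    have h1 := (hB j X).2 (by rw [hXl, hlen]; exact hj) (w.take (Lw j)) v (τ j) ys
      (by rw [List.length_take, hXl, hpl]; exact min_eq_left (by omega)) (by rw [hXl]; exact hm)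
    rw [hXl, hpl] at h1
    refine ⟨w.take (Lw j) ++ v, u, ?_, ?_⟩
    · rw [List.append_assoc, ← hv, List.take_append_drop]
    · rw [hv, hm.multiCount_eq u]
      have h2 : majority (ys.map fun y => !y.isNil) =
          decide (n * n < 2 * (ys.map fun y => !y.isNil).count true) := by
        simp only [majority, List.length_map, hm.length_eq]
      rw [h2] at h1
      exact h1
  -- the time until the first answer
  set t := K i + (sz (pat i) + sz X + numTuples d C (k i) n + 2) ^ c +
    60 * (n * n + 1) * (τ i + 1) + Lw i + n * n * τ i with ht
  have hPrun := hP X t i (by rw [hXl]; exact hi) fun w hw => by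
    obtain ⟨v, u, hv, hr⟩ := hBrun i hsize w (by omega)
    exact ⟨v, u, _, hv, hr.mono (by omega), by simp⟩
  set Z := baseTime d C (fun i => K i + sz (pat i) + k i + 2 * d * C) k T i n with hZ
  have hsX : sz X = n * (n + 1) := sz_adjMat G
  have htime : (sz X + t + 2) ^ c' + t + 1 ≤ Z ^ ((2 * c + 14) * (c' + 1)) := by
    have hZ' : Z = K i + sz (pat i) + k i + 2 * d * C + n + numTuples d C (k i) n + τ i + 2 := rfl
    refine outer_time_le (by omega) ?_ ?_
    · rw [hsX]
      exact Nat.mul_le_mul (by omega) (by omega)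
    · refine total_time_le (k := k i) (l := tupleLen d C (k i) n) (D := 2 * d * C) (by omega)
        (by omega) (by omega) (by omega) rfl (by omega) ?_ (by omega) hsX
      rw [tupleLen, ellOf, ← Nat.mul_assoc]
      refine Nat.mul_le_mul_left _ (Nat.succ_le_succ ?_)
      exact (Nat.div_le_self _ _).trans (Nat.log_le_self 2 n)
  have hHalts : P.HaltsBy (BTree.ofGraph G) (Z ^ ((2 * c + 14) * (c' + 1))) := by
    intro w hw
    obtain ⟨v, u, z, hv, hr, -⟩ := hPrun w (by omega)
    rw [← enc_adjMat]
    exact ⟨v, u, z, hv, hr.mono (by omega)⟩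
  refine ⟨hHalts, ?_⟩
  -- the answers
  set L := Z ^ ((2 * c + 14) * (c' + 1)) + ∑ j ∈ Finset.range n, (Lw j + n * n * τ j) with hL
  have hLj : ∀ j < n, Lw j + n * n * τ j ≤ L := fun j hj => by
    have := Finset.single_le_sum (f := fun j => Lw j + n * n * τ j) (fun _ _ => Nat.zero_le _)
      (Finset.mem_range.2 hj)
    omega
  set ans : ℕ → List Bool → Prop := fun j w =>
    n * n < 2 * multiCount A (x j (w.take (Lw j))) (τ j) (n * n) (w.drop (Lw j)) with hans
  -- Which index answers first depends on the coins, and this may bias its answer. So the errors of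
  -- all indices are added up below.
  have hspec : ∀ w : List Bool, w.length = L → ∃ j < n, sizeOK (k j) n = true ∧
      (P.AcceptsOn (BTree.ofGraph G) w ↔ ans j w) := by
    intro w hw
    obtain ⟨v, u, z, hv, hr, j, hj, v', u', y, T', hv', hr', hy, hz⟩ := hPrun w (by omega)
    rw [hXl] at hj
    rw [enc_adjMat] at hr
    -- An index of unsuitable size only ever returns `nil`, so it is never the first to answer.
    have hjs : sizeOK (k j) n = true := by
      by_contra h
      rw [Bool.not_eq_true] at h
      obtain ⟨T'', h1⟩ := (hB j X).1 (by rw [hXl, hlen]; exact h)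
      exact hy (hr'.det h1 (u := u') (u' := w) (by simpa using hv'.symm)).1
    obtain ⟨v₂, u₂, hv₂, hr₂⟩ := hBrun j hjs w (by rw [hw]; exact hLj j hj)
    obtain ⟨rfl, -⟩ := hr'.det hr₂ (u := u') (u' := u₂) (by rw [← hv', ← hv₂])
    refine ⟨j, hj, hjs, ?_⟩
    have hacc : P.AcceptsOn (BTree.ofGraph G) w ↔ z ≠ .nil := by
      constructor
      · rintro ⟨v₃, u₃, y₃, T₃, hv₃, hr₃, hy₃⟩
        rwa [(hr.det hr₃ (u := u) (u' := u₃) (by rw [← hv, ← hv₃])).1]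
      · exact fun h => ⟨v, u, z, _, hv, hr, h⟩
    rw [hacc, hz]
    simp only [hans]
    by_cases h : n * n < 2 * multiCount A (x j (w.take (Lw j))) (τ j) (n * n) (w.drop (Lw j))
    · simp [h, enc, BTree.ofBool, BTree.right]
    · simp [h, enc, BTree.ofBool, BTree.right]
  have hprob := acceptProb_eq hHalts (L := L) (by omega)
  have hvote : ∀ j < n, ∀ (_ : NeZero (k j)), sizeOK (k j) n = true →
      avg L (fun w => if ans j w then 1 else 0) ≤
        avg (Lw j) (fun v => if (Q j).IsIndContained (instGraph (Q j) G (numTuples d C (k j) n * k j)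
          (tupleLen d C (k j) n) (seqOf n v)) then 1 else 0) + 9 / (n * n : ℕ) ∧
      avg L (fun w => if ans j w then 0 else 1) ≤
        avg (Lw j) (fun v => if (Q j).IsIndContained (instGraph (Q j) G (numTuples d C (k j) n * k j)
          (tupleLen d C (k j) n) (seqOf n v)) then 0 else 1) + 9 / (n * n : ℕ) := by
    intro j hj hk0 hjs
    have h1 := hLj j hj
    obtain ⟨iso⟩ := (hQ j (NeZero.ne _)).2
    have h2 := avg_vote_le (A := A) (x := x j) (t := τ j) (r := n * n) (L₁ := Lw j) (L₂ := L - Lw j)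
      hr (by omega) (hhalt j hjs) (fun v => (Q j).IsIndContained (instGraph (Q j) G
        (numTuples d C (k j) n * k j) (tupleLen d C (k j) n) (seqOf n v)))
      (fun v hv => by
        rw [hxeq j hk0]
        exact (hA j _ (hN1 j hjs) _).2.1 (SimpleGraph.IsIndContained.trans ⟨iso.toEmbedding⟩ hv))
      (fun v hv => by
        rw [hxeq j hk0]
        exact (hA j _ (hN1 j hjs) _).2.2 fun h =>
          hv (SimpleGraph.IsIndContained.trans ⟨iso.symm.toEmbedding⟩ h))
    rw [show Lw j + (L - Lw j) = L by omega] at h2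
    exact h2
  intro ε
  constructor
  · intro hε
    rw [hprob]
    calc avg L (fun w => if P.AcceptsOn (BTree.ofGraph G) w then 1 else 0)
        ≤ avg L (fun w => ∑ j ∈ Finset.range n,
            if sizeOK (k j) n = true then if ans j w then 1 else 0 else 0) := by
          refine avg_mono fun w hw => ?_
          obtain ⟨j, hj, hjs, hiff⟩ := hspec w hw
          refine le_trans ?_ (Finset.single_le_sum (fun _ _ => by simp) (Finset.mem_range.2 hj))
          simp [hjs, hiff]
      _ ≤ _ := by
          rw [avg_sum]
          refine Finset.sum_le_sum fun j hj => ?_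
          have hj := Finset.mem_range.1 hj
          by_cases hjs : sizeOK (k j) n = true
          · simp only [hjs, if_true]
            refine (hvote j hj (hne j hjs) hjs).1.trans ?_
            rw [← pow_two]
            exact add_le_add_left (hε j hj (hne j hjs) hjs) _
          · simp [hjs]
  · intro hε
    rw [hprob]
    calc (1 : ℝ≥0∞) = avg L (fun w => 1) := (avg_const L 1).symm
      _ ≤ avg L (fun w => (if P.AcceptsOn (BTree.ofGraph G) w then 1 else 0) +
            ∑ j ∈ Finset.range n,
            if sizeOK (k j) n = true then if ans j w then 0 else 1 else 0) := by
          refine avg_mono fun w hw => ?_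
          obtain ⟨j, hj, hjs, hiff⟩ := hspec w hw
          by_cases h : ans j w
          · simp [hiff, h]
          · refine le_trans ?_ le_add_self
            refine le_trans ?_ (Finset.single_le_sum (fun _ _ => by simp) (Finset.mem_range.2 hj))
            simp [hjs, h]
      _ ≤ _ := by
          rw [avg_add, avg_sum]
          refine add_le_add_right (Finset.sum_le_sum fun j hj => ?_) _
          have hj := Finset.mem_range.1 hj
          by_cases hjs : sizeOK (k j) n = true
          · simp only [hjs, if_true]
            refine (hvote j hj (hne j hjs) hjs).2.trans ?_
            rw [← pow_two]
            exact add_le_add_left (hε j hj (hne j hjs) hjs) _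
          · simp [hjs]

/-! ### The running time -/

theorem natLog_two_le (n : ℕ) : (Nat.log 2 n : ℝ) ≤ 2 * Real.log n := by
  rcases Nat.eq_zero_or_pos n with rfl | hn
  · simp
  have h1 : ((2 : ℝ) ^ Nat.log 2 n) ≤ n := by exact_mod_cast Nat.pow_log_le_self 2 hn.ne'
  have h2 := Real.log_le_log (by positivity) h1
  rw [Real.log_pow] at h2
  have h3 := Real.log_two_gt_d9
  have h4 : (0 : ℝ) ≤ Nat.log 2 n := by positivity
  nlinarith

/-- `Nat.log 2 n` is at most `2 * log n`, and the summand one in `ellOf` costs at most another `log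
n / k` since `k ≤ log n`. -/
theorem numTuples_le_exp {d C k n : ℕ} (hn : 0 < n) (hk : 0 < k) (hkn : (k : ℝ) ≤ Real.log n) :
    (numTuples d C k n : ℝ) ≤ Real.exp (6 * d * C / k * Real.log n ^ 2) := by
  have hnR : (0 : ℝ) < n := by exact_mod_cast hn
  have hkR : (0 : ℝ) < k := by exact_mod_cast hk
  have hy : 0 ≤ Real.log n := hkR.le.trans hkn
  have h1 : ((Nat.log 2 n / k : ℕ) : ℝ) + 1 ≤ 3 * Real.log n / k := by
    have h2 : ((Nat.log 2 n / k : ℕ) : ℝ) ≤ (Nat.log 2 n : ℝ) / k := Nat.cast_div_le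
    have h3 : (Nat.log 2 n : ℝ) / k ≤ 2 * Real.log n / k := by
      gcongr
      exact natLog_two_le n
    have h4 : 1 ≤ Real.log n / k := (one_le_div hkR).2 hkn
    have h5 : 3 * Real.log n / k = 2 * Real.log n / k + Real.log n / k := by ring
    linarith
  have hd : ((d - 1 : ℕ) : ℝ) ≤ d := by exact_mod_cast Nat.sub_le d 1
  rw [numTuples]
  push_cast
  rw [← Real.exp_log (pow_pos hnR _), Real.log_pow]
  refine Real.exp_le_exp.2 ?_
  simp only [ellOf]
  push_cast
  calc 2 * ((d - 1 : ℕ) : ℝ) * (C * (((Nat.log 2 n / k : ℕ) : ℝ) + 1)) * Real.log n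
      ≤ 2 * d * (C * (3 * Real.log n / k)) * Real.log n := by gcongr
    _ = _ := by ring

/-- The instance has at most `exp ((6 * d * C + 1) / k * log n ^ 2)` vertices, so raising this to
the power `g k` leaves at most `exp (η * log n ^ 2)`. The second `η` absorbs the constants `K i` and
`f (k i)`, the index being fixed. -/
theorem baseTime_le_exp (d C : ℕ) (K k : ℕ → ℕ) (f g : ℕ → ℝ) (i : ℕ) (hk : 0 < k i) {η : ℝ}
    (hη : 0 < η) (h1 : 6 * d * C / (k i : ℝ) ≤ η) (h2 : |g (k i)| * (6 * d * C + 1) ≤ η * k i) :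
    ∀ᶠ n : ℕ in atTop,
      (baseTime d C K k (fun i n => f (k i) * (n : ℝ) ^ g (k i)) i n : ℝ) ≤
        Real.exp (2 * η * Real.log n ^ 2) := by
  have hlog : Tendsto (fun n : ℕ => Real.log n) atTop atTop :=
    Real.tendsto_log_atTop.comp tendsto_natCast_atTop_atTop
  have hkR : (0 : ℝ) < k i := by exact_mod_cast hk
  set c₀ : ℝ := K i + 1 + 1 + |f (k i)| + 2 with hc₀
  have hc₀pos : 0 < c₀ := by positivity
  filter_upwards [hlog.eventually_ge_atTop (k i), hlog.eventually_ge_atTop (1 / η),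
    hlog.eventually_ge_atTop (Real.log c₀ + 1), hlog.eventually_ge_atTop 1,
    hlog.eventually_ge_atTop (Real.log c₀ / η), eventually_gt_atTop 0] with n hy1 hy2 hy3 hy4 hy5 hn
  set y := Real.log n with hy
  have hnR : (0 : ℝ) < n := by exact_mod_cast hn
  set M := numTuples d C (k i) n with hM
  have hM1 : 1 ≤ M := Nat.pow_pos hn
  have hM1R : (1 : ℝ) ≤ M := by exact_mod_cast hM1
  have hMlog : Real.log M ≤ 6 * d * C / k i * y ^ 2 := by
    have := Real.log_le_log (by linarith) (numTuples_le_exp (d := d) (C := C) hn hk hy1)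
    rwa [Real.log_exp] at this
  have e0 : 0 ≤ η * y ^ 2 := by positivity
  have b1 : (n : ℝ) ≤ Real.exp (η * y ^ 2) := by
    rw [← Real.exp_log hnR, ← hy]
    refine Real.exp_le_exp.2 ?_
    rw [div_le_iff₀ hη] at hy2
    nlinarith
  have b2 : (M : ℝ) ≤ Real.exp (η * y ^ 2) := by
    rw [← Real.exp_log (show (0 : ℝ) < M by linarith)]
    refine Real.exp_le_exp.2 (hMlog.trans ?_)
    gcongr
  have b3 : ((⌊f (k i) * ((M * k i : ℕ) : ℝ) ^ g (k i)⌋₊ : ℕ) : ℝ) ≤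
      |f (k i)| * Real.exp (η * y ^ 2) := by
    have hN1 : (1 : ℝ) ≤ ((M * k i : ℕ) : ℝ) := by exact_mod_cast Nat.mul_pos hM1 hk
    have hpow : ((M * k i : ℕ) : ℝ) ^ g (k i) ≤ Real.exp (η * y ^ 2) := by
      refine (Real.rpow_le_rpow_of_exponent_le hN1 (le_abs_self _)).trans ?_
      rw [Real.rpow_def_of_pos (by linarith)]
      refine Real.exp_le_exp.2 ?_
      have hlogN : Real.log ((M * k i : ℕ) : ℝ) ≤ (6 * d * C + 1) / k i * y ^ 2 := by
        push_cast
        rw [Real.log_mul (by linarith) hkR.ne']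
        have hlk : Real.log (k i) ≤ y ^ 2 / k i := by
          have := Real.log_le_sub_one_of_pos hkR
          rw [le_div_iff₀ hkR]
          nlinarith
        have : (6 * d * C + 1) / k i * y ^ 2 = 6 * d * C / k i * y ^ 2 + y ^ 2 / k i := by
          ring
        linarith
      calc Real.log ((M * k i : ℕ) : ℝ) * |g (k i)|
          ≤ (6 * d * C + 1) / k i * y ^ 2 * |g (k i)| := by gcongr
        _ = |g (k i)| * (6 * d * C + 1) / k i * y ^ 2 := by ring
        _ ≤ η * y ^ 2 := by
            gcongr
            rwa [div_le_iff₀ hkR]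
    rcases le_total 0 (f (k i) * ((M * k i : ℕ) : ℝ) ^ g (k i)) with h0 | h0
    · refine (Nat.floor_le h0).trans ?_
      refine mul_le_mul (le_abs_self _) hpow (by positivity) (abs_nonneg _)
    · rw [Nat.floor_of_nonpos h0]
      simp only [Nat.cast_zero]
      positivity
  have b4 : 1 ≤ Real.exp (η * y ^ 2) := Real.one_le_exp e0
  have b5 : c₀ ≤ Real.exp (η * y ^ 2) := by
    rw [← Real.exp_log hc₀pos]
    refine Real.exp_le_exp.2 ?_
    rw [div_le_iff₀ hη] at hy5
    nlinarith
  have hsum : (baseTime d C K k (fun i n => f (k i) * (n : ℝ) ^ g (k i)) i n : ℝ) ≤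
      c₀ * Real.exp (η * y ^ 2) := by
    rw [baseTime]
    push_cast only [Nat.cast_add]
    rw [← hM, hc₀]
    have hK : (0 : ℝ) ≤ K i := by positivity
    have : (K i : ℝ) ≤ K i * Real.exp (η * y ^ 2) := le_mul_of_one_le_right hK b4
    push_cast at b3 ⊢
    nlinarith
  refine hsum.trans ?_
  calc c₀ * Real.exp (η * y ^ 2) ≤ Real.exp (η * y ^ 2) * Real.exp (η * y ^ 2) := by gcongr
    _ = _ := by rw [← Real.exp_add]; congr 1; ring

/-- The best time bound that is available for graphs with `n` vertices. -/
noncomputable def bestTime (d C c : ℕ) (K k : ℕ → ℕ) (T : ℕ → ℕ → ℝ) (n : ℕ) : ℕ :=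
  sInf {m | ∃ i < n, sizeOK (k i) n = true ∧ m = baseTime d C K k T i n ^ c}

theorem eventually_sizeOK {k : ℕ → ℕ} {i : ℕ} (hi : 16 ≤ k i) :
    ∀ᶠ n : ℕ in atTop, i < n ∧ sizeOK (k i) n = true := by
  filter_upwards [eventually_gt_atTop i, eventually_ge_atTop (2 ^ k i)] with n h1 h2
  refine ⟨h1, ?_⟩
  simp only [sizeOK, Bool.and_eq_true, decide_eq_true_eq]
  refine ⟨hi, ?_⟩
  have := Nat.log_mono_right (b := 2) h2
  rwa [Nat.log_pow (by norm_num)] at this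

/-- For each `ε` a single index with `k i` large enough gives an exponent of at most `ε * log n` for
all large `n`, by `k i → ∞` and `g = o(k)`. The minimum over the indices inherits all of these
bounds, so no choice of an index depending on `n` has to be made. -/
theorem isLittleO_logb_bestTime (d C c : ℕ) (K : ℕ → ℕ) {k : ℕ → ℕ} (hk : Tendsto k atTop atTop)
    (f : ℕ → ℝ) {g : ℕ → ℝ} (hg : g =o[atTop] fun m : ℕ => (m : ℝ)) :
    (fun n : ℕ => Real.logb n (bestTime d C c K k (fun i n => f (k i) * (n : ℝ) ^ g (k i)) n))
      =o[atTop] fun n : ℕ => Real.log n := by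
  rw [Asymptotics.isLittleO_iff]
  intro ε hε
  -- This compensates for the `c`-th power in `bestTime` and the factor two in `baseTime_le_exp`; `c
  -- + 1` in place of `c` avoids a zero denominator.
  set η : ℝ := ε / (2 * (c + 1)) with hη
  have hηpos : 0 < η := by positivity
  set D : ℝ := 6 * d * C with hD
  have hD0 : 0 ≤ D := by positivity
  -- a pattern that is large enough
  have hkR : Tendsto (fun i => (k i : ℝ)) atTop atTop := tendsto_natCast_atTop_atTop.comp hk
  have hg' := (Asymptotics.isLittleO_iff.1 hg) (c := η / (D + 1)) (by positivity)
  obtain ⟨i, hi1, hi2, hi3, hi4⟩ := ((hk.eventually_ge_atTop 16).and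
    ((hkR.eventually_ge_atTop (D / η)).and ((hkR.eventually_ge_atTop 1).and
      (hk.eventually hg')))).exists
  have hki : (0 : ℝ) < k i := by linarith
  have h1 : 6 * d * C / (k i : ℝ) ≤ η := by
    rw [div_le_iff₀ hki, ← hD]
    rw [div_le_iff₀ hηpos] at hi2
    linarith
  have h2 : |g (k i)| * (6 * d * C + 1) ≤ η * k i := by
    rw [Real.norm_eq_abs, Real.norm_eq_abs, abs_of_pos hki, div_mul_eq_mul_div,
      le_div_iff₀ (by positivity)] at hi4
    rwa [← hD]
  filter_upwards [baseTime_le_exp d C K k f g i (by omega) hηpos h1 h2, eventually_sizeOK hi1,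
    eventually_ge_atTop 3] with n hn hs hn3
  have hmem : baseTime d C K k (fun i n => f (k i) * (n : ℝ) ^ g (k i)) i n ^ c ∈ {m | ∃ i < n,
      sizeOK (k i) n = true ∧
        m = baseTime d C K k (fun i n => f (k i) * (n : ℝ) ^ g (k i)) i n ^ c} :=
    ⟨i, hs.1, hs.2, rfl⟩
  set b := bestTime d C c K k (fun i n => f (k i) * (n : ℝ) ^ g (k i)) n with hb
  have hle : b ≤ baseTime d C K k (fun i n => f (k i) * (n : ℝ) ^ g (k i)) i n ^ c :=
    Nat.sInf_le hmem
  have hb1 : 1 ≤ b := by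
    obtain ⟨j, _, _, hj⟩ := Nat.sInf_mem ⟨_, hmem⟩
    rw [hb, bestTime, hj]
    exact Nat.one_le_pow _ _ (by unfold baseTime; omega)
  have hb1R : (1 : ℝ) ≤ b := by exact_mod_cast hb1
  have hn3R : (3 : ℝ) ≤ n := by exact_mod_cast hn3
  have hy : 0 < Real.log n := Real.log_pos (by linarith)
  have hlog : Real.log b ≤ c * (2 * η * Real.log n ^ 2) := by
    have h3 : (b : ℝ) ≤ Real.exp (2 * η * Real.log n ^ 2) ^ c := by
      calc (b : ℝ) ≤ (baseTime d C K k (fun i n => f (k i) * (n : ℝ) ^ g (k i)) i n : ℝ) ^ c := by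
            exact_mod_cast hle
        _ ≤ _ := pow_le_pow_left₀ (by positivity) hn c
    have h4 := Real.log_le_log (by linarith) h3
    rwa [← Real.exp_nat_mul, Real.log_exp] at h4
  have hlogb : 0 ≤ Real.log b := Real.log_nonneg hb1R
  rw [Real.norm_eq_abs, Real.norm_eq_abs, abs_of_pos hy, Real.logb, abs_of_nonneg (by positivity),
    div_le_iff₀ hy]
  calc Real.log b ≤ c * (2 * η * Real.log n ^ 2) := hlog
    _ ≤ (c + 1) * (2 * η * Real.log n ^ 2) := by gcongr; linarith
    _ = ε * Real.log n * Real.log n := by rw [hη]; field_simp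

/-! ### Planted cliques and the main theorem -/

/-- The planted distribution is a mean over the planted sets, so a lower bound valid for every `S`
and every `G` passes to the integral. -/
theorem le_lintegral_plantedClique {n κ : ℕ} (hκ : κ ≤ n) {F : SimpleGraph (Fin n) → ℝ≥0∞}
    {a : ℝ≥0∞} (h : ∀ (S : Finset (Fin n)) (G : SimpleGraph (Fin n)), S.card = κ →
      a ≤ F (G ⊔ cliqueOn S)) : a ≤ ∫⁻ G, F G ∂(plantedClique n κ) := by
  rw [plantedClique, lintegral_smul_measure, lintegral_finsetSum_measure]
  have h1 : ∀ S ∈ (Finset.univ : Finset (Fin n)).powersetCard κ,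
      a ≤ ∫⁻ G, F G ∂((erdosRenyiHalf n).map fun G => G ⊔ cliqueOn S) := by
    intro S hS
    rw [lintegral_map .of_discrete .of_discrete]
    calc a = ∫⁻ _, a ∂(erdosRenyiHalf n) := by simp
      _ ≤ _ := lintegral_mono fun G => h S G (Finset.mem_powersetCard.1 hS).2
  have h2 := Finset.card_nsmul_le_sum _ _ _ h1
  rw [Finset.card_powersetCard, Finset.card_univ, Fintype.card_fin, nsmul_eq_mul] at h2
  have h3 : (n.choose κ : ℝ≥0∞) ≠ 0 := by
    exact_mod_cast (Nat.choose_pos hκ).ne'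
  calc a = (n.choose κ : ℝ≥0∞)⁻¹ * (n.choose κ * a) := by
        rw [← mul_assoc, ENNReal.inv_mul_cancel h3 (by simp), one_mul]
    _ ≤ _ := by
        rw [smul_eq_mul]
        gcongr

/-- Each of the `n` indices contributes at most `11 / n ^ 2`, and `11 / n ≤ 1 / 3` from `n = 33` on.
-/
theorem sum_error_le {n : ℕ} (hn : 33 ≤ n) {a : ℕ} (ha : a ≤ 2) :
    ∑ _j ∈ Finset.range n, ((a : ℝ≥0∞) / (n ^ 2 : ℕ) + 9 / (n ^ 2 : ℕ)) ≤ 1 / 3 := by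
  rw [Finset.sum_const, Finset.card_range, nsmul_eq_mul, ENNReal.div_add_div_same, ← mul_div_assoc]
  have := ENNReal.natCast_div_le_one_div (X := n * (a + 9)) (Y := n ^ 2) (Z := 3) (by positivity)
    (by norm_num) (by nlinarith)
  push_cast at this ⊢
  exact this

/-- Under the Strongish Planted Clique Hypothesis, for every choice of patterns `H i` with `k i`
nodes, `k i → ∞`, no algorithm solves induced pattern detection for these patterns on `n`-vertex
graphs in time `f(k) * n ^ o(k)`, for any function `f`. The pattern may be presented to the
algorithm in any way that can be computed from `i`: by the index alone (`code = BTree.ofNat`, for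
an arbitrary sequence of patterns), or explicitly (`code i = BTree.ofGraph (H i)`, for a computable
sequence of patterns). -/
theorem mainTheorem3 (hSPCH : StrongishPlantedCliqueHypothesis)
    (k : ℕ → ℕ) (hk : Tendsto k atTop atTop) (H : ∀ i, SimpleGraph (Fin (k i)))
    (code : ℕ → BTree) (hcode : ∃ E : Prog, ∀ i, E.Outputs (BTree.ofNat i) (code i)) :
    ¬ ∃ (A : Prog) (f : ℕ → ℝ) (g : ℕ → ℝ),
      g =o[atTop] (fun m : ℕ => (m : ℝ)) ∧
      SolvesInducedDetection A H code (fun i n => f (k i) * (n : ℝ) ^ g (k i)) := by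
  classical
  rintro ⟨A, f, g, hg, hA⟩
  obtain ⟨δ, hδ0, hδ1, hno⟩ := hSPCH
  obtain ⟨E, hE⟩ := hcode
  obtain ⟨d, C, hparams⟩ := exists_reduction_params hδ0
  obtain ⟨P, c, K, Q, hP⟩ := exists_distinguisher (Prog.fn_of_outputs hE) hA d C
  -- With the exponent `h n = logb n (bestTime n)`, the bound `n ^ h n` is exactly `bestTime n` for
  -- `n ≥ 2`; nothing about `h` has to be computable.
  refine hno ⟨P, _, isLittleO_logb_bestTime d C c K hk f hg, ?_⟩
  -- A single fixed index guarantees that the set defining `bestTime` is nonempty for all large `n`.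
  obtain ⟨i, hi⟩ := (hk.eventually_ge_atTop 16).exists
  filter_upwards [hparams, eventually_sizeOK hi, eventually_ge_atTop 33] with n hn hs hn33
  have hn0 : NeZero n := ⟨by omega⟩
  have hn1 : (1 : ℝ) ≤ n := by exact_mod_cast (by omega : 1 ≤ n)
  have hne : ∀ j, sizeOK (k j) n = true → NeZero (k j) := by
    intro j hj
    simp only [sizeOK, Bool.and_eq_true, decide_eq_true_eq] at hj
    exact ⟨by omega⟩
  refine ⟨fun G => ?_, ?_, ?_⟩
  · obtain ⟨j, hj, hjs, hb⟩ := Nat.sInf_mem (s := {m | ∃ i < n, sizeOK (k i) n = true ∧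
      m = baseTime d C K k (fun i n => f (k i) * (n : ℝ) ^ g (k i)) i n ^ c})
      ⟨_, i, hs.1, hs.2, rfl⟩
    have h1 := (hP n hn0 G j hj hjs).1
    rw [← hb] at h1
    refine Prog.haltsWithin_iff.2 ⟨_, ?_, h1⟩
    have hpos : (0 : ℝ) < (bestTime d C c K k (fun i n => f (k i) * (n : ℝ) ^ g (k i)) n : ℕ) := by
      rw [bestTime, hb]
      exact_mod_cast Nat.pow_pos (by unfold baseTime; omega)
    rw [Real.rpow_logb (by linarith) (by exact_mod_cast (by omega : n ≠ 1)) hpos]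
    exact le_rfl
  · have hκ : ⌈(n : ℝ) ^ δ⌉₊ ≤ n := by
      rw [Nat.ceil_le]
      calc (n : ℝ) ^ δ ≤ (n : ℝ) ^ (1 : ℝ) := Real.rpow_le_rpow_of_exponent_le hn1 (by linarith)
        _ = n := Real.rpow_one _
    refine le_lintegral_plantedClique hκ fun S G hS => ?_
    -- On the planted side the error is small for every `G`, by the randomness of the tuples alone,
    -- so a constant `ε` is enough.
    have h1 := ((hP n hn0 (G ⊔ cliqueOn S) i hs.1 hs.2).2
      fun _ => ((1 : ℕ) : ℝ≥0∞) / (n ^ 2 : ℕ)).2 fun j hj hj0 hjs => by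
        rw [Nat.cast_one]
        exact (hn hn0 (k j) hj0 hjs (Q j)).2 S G hS
    have h2 := h1.trans (add_le_add_right (sum_error_le hn33 (by norm_num)) _)
    have h3 : (2 / 3 : ℝ≥0∞) + 1 / 3 = 1 := by
      rw [ENNReal.div_add_div_same]
      norm_num
      exact ENNReal.div_self (by simp) (by simp)
    exact (ENNReal.add_le_add_iff_right (by simp)).1 (h3.le.trans h2)
  -- Without a planted clique individual graphs may be bad. The error has to depend on `G`, and only
  -- its integral is small.
  · set ε : SimpleGraph (Fin n) → ℕ → ℝ≥0∞ := fun G j => if h : sizeOK (k j) n = true then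
      haveI := hne j h
      Prog.avg (numPicks d C (k j) n * n) (fun w => if (Q j).IsIndContained
        (instGraph (Q j) G (numTuples d C (k j) n * k j) (tupleLen d C (k j) n) (seqOf n w))
          then 1 else 0) else 0 with hε
    calc ∫⁻ G, P.acceptProb (BTree.ofGraph G) ∂(erdosRenyiHalf n)
        ≤ ∫⁻ G, ∑ j ∈ Finset.range n, (ε G j + 9 / (n ^ 2 : ℕ)) ∂(erdosRenyiHalf n) := by
          refine lintegral_mono fun G => ?_
          refine ((hP n hn0 G i hs.1 hs.2).2 (ε G)).1 fun j hj hj0 hjs => ?_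
          simp only [hε, hjs, dif_pos]
          exact le_rfl
      _ = ∑ j ∈ Finset.range n, (∫⁻ G, ε G j ∂(erdosRenyiHalf n) + 9 / (n ^ 2 : ℕ)) := by
          rw [lintegral_finsetSum _ fun _ _ => .of_discrete]
          refine Finset.sum_congr rfl fun j _ => ?_
          rw [lintegral_add_left .of_discrete]
          simp
      _ ≤ ∑ j ∈ Finset.range n, (((2 : ℕ) : ℝ≥0∞) / (n ^ 2 : ℕ) + 9 / (n ^ 2 : ℕ)) := by
          refine Finset.sum_le_sum fun j _ => add_le_add_left ?_ _
          by_cases hjs : sizeOK (k j) n = true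
          · simp only [hε, hjs, dif_pos]
            exact (hn hn0 (k j) (hne j hjs) hjs (Q j)).1
          · simp [hε, hjs]
      _ ≤ 1 / 3 := sum_error_le hn33 le_rfl
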